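/- Consider the class of equations $$(*)\qquad u_{tt}=u_{xx}-u^{-1}u_x^2+A(x)u_x+B(x)\,u\ln|u|+u\,D(t,x)$$ on regions $J\times I\times U$ of $(t,x,u)$-space, where $J,I\subseteq\mathbb R$ are nonempty open intervals, $U$ is $(0,\infty)$ or $(-\infty,0)$, and $A,B\in C^\infty(I)$, $D\in C^\infty(J\times I)$. The maximal invariance algebra of $(*)$ is the Lie algebra of all smooth vector fields $\tau\partial_t+\xi\partial_x+\eta\partial_u$ on $J\times I\times U$ satisfying Lie's infinitesimal invariance criterion. Two equations are equivalent if a transformation $\bar t=kt+k_1$, $\bar x=\epsilon kx+k_2$, $v=X(x)u+Y(t,x)$ ($k\ne0$, $\epsilon=\pm1$, $X,Y$ smooth, $X\neq0$ on $I$) maps the region of the first onto that of the second and the first equation into the second. For commutation relations of a basis $e_1,e_2,e_3$ (those not listed are zero) write: $A_{3.1}$: none; $A_{3.2}$: $[e_1,e_2]=e_2$; $A_{3.3}$: $[e_2,e_3]=e_1$; $A_{3.4}$: $[e_1,e_3]=e_1$, $[e_2,e_3]=e_1+e_2$; $A_{3.6}$: $[e_1,e_3]=e_1$, $[e_2,e_3]=-e_2$;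 $A_{3.7}$: $[e_1,e_3]=e_1$, $[e_2,e_3]=qe_2$ with $0<|q|<1$; $A_{3.8}$: $[e_1,e_3]=-e_2$, $[e_2,e_3]=e_1$; $A_{3.9}$: $[e_1,e_3]=qe_1-e_2$, $[e_2,e_3]=e_1+qe_2$ with $q>0$. For functions $f,\varphi$ of $x$ put $\sigma=f'\varphi-f\varphi'$, $\rho=\varphi'f''-\varphi''f'$. **1.** For every equation $(*)$ there are $f,\varphi\in C^\infty(I)$ with $\sigma\ne0$ on $I$, $A=-\sigma^{-1}\sigma'$, $B=\sigma^{-1}\rho$, and $fu\partial_u$, $\varphi u\partial_u$ belong to the maximal invariance algebra. For generic $(A,B,D)$ (all triples in an open dense set for the topology of uniform convergence of all derivatives on compact sets), and every such $f,\varphi$, the maximal invariance algebra is the two-dimensional abelian algebra $A^{13}_{2.1}=\langle fu\partial_u,\varphi u\partial_u\rangle$. **2.** If the maximal invariance algebra of an equation $(*)$ is three-dimensional, then it is of the type $A_{3.i}$ named in one of the following items, and the equation is equivalent to an equation of that item whose maximal invariance algebra is the algebra $A_3$ given there. Moreover, each equation of the list admits the given $A_3$, and $A_3$ has the given type; and equations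 of different items (with maximal invariance algebra $A_3$ as given) are not equivalent. **I.** $A_{3.1}$: $A_3=\langle\partial_t,fu\partial_u,\varphi u\partial_u\rangle$; $A=-\sigma^{-1}\sigma'$, $B=\sigma^{-1}\rho$, $D=0$, $\sigma\ne0$ on $I$. **II.** $A_{3.1}$: $A_3=\langle fu\partial_u,\varphi u\partial_u,\partial_t+\psi(x)u\partial_u\rangle$; $A=-\sigma^{-1}\sigma'$, $B=\sigma^{-1}\rho$, $\sigma\neq0$ on $I$, $D=t\sigma^{-1}[\sigma'\psi'-\psi\rho-\sigma\psi'']$, where none of $f'\psi-f\psi'$, $\varphi'\psi-\varphi\psi'$, $D$ vanishes identically. **III.** $D=x^{-2}G(t/x)$, $G\not\equiv0$ smooth, $A=nx^{-1}$, $B=mx^{-2}$ (these identities hold at all $x\in I$, $x\ne0$; the region can contain points with $x=0$ only if $n=m=0$), $A_3=\langle t\partial_t+x\partial_x,\ h_1u\partial_u,\ h_2u\partial_u\rangle$ with 1. $A_{3.2}$: $n\ne1$, $m=0$; $h_1=1$, $h_2=|x|^{1-n}$ (read as $x|x|^{-n}$, i.e. as $x$ when $n=0$; this is $|x|^{1-n}$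 up to sign where $x\neq 0$); 2. $A_{3.3}$: $n=1$, $m=0$; $1$, $\ln|x|$; 3. $A_{3.4}$: $n=0$, $m=\frac14$; $\sqrt{|x|}$, $\sqrt{|x|}\ln|x|$; 4. $A_{3.9}$: $n=0$, $m>\frac14$, $\beta=\sqrt{4m-1}$; $\sqrt{|x|}\cos(\frac12\beta\ln|x|)$, $\sqrt{|x|}\sin(\frac12\beta\ln|x|)$; 5. $A_{3.7}$: $n=0$, $m<\frac14$, $m\neq0$, $\beta=\sqrt{1-4m}$; $\sqrt{|x|}^{\,1+\beta}$, $\sqrt{|x|}^{\,1-\beta}$; 6. $A_{3.8}$: $n=1$, $m>0$; $\cos(\sqrt m\ln|x|)$, $\sin(\sqrt m\ln|x|)$; 7. $A_{3.6}$: $n=1$, $m<0$; $|x|^{\sqrt{|m|}}$, $|x|^{-\sqrt{|m|}}$; 8. $A_{3.4}$: $n\ne0,1$, $m=\frac14(n-1)^2$; $\sqrt{|x|}^{\,1-n}$, $\sqrt{|x|}^{\,1-n}\ln|x|$; 9. $A_{3.9}$: $n\neq0,1$, $m>\frac14(n-1)^2$, $\beta=\sqrt{4m-(n-1)^2}$;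 $\sqrt{|x|}^{\,1-n}\cos(\frac12\beta\ln|x|)$, $\sqrt{|x|}^{\,1-n}\sin(\frac12\beta\ln|x|)$; 10. $A_{3.7}$: $n\ne0,1$, $m<\frac14(n-1)^2$, $m\ne0$, $\beta=\sqrt{(n-1)^2-4m}$; $\sqrt{|x|}^{\,1-\beta-n}$, $\sqrt{|x|}^{\,1-n+\beta}$. **IV.** $D=G(t)$, $G$ smooth, $A=n$, $B=m$ constant, $A_3=\langle\partial_x,h_1u\partial_u,h_2u\partial_u\rangle$ with 1. $A_{3.3}$: $n=m=0$; $1$, $x$; 2. $A_{3.2}$: $n=-1$, $m=0$; $1$, $e^x$; 3. $A_{3.8}$: $n=0$, $m=1$; $\cos x$, $\sin x$; 4. $A_{3.6}$: $n=0$, $m=-1$; $e^x$, $e^{-x}$; 5. $A_{3.4}$: $n=-1$, $m=\frac14$; $e^{x/2}$, $xe^{x/2}$; 6. $A_{3.7}$: $n=-1$, $m<\frac14$, $m\ne0$, $\beta=\sqrt{1-4m}$; $e^{(1+\beta)x/2}$, $e^{(1-\beta)x/2}$; 7. $A_{3.9}$: $n=-1$, $m>\frac14$, $\beta=\sqrt{4m-1}$;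 $e^{x/2}\cos(\frac12\beta x)$, $e^{x/2}\sin(\frac12\beta x)$. **V.** $D=G(x-kt)$, $k>0$, $G$ smooth, $A_3=\langle\partial_t+k\partial_x,h_1u\partial_u,h_2u\partial_u\rangle$ with the same seven items 1–7 for $A=n$, $B=m$, the types, $h_1$ and $h_2$ as in IV. -/

import Mathlib

namespace WaveClassification

open Set
open scoped ContDiff

/-! ### Vector fields, prolongation, and Lie's infinitesimal invariance criterion -/

/-- A vector field `τ ∂_t + ξ ∂_x + η ∂_u` in the variables `(t, x, u)`, as the triple `(τ, ξ, η)`. -/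
abbrev VF : Type := ℝ × ℝ × ℝ → ℝ × ℝ × ℝ

/-- `(D_t τ, D_t ξ, D_t η)` at `(t, x, u, p, q)`, where `p = u_t`, `q = u_x`. -/
noncomputable def totalT (v : VF) (j : ℝ × ℝ × ℝ × ℝ × ℝ) : ℝ × ℝ × ℝ :=
  fderiv ℝ v (j.1, j.2.1, j.2.2.1) (1, 0, j.2.2.2.1)

/-- `(D_x τ, D_x ξ, D_x η)` at `(t, x, u, p, q)`, where `p = u_t`, `q = u_x`. -/
noncomputable def totalX (v : VF) (j : ℝ × ℝ × ℝ × ℝ × ℝ) : ℝ × ℝ × ℝ :=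
  fderiv ℝ v (j.1, j.2.1, j.2.2.1) (0, 1, j.2.2.2.2)

/-- `φ^t = D_t η - u_t D_t τ - u_x D_t ξ`, a function on the first jet space. -/
noncomputable def prolT (v : VF) (j : ℝ × ℝ × ℝ × ℝ × ℝ) : ℝ :=
  (totalT v j).2.2 - j.2.2.2.1 * (totalT v j).1 - j.2.2.2.2 * (totalT v j).2.1

/-- `φ^x = D_x η - u_t D_x τ - u_x D_x ξ`, a function on the first jet space. -/
noncomputable def prolX (v : VF) (j : ℝ × ℝ × ℝ × ℝ × ℝ) : ℝ :=
  (totalX v j).2.2 - j.2.2.2.1 * (totalX v j).1 - j.2.2.2.2 * (totalX v j).2.1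

/-- `φ^tt = D_t φ^t - u_tt D_t τ - u_tx D_t ξ`, where `a = u_tt`, `b = u_tx`. -/
noncomputable def prolTT (v : VF) (j : ℝ × ℝ × ℝ × ℝ × ℝ) (a b : ℝ) : ℝ :=
  fderiv ℝ (prolT v) j (1, 0, j.2.2.2.1, a, b) - a * (totalT v j).1 - b * (totalT v j).2.1

/-- `φ^xx = D_x φ^x - u_tx D_x τ - u_xx D_x ξ`, where `b = u_tx`, `c = u_xx`. -/
noncomputable def prolXX (v : VF) (j : ℝ × ℝ × ℝ × ℝ × ℝ) (b c : ℝ) : ℝ :=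
  fderiv ℝ (prolX v) j (0, 1, j.2.2.2.2, b, c) - b * (totalX v j).1 - c * (totalX v j).2.1

/-- `v` is an infinitesimal symmetry on `Ω` of `u_tt = u_xx + F(t, x, u, u_x)`: it is smooth on `Ω`
(and, so that fields on `Ω` are counted once, extended by zero), and
`φ^tt - φ^xx - τ F_t - ξ F_x - η F_u - φ^x F_{u_x} = 0` whenever `u_tt = u_xx + F`. -/
def IsSymmetry (Ω : Set (ℝ × ℝ × ℝ)) (F : ℝ × ℝ × ℝ × ℝ → ℝ) (v : VF) : Prop :=
  (∀ z, z ∉ Ω → v z = 0) ∧ ContDiffOn ℝ ∞ v Ω ∧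
    ∀ t x u, (t, x, u) ∈ Ω → ∀ p q b c : ℝ,
      prolTT v (t, x, u, p, q) (c + F (t, x, u, q)) b - prolXX v (t, x, u, p, q) b c
        - fderiv ℝ F (t, x, u, q)
            ((v (t, x, u)).1, (v (t, x, u)).2.1, (v (t, x, u)).2.2, prolX v (t, x, u, p, q)) = 0

section Linearity

variable {Ω : Set (ℝ × ℝ × ℝ)} {v w : VF}

lemma differentiableAt_of {z : ℝ × ℝ × ℝ} (hΩ : IsOpen Ω) (hv : ContDiffOn ℝ ∞ v Ω) (hz : z ∈ Ω) :
    DifferentiableAt ℝ v z :=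
  (hv.contDiffAt (hΩ.mem_nhds hz)).differentiableAt (by simp)

lemma differentiableAt_fderiv_comp {j : ℝ × ℝ × ℝ × ℝ × ℝ} (hΩ : IsOpen Ω)
    (hv : ContDiffOn ℝ ∞ v Ω) (hj : (j.1, j.2.1, j.2.2.1) ∈ Ω) :
    DifferentiableAt ℝ (fun j : ℝ × ℝ × ℝ × ℝ × ℝ => fderiv ℝ v (j.1, j.2.1, j.2.2.1)) j := by
  have h1 : DifferentiableAt ℝ (fderiv ℝ v) (j.1, j.2.1, j.2.2.1) :=
    ((hv.contDiffAt (hΩ.mem_nhds hj)).fderiv_right (m := 1) (by norm_cast)).differentiableAt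
      (by simp)
  exact h1.comp j (f := fun j : ℝ × ℝ × ℝ × ℝ × ℝ => (j.1, j.2.1, j.2.2.1)) (by fun_prop)

lemma differentiableAt_prolT {j : ℝ × ℝ × ℝ × ℝ × ℝ} (hΩ : IsOpen Ω)
    (hv : ContDiffOn ℝ ∞ v Ω) (hj : (j.1, j.2.1, j.2.2.1) ∈ Ω) :
    DifferentiableAt ℝ (prolT v) j := by
  have h := differentiableAt_fderiv_comp hΩ hv hj
  unfold prolT totalT
  fun_prop

lemma differentiableAt_prolX {j : ℝ × ℝ × ℝ × ℝ × ℝ} (hΩ : IsOpen Ω)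
    (hv : ContDiffOn ℝ ∞ v Ω) (hj : (j.1, j.2.1, j.2.2.1) ∈ Ω) :
    DifferentiableAt ℝ (prolX v) j := by
  have h := differentiableAt_fderiv_comp hΩ hv hj
  unfold prolX totalX
  fun_prop

lemma totalT_comb {j : ℝ × ℝ × ℝ × ℝ × ℝ} (hΩ : IsOpen Ω) (hv : ContDiffOn ℝ ∞ v Ω)
    (hw : ContDiffOn ℝ ∞ w Ω) (hj : (j.1, j.2.1, j.2.2.1) ∈ Ω) (r : ℝ) :
    totalT (r • v + w) j = r • totalT v j + totalT w j := by
  have h1 := differentiableAt_of hΩ hv hj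
  have h2 := differentiableAt_of hΩ hw hj
  simp only [totalT]
  rw [fderiv_add (h1.const_smul r) h2, fderiv_const_smul h1]
  rfl

lemma totalX_comb {j : ℝ × ℝ × ℝ × ℝ × ℝ} (hΩ : IsOpen Ω) (hv : ContDiffOn ℝ ∞ v Ω)
    (hw : ContDiffOn ℝ ∞ w Ω) (hj : (j.1, j.2.1, j.2.2.1) ∈ Ω) (r : ℝ) :
    totalX (r • v + w) j = r • totalX v j + totalX w j := by
  have h1 := differentiableAt_of hΩ hv hj
  have h2 := differentiableAt_of hΩ hw hj
  simp only [totalX]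
  rw [fderiv_add (h1.const_smul r) h2, fderiv_const_smul h1]
  rfl

lemma prolX_comb {j : ℝ × ℝ × ℝ × ℝ × ℝ} (hΩ : IsOpen Ω) (hv : ContDiffOn ℝ ∞ v Ω)
    (hw : ContDiffOn ℝ ∞ w Ω) (hj : (j.1, j.2.1, j.2.2.1) ∈ Ω) (r : ℝ) :
    prolX (r • v + w) j = r • prolX v j + prolX w j := by
  simp only [prolX, totalX_comb hΩ hv hw hj r, Prod.fst_add, Prod.snd_add, Prod.smul_fst,
    Prod.smul_snd, smul_eq_mul]
  ring

lemma prolT_comb {j : ℝ × ℝ × ℝ × ℝ × ℝ} (hΩ : IsOpen Ω) (hv : ContDiffOn ℝ ∞ v Ω)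
    (hw : ContDiffOn ℝ ∞ w Ω) (hj : (j.1, j.2.1, j.2.2.1) ∈ Ω) (r : ℝ) :
    prolT (r • v + w) j = r • prolT v j + prolT w j := by
  simp only [prolT, totalT_comb hΩ hv hw hj r, Prod.fst_add, Prod.snd_add, Prod.smul_fst,
    Prod.smul_snd, smul_eq_mul]
  ring

lemma eventually_mem {j : ℝ × ℝ × ℝ × ℝ × ℝ} (hΩ : IsOpen Ω)
    (hj : (j.1, j.2.1, j.2.2.1) ∈ Ω) :
    ∀ᶠ i : ℝ × ℝ × ℝ × ℝ × ℝ in nhds j, (i.1, i.2.1, i.2.2.1) ∈ Ω := by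
  have hc : Continuous fun i : ℝ × ℝ × ℝ × ℝ × ℝ => (i.1, i.2.1, i.2.2.1) := by fun_prop
  exact hc.continuousAt.eventually (hΩ.mem_nhds hj)

lemma prolTT_comb {j : ℝ × ℝ × ℝ × ℝ × ℝ} (hΩ : IsOpen Ω) (hv : ContDiffOn ℝ ∞ v Ω)
    (hw : ContDiffOn ℝ ∞ w Ω) (hj : (j.1, j.2.1, j.2.2.1) ∈ Ω) (r a b : ℝ) :
    prolTT (r • v + w) j a b = r • prolTT v j a b + prolTT w j a b := by
  have he : prolT (r • v + w) =ᶠ[nhds j] r • prolT v + prolT w := by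
    filter_upwards [eventually_mem hΩ hj] with i hi
    simpa using prolT_comb hΩ hv hw hi r
  have h1 := differentiableAt_prolT hΩ hv hj
  have h2 := differentiableAt_prolT hΩ hw hj
  simp only [prolTT, totalT_comb hΩ hv hw hj r, he.fderiv_eq]
  rw [fderiv_add (h1.const_smul r) h2, fderiv_const_smul h1]
  simp only [add_apply, smul_apply, Prod.fst_add,
    Prod.snd_add, Prod.smul_fst, Prod.smul_snd, smul_eq_mul]
  ring

lemma prolXX_comb {j : ℝ × ℝ × ℝ × ℝ × ℝ} (hΩ : IsOpen Ω) (hv : ContDiffOn ℝ ∞ v Ω)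
    (hw : ContDiffOn ℝ ∞ w Ω) (hj : (j.1, j.2.1, j.2.2.1) ∈ Ω) (r b c : ℝ) :
    prolXX (r • v + w) j b c = r • prolXX v j b c + prolXX w j b c := by
  have he : prolX (r • v + w) =ᶠ[nhds j] r • prolX v + prolX w := by
    filter_upwards [eventually_mem hΩ hj] with i hi
    simpa using prolX_comb hΩ hv hw hi r
  have h1 := differentiableAt_prolX hΩ hv hj
  have h2 := differentiableAt_prolX hΩ hw hj
  simp only [prolXX, totalX_comb hΩ hv hw hj r, he.fderiv_eq]
  rw [fderiv_add (h1.const_smul r) h2, fderiv_const_smul h1]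
  simp only [add_apply, smul_apply, Prod.fst_add,
    Prod.snd_add, Prod.smul_fst, Prod.smul_snd, smul_eq_mul]
  ring

lemma IsSymmetry.comb {F : ℝ × ℝ × ℝ × ℝ → ℝ} (hΩ : IsOpen Ω) (hv : IsSymmetry Ω F v)
    (hw : IsSymmetry Ω F w) (r : ℝ) : IsSymmetry Ω F (r • v + w) := by
  refine ⟨fun z hz => by simp [hv.1 z hz, hw.1 z hz], ?_, ?_⟩
  · exact (hv.2.1.const_smul r).add hw.2.1
  · intro t x u hz p q b c
    have e1 := hv.2.2 t x u hz p q b c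
    have e2 := hw.2.2 t x u hz p q b c
    have hj : (((t, x, u, p, q) : ℝ × ℝ × ℝ × ℝ × ℝ).1, ((t, x, u, p, q) : ℝ × ℝ × ℝ × ℝ × ℝ).2.1,
      ((t, x, u, p, q) : ℝ × ℝ × ℝ × ℝ × ℝ).2.2.1) ∈ Ω := hz
    rw [prolTT_comb hΩ hv.2.1 hw.2.1 hj, prolXX_comb hΩ hv.2.1 hw.2.1 hj,
      prolX_comb hΩ hv.2.1 hw.2.1 hj]
    have hvec : ((((r • v + w) (t, x, u)).1, ((r • v + w) (t, x, u)).2.1,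
        ((r • v + w) (t, x, u)).2.2,
        r • prolX v (t, x, u, p, q) + prolX w (t, x, u, p, q)) : ℝ × ℝ × ℝ × ℝ)
        = r • ((v (t, x, u)).1, (v (t, x, u)).2.1, (v (t, x, u)).2.2, prolX v (t, x, u, p, q))
          + ((w (t, x, u)).1, (w (t, x, u)).2.1, (w (t, x, u)).2.2, prolX w (t, x, u, p, q)) := rfl
    rw [hvec, map_add, map_smul]
    simp only [smul_eq_mul]
    linear_combination r * e1 + e2

lemma IsSymmetry.zero {F : ℝ × ℝ × ℝ × ℝ → ℝ} : IsSymmetry Ω F 0 := by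
  have hX : prolX (0 : VF) = 0 := by
    funext j; simp [prolX, totalX]
  have hT : prolT (0 : VF) = 0 := by
    funext j; simp [prolT, totalT]
  refine ⟨fun _ _ => rfl, contDiffOn_const, ?_⟩
  intro t x u _ p q b c
  have h0 : fderiv ℝ F (t, x, u, q) (0, 0, 0, 0) = 0 := map_zero _
  simp [prolTT, prolXX, hX, hT, totalT, totalX, h0]

end Linearity

/-- The maximal invariance algebra of `u_tt = u_xx + F` on the open set `Ω`. -/
noncomputable def maxAlgebra (Ω : Set (ℝ × ℝ × ℝ)) (hΩ : IsOpen Ω) (F : ℝ × ℝ × ℝ × ℝ → ℝ) :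
    Submodule ℝ VF where
  carrier := {v | IsSymmetry Ω F v}
  zero_mem' := IsSymmetry.zero
  add_mem' {v w} hv hw := by
    have h := IsSymmetry.comb hΩ hv hw 1
    rwa [one_smul] at h
  smul_mem' r v hv := by
    have h := IsSymmetry.comb hΩ hv IsSymmetry.zero r
    rwa [add_zero] at h

/-! ### The class `u_tt = u_xx - u⁻¹ u_x² + A(x) u_x + B(x) u ln|u| + u D(t,x)` -/

/-- A region `J × I × U`: `t` and `x` range over nonempty open intervals `J` and `I`, and `u` over
one of the two half-lines `u > 0`, `u < 0`. -/
structure Region where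
  J : Set ℝ
  I : Set ℝ
  U : Set ℝ
  isOpen_J : IsOpen J
  ordConnected_J : J.OrdConnected
  nonempty_J : J.Nonempty
  isOpen_I : IsOpen I
  ordConnected_I : I.OrdConnected
  nonempty_I : I.Nonempty
  U_eq : U = Ioi 0 ∨ U = Iio 0

/-- The open set `J × I × U` of the space of the variables `(t, x, u)`. -/
def Region.Ω (R : Region) : Set (ℝ × ℝ × ℝ) := R.J ×ˢ R.I ×ˢ R.U

lemma Region.isOpen_Ω (R : Region) : IsOpen R.Ω := by
  refine R.isOpen_J.prod (R.isOpen_I.prod ?_)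
  rcases R.U_eq with h | h
  · rw [h]; exact isOpen_Ioi
  · rw [h]; exact isOpen_Iio

/-- An equation of the class on `R`, given by its smooth coefficients `A(x)`, `B(x)`, `D(t,x)`. -/
structure Equation (R : Region) where
  A : ℝ → ℝ
  B : ℝ → ℝ
  D : ℝ × ℝ → ℝ
  smooth_A : ContDiffOn ℝ ∞ A R.I
  smooth_B : ContDiffOn ℝ ∞ B R.I
  smooth_D : ContDiffOn ℝ ∞ D (R.J ×ˢ R.I)

namespace Equation

variable {R : Region}

/-- The nonlinearity `F(t, x, u, q) = -u⁻¹ q² + A(x) q + B(x) u ln|u| + u D(t,x)`, `q = u_x`. -/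
noncomputable def F (E : Equation R) (y : ℝ × ℝ × ℝ × ℝ) : ℝ :=
  -(y.2.2.1)⁻¹ * y.2.2.2 ^ 2 + E.A y.2.1 * y.2.2.2 + E.B y.2.1 * y.2.2.1 * Real.log |y.2.2.1|
    + y.2.2.1 * E.D (y.1, y.2.1)

/-- The maximal invariance algebra of the equation. -/
noncomputable def maxAlg (E : Equation R) : Submodule ℝ VF := maxAlgebra R.Ω R.isOpen_Ω E.F

/-- The coefficients of `E'` and `E` and their derivatives up to order `N` differ by less than `δ`
on `K` (for `A` and `B`) and on `L` (for `D`). -/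
def Near (N : ℕ) (K : Set ℝ) (L : Set (ℝ × ℝ)) (δ : ℝ) (E E' : Equation R) : Prop :=
  ∀ n ≤ N,
    (∀ x ∈ K, ‖iteratedFDeriv ℝ n E'.A x - iteratedFDeriv ℝ n E.A x‖ < δ ∧
      ‖iteratedFDeriv ℝ n E'.B x - iteratedFDeriv ℝ n E.B x‖ < δ) ∧
    ∀ y ∈ L, ‖iteratedFDeriv ℝ n E'.D y - iteratedFDeriv ℝ n E.D y‖ < δ

/-- The `C^∞` topology on the coefficient triples: uniform convergence of all derivatives on
compact subsets of `I` and of `J × I`. -/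
instance : TopologicalSpace (Equation R) where
  IsOpen S := ∀ E ∈ S, ∃ (N : ℕ) (K : Set ℝ) (L : Set (ℝ × ℝ)) (δ : ℝ), IsCompact K ∧ K ⊆ R.I ∧
    IsCompact L ∧ L ⊆ R.J ×ˢ R.I ∧ 0 < δ ∧ ∀ E' : Equation R, Near N K L δ E E' → E' ∈ S
  isOpen_univ := fun _ _ => ⟨0, ∅, ∅, 1, isCompact_empty, empty_subset _, isCompact_empty,
    empty_subset _, one_pos, fun _ _ => mem_univ _⟩
  isOpen_inter := by
    intro S T hS hT E hE
    obtain ⟨N, K, L, δ, hK, hKI, hL, hLI, hδ, h⟩ := hS E hE.1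
    obtain ⟨N', K', L', δ', hK', hKI', hL', hLI', hδ', h'⟩ := hT E hE.2
    refine ⟨max N N', K ∪ K', L ∪ L', min δ δ', hK.union hK', union_subset hKI hKI',
      hL.union hL', union_subset hLI hLI', lt_min hδ hδ', fun E' hE' => ⟨h E' ?_, h' E' ?_⟩⟩
    · intro n hn
      obtain ⟨h1, h2⟩ := hE' n (hn.trans (le_max_left _ _))
      exact ⟨fun x hx => ⟨(h1 x (.inl hx)).1.trans_le (min_le_left _ _),
        (h1 x (.inl hx)).2.trans_le (min_le_left _ _)⟩,
        fun y hy => (h2 y (.inl hy)).trans_le (min_le_left _ _)⟩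
    · intro n hn
      obtain ⟨h1, h2⟩ := hE' n (hn.trans (le_max_right _ _))
      exact ⟨fun x hx => ⟨(h1 x (.inr hx)).1.trans_le (min_le_right _ _),
        (h1 x (.inr hx)).2.trans_le (min_le_right _ _)⟩,
        fun y hy => (h2 y (.inr hy)).trans_le (min_le_right _ _)⟩
  isOpen_sUnion := by
    intro 𝒮 h𝒮 E hE
    obtain ⟨S, hS, hES⟩ := hE
    obtain ⟨N, K, L, δ, hK, hKI, hL, hLI, hδ, h⟩ := h𝒮 S hS E hES
    exact ⟨N, K, L, δ, hK, hKI, hL, hLI, hδ, fun E' hE' => ⟨S, hS, h E' hE'⟩⟩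

end Equation

/-! ### Equivalence -/

/-- An element of the equivalence group: `t' = k t + k₁`, `x' = ε k x + k₂`,
`v = X(x) u + Y(t,x)` with `k ≠ 0`, `ε = ±1` and `X`, `Y` smooth, `X ≠ 0`. -/
structure Transformation (R : Region) where
  k : ℝ
  k₁ : ℝ
  k₂ : ℝ
  ε : ℝ
  X : ℝ → ℝ
  Y : ℝ × ℝ → ℝ
  k_ne : k ≠ 0
  ε_eq : ε = 1 ∨ ε = -1
  smooth_X : ContDiffOn ℝ ∞ X R.I
  X_ne : ∀ x ∈ R.I, X x ≠ 0
  smooth_Y : ContDiffOn ℝ ∞ Y (R.J ×ˢ R.I)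

/-- The action on points `(t, x, u)`. -/
def Transformation.onPoint {R : Region} (T : Transformation R) (z : ℝ × ℝ × ℝ) : ℝ × ℝ × ℝ :=
  (T.k * z.1 + T.k₁, T.ε * T.k * z.2.1 + T.k₂, T.X z.2.1 * z.2.2 + T.Y (z.1, z.2.1))

/-- The action on functions: `v(t', x') = X(x) u(t,x) + Y(t,x)`. -/
noncomputable def Transformation.onFunction {R : Region} (T : Transformation R)
    (u : ℝ × ℝ → ℝ) (y : ℝ × ℝ) : ℝ :=
  T.X ((y.2 - T.k₂) / (T.ε * T.k)) * u ((y.1 - T.k₁) / T.k, (y.2 - T.k₂) / (T.ε * T.k))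
    + T.Y ((y.1 - T.k₁) / T.k, (y.2 - T.k₂) / (T.ε * T.k))

/-- The function `u` satisfies `u_tt = u_xx + F(t, x, u, u_x)` at the point `(t, x)`. -/
def SolvesAt (F : ℝ × ℝ × ℝ × ℝ → ℝ) (u : ℝ × ℝ → ℝ) (t x : ℝ) : Prop :=
  iteratedDeriv 2 (fun s => u (s, x)) t =
    iteratedDeriv 2 (fun y => u (t, y)) x + F (t, x, u (t, x), deriv (fun y => u (t, y)) x)

/-- Some transformation of the equivalence group maps the region of `E` onto that of `E'` and
takes the equation `E` to the equation `E'`. The second condition is stated pointwise (equivalently,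
for second-order jets), so it does not depend on which solutions exist on the whole region. -/
def Equivalent {R R' : Region} (E : Equation R) (E' : Equation R') : Prop :=
  ∃ T : Transformation R, T.onPoint '' R.Ω = R'.Ω ∧
    ∀ u : ℝ × ℝ → ℝ, ContDiff ℝ ∞ u → ∀ t x : ℝ, (t, x, u (t, x)) ∈ R.Ω →
      (SolvesAt E.F u t x ↔
        SolvesAt E'.F (T.onFunction u) (T.k * t + T.k₁) (T.ε * T.k * x + T.k₂))

/-! ### The solvable Lie algebras of dimension three that occur -/

/-- Isomorphism types of real three-dimensional Lie algebras. -/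
inductive LieType
  | A31 | A32 | A33 | A34 | A36 | A37 | A38 | A39

/-- The commutator of vector fields. -/
noncomputable abbrev bracket (v w : VF) : VF := VectorField.lieBracket ℝ v w

/-- The commutation relations that define the type, for a basis `e₁, e₂, e₃`. -/
def Relations (e₁ e₂ e₃ : VF) : LieType → Prop
  | .A31 => bracket e₁ e₂ = 0 ∧ bracket e₁ e₃ = 0 ∧ bracket e₂ e₃ = 0
  | .A32 => bracket e₁ e₂ = e₂ ∧ bracket e₁ e₃ = 0 ∧ bracket e₂ e₃ = 0
  | .A33 => bracket e₁ e₂ = 0 ∧ bracket e₁ e₃ = 0 ∧ bracket e₂ e₃ = e₁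
  | .A34 => bracket e₁ e₂ = 0 ∧ bracket e₁ e₃ = e₁ ∧ bracket e₂ e₃ = e₁ + e₂
  | .A36 => bracket e₁ e₂ = 0 ∧ bracket e₁ e₃ = e₁ ∧ bracket e₂ e₃ = -e₂
  | .A37 => ∃ q : ℝ, 0 < |q| ∧ |q| < 1 ∧
      bracket e₁ e₂ = 0 ∧ bracket e₁ e₃ = e₁ ∧ bracket e₂ e₃ = q • e₂
  | .A38 => bracket e₁ e₂ = 0 ∧ bracket e₁ e₃ = -e₂ ∧ bracket e₂ e₃ = e₁
  | .A39 => ∃ q : ℝ, 0 < q ∧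
      bracket e₁ e₂ = 0 ∧ bracket e₁ e₃ = q • e₁ - e₂ ∧ bracket e₂ e₃ = e₁ + q • e₂

/-- `L` is a three-dimensional Lie algebra of vector fields of the given isomorphism type. -/
def HasType (L : Submodule ℝ VF) (c : LieType) : Prop :=
  ∃ e₁ e₂ e₃ : VF, LinearIndependent ℝ ![e₁, e₂, e₃] ∧ Submodule.span ℝ {e₁, e₂, e₃} = L ∧
    Relations e₁ e₂ e₃ c

/-! ### The list of equations -/

/-- The operator `(l t + l₁) ∂_t + (l x + l₂) ∂_x + h(x) u ∂_u` on `R`. -/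
noncomputable def Region.op (R : Region) (l l₁ l₂ : ℝ) (h : ℝ → ℝ) : VF :=
  R.Ω.indicator fun z => (l * z.1 + l₁, l * z.2.1 + l₂, h z.2.1 * z.2.2)

/-- `h(x) u ∂_u` -/
noncomputable abbrev Region.mulU (R : Region) (h : ℝ → ℝ) : VF := R.op 0 0 0 h

/-- `t ∂_t + x ∂_x` -/
noncomputable abbrev Region.dil (R : Region) : VF := R.op 1 0 0 (fun _ => 0)

/-- `∂_t` -/
noncomputable abbrev Region.dt (R : Region) : VF := R.op 0 1 0 (fun _ => 0)

/-- `∂_x` -/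
noncomputable abbrev Region.dx (R : Region) : VF := R.op 0 0 1 (fun _ => 0)

/-- `f' g - f g'` -/
noncomputable def wr (f g : ℝ → ℝ) (x : ℝ) : ℝ := deriv f x * g x - f x * deriv g x

/-- `g' f'' - g'' f'` -/
noncomputable def rh (f g : ℝ → ℝ) (x : ℝ) : ℝ :=
  deriv g x * deriv (deriv f) x - deriv (deriv g) x * deriv f x

/-- `f, g` are smooth on `I`, `σ = f' g - f g'` vanishes nowhere, `A = -σ⁻¹ σ'` and
`B = σ⁻¹ (g' f'' - g'' f')`: the equation has the form of the equations invariant under the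
two-dimensional algebra spanned by `f(x) u ∂_u` and `g(x) u ∂_u`. -/
def InvariantForm {R : Region} (E : Equation R) (f g : ℝ → ℝ) : Prop :=
  ContDiffOn ℝ ∞ f R.I ∧ ContDiffOn ℝ ∞ g R.I ∧ ∀ x ∈ R.I, wr f g x ≠ 0 ∧
    E.A x = -(wr f g x)⁻¹ * deriv (wr f g) x ∧ E.B x = (wr f g x)⁻¹ * rh f g x

/-- The ten cases `A = n x⁻¹`, `B = m x⁻²`, with their types and the functions `h₁, h₂` in the
operators `h₁(x) u ∂_u`, `h₂(x) u ∂_u`. In the first case `x |x|^(-n)` is `|x|^(1-n)` up to sign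
for `x ≠ 0`, and for `n = 0` it is the smooth function `x`. -/
inductive EulerCase : ℕ → ℝ → ℝ → LieType → (ℝ → ℝ) → (ℝ → ℝ) → Prop
  | c1 (n : ℝ) (hn : n ≠ 1) :
      EulerCase 1 n 0 .A32 (fun _ => 1) (fun x => x * |x| ^ (-n))
  | c2 : EulerCase 2 1 0 .A33 (fun _ => 1) (fun x => Real.log |x|)
  | c3 : EulerCase 3 0 (1 / 4) .A34 (fun x => √|x|) (fun x => √|x| * Real.log |x|)
  | c4 (m β : ℝ) (hm : 1 / 4 < m) (hβ : β = √(4 * m - 1)) :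
      EulerCase 4 0 m .A39 (fun x => √|x| * Real.cos (1 / 2 * β * Real.log |x|))
        (fun x => √|x| * Real.sin (1 / 2 * β * Real.log |x|))
  | c5 (m β : ℝ) (hm : m < 1 / 4) (hm0 : m ≠ 0) (hβ : β = √(1 - 4 * m)) :
      EulerCase 5 0 m .A37 (fun x => √|x| ^ (1 + β)) (fun x => √|x| ^ (1 - β))
  | c6 (m : ℝ) (hm : 0 < m) :
      EulerCase 6 1 m .A38 (fun x => Real.cos (√m * Real.log |x|))
        (fun x => Real.sin (√m * Real.log |x|))
  | c7 (m : ℝ) (hm : m < 0) :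
      EulerCase 7 1 m .A36 (fun x => |x| ^ √|m|) (fun x => |x| ^ (-√|m|))
  | c8 (n : ℝ) (hn0 : n ≠ 0) (hn1 : n ≠ 1) :
      EulerCase 8 n (1 / 4 * (n - 1) ^ 2) .A34 (fun x => √|x| ^ (1 - n))
        (fun x => √|x| ^ (1 - n) * Real.log |x|)
  | c9 (n m β : ℝ) (hn0 : n ≠ 0) (hn1 : n ≠ 1) (hm : 1 / 4 * (n - 1) ^ 2 < m)
      (hβ : β = √(4 * m - (n - 1) ^ 2)) :
      EulerCase 9 n m .A39 (fun x => √|x| ^ (1 - n) * Real.cos (1 / 2 * β * Real.log |x|))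
        (fun x => √|x| ^ (1 - n) * Real.sin (1 / 2 * β * Real.log |x|))
  | c10 (n m β : ℝ) (hn0 : n ≠ 0) (hn1 : n ≠ 1) (hm : m < 1 / 4 * (n - 1) ^ 2) (hm0 : m ≠ 0)
      (hβ : β = √((n - 1) ^ 2 - 4 * m)) :
      EulerCase 10 n m .A37 (fun x => √|x| ^ (1 - β - n)) (fun x => √|x| ^ (1 - n + β))

/-- The seven cases with constant `A = n`, `B = m`, with their types and the functions `h₁, h₂` in
the operators `h₁(x) u ∂_u`, `h₂(x) u ∂_u`. -/
inductive ConstCase : ℕ → ℝ → ℝ → LieType → (ℝ → ℝ) → (ℝ → ℝ) → Prop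
  | c1 : ConstCase 1 0 0 .A33 (fun _ => 1) (fun x => x)
  | c2 : ConstCase 2 (-1) 0 .A32 (fun _ => 1) (fun x => Real.exp x)
  | c3 : ConstCase 3 0 1 .A38 (fun x => Real.cos x) (fun x => Real.sin x)
  | c4 : ConstCase 4 0 (-1) .A36 (fun x => Real.exp x) (fun x => Real.exp (-x))
  | c5 : ConstCase 5 (-1) (1 / 4) .A34 (fun x => Real.exp (1 / 2 * x))
      (fun x => Real.exp (1 / 2 * x) * x)
  | c6 (m β : ℝ) (hm : m < 1 / 4) (hm0 : m ≠ 0) (hβ : β = √(1 - 4 * m)) :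
      ConstCase 6 (-1) m .A37 (fun x => Real.exp (1 / 2 * (1 + β) * x))
        (fun x => Real.exp (1 / 2 * (1 - β) * x))
  | c7 (m β : ℝ) (hm : 1 / 4 < m) (hβ : β = √(4 * m - 1)) :
      ConstCase 7 (-1) m .A39 (fun x => Real.exp (1 / 2 * x) * Real.cos (1 / 2 * β * x))
        (fun x => Real.exp (1 / 2 * x) * Real.sin (1 / 2 * β * x))

/-- The items of the list. -/
inductive Item
  | I | II | III (i : ℕ) | IV (i : ℕ) | V (i : ℕ)

/-- `Listed E s c e₁ e₂ e₃`: the equation `E` is the one of item `s` of the list (for some values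
of the parameters and functions of that item), where the list gives the algebra `⟨e₁, e₂, e₃⟩` and
the type `c`. -/
inductive Listed {R : Region} (E : Equation R) : Item → LieType → VF → VF → VF → Prop
  | I (f φ : ℝ → ℝ) (hfφ : InvariantForm E f φ)
      (hD : ∀ t ∈ R.J, ∀ x ∈ R.I, E.D (t, x) = 0) :
      Listed E .I .A31 R.dt (R.mulU f) (R.mulU φ)
  | II (f φ ψ : ℝ → ℝ) (hfφ : InvariantForm E f φ) (hψ : ContDiffOn ℝ ∞ ψ R.I)
      (hD : ∀ t ∈ R.J, ∀ x ∈ R.I, E.D (t, x) = t * (wr f φ x)⁻¹ *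
        (deriv (wr f φ) x * deriv ψ x - ψ x * rh f φ x - wr f φ x * deriv (deriv ψ) x))
      (hf : ∃ x ∈ R.I, wr f ψ x ≠ 0) (hφ : ∃ x ∈ R.I, wr φ ψ x ≠ 0)
      (hD0 : ∃ t ∈ R.J, ∃ x ∈ R.I, E.D (t, x) ≠ 0) :
      Listed E .II .A31 (R.mulU f) (R.mulU φ) (R.op 0 1 0 ψ)
  | III (i : ℕ) (n m : ℝ) (c : LieType) (h₁ h₂ : ℝ → ℝ) (G : ℝ → ℝ)
      (hi : EulerCase i n m c h₁ h₂)
      (hA : ∀ x ∈ R.I, x ≠ 0 → E.A x = n * x⁻¹) (hB : ∀ x ∈ R.I, x ≠ 0 → E.B x = m * (x ^ 2)⁻¹)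
      (hG : ContDiffOn ℝ ∞ G {y | ∃ t ∈ R.J, ∃ x ∈ R.I, x ≠ 0 ∧ y = t * x⁻¹})
      (hG0 : ∃ t ∈ R.J, ∃ x ∈ R.I, x ≠ 0 ∧ G (t * x⁻¹) ≠ 0)
      (hD : ∀ t ∈ R.J, ∀ x ∈ R.I, x ≠ 0 → E.D (t, x) = (x ^ 2)⁻¹ * G (t * x⁻¹)) :
      Listed E (.III i) c R.dil (R.mulU h₁) (R.mulU h₂)
  | IV (i : ℕ) (n m : ℝ) (c : LieType) (h₁ h₂ : ℝ → ℝ) (G : ℝ → ℝ)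
      (hi : ConstCase i n m c h₁ h₂)
      (hA : ∀ x ∈ R.I, E.A x = n) (hB : ∀ x ∈ R.I, E.B x = m)
      (hG : ContDiffOn ℝ ∞ G R.J)
      (hD : ∀ t ∈ R.J, ∀ x ∈ R.I, E.D (t, x) = G t) :
      Listed E (.IV i) c R.dx (R.mulU h₁) (R.mulU h₂)
  | V (i : ℕ) (n m : ℝ) (c : LieType) (h₁ h₂ : ℝ → ℝ) (k : ℝ) (G : ℝ → ℝ)
      (hi : ConstCase i n m c h₁ h₂) (hk : 0 < k)
      (hA : ∀ x ∈ R.I, E.A x = n) (hB : ∀ x ∈ R.I, E.B x = m)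
      (hG : ContDiffOn ℝ ∞ G {y | ∃ t ∈ R.J, ∃ x ∈ R.I, y = x - k * t})
      (hD : ∀ t ∈ R.J, ∀ x ∈ R.I, E.D (t, x) = G (x - k * t)) :
      Listed E (.V i) c (R.op 0 1 k (fun _ => 0)) (R.mulU h₁) (R.mulU h₂)

end WaveClassification

namespace WaveClassification

open Set
open scoped ContDiff

/-! The infinitesimal criterion is polynomial in the jet variables `u_t, u_x, u_tx, u_xx`, so it
splits into equations for the coefficients. They force `τ = l t + l₁`, `ξ = l x + l₂`, `η = h(x) u`.
What is left splits along `u_x`, `u ln|u|` and `u`, which are independent on a half-line, into the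
system `Det`: with `ξ = l x + l₂`, it reads `ξ A' + l A = 0`, `ξ B' + 2 l B = 0` and `L h + (l t +
l₁) D_t + ξ D_x + 2 l D = 0`, where `L h = h'' + A h' + B h` (`mem_maxAlg_iff`).

For `l = l₁ = l₂ = 0` only `L h = 0` remains. Its two-dimensional solution space gives the operators
`f u ∂_u`, `φ u ∂_u`, and Cramer's rule expresses `A`, `B` through `f`, `φ` (`exists_invariantForm`,
`InvariantForm.exists_comb`). Modulo these operators a symmetry is the vector `(l, l₁, l₂)`. For
generic coefficients the first equation at two points gives `l = l₂ = 0`, and `D_tt ≠ 0` at one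
point gives `l₁ = 0` (`exists_generic`). Dimension three means that the vectors form exactly a line
(`finrank_eq_three_iff`).

Since `u` ranges over half-lines, an equivalence has `Y = 0`. With `g = ln|X|` it rescales `A` and
`B` and changes `D` by a rescaling and the summand `L g` (`CoeffRel`, `Equivalent.exists_coeffRel`);
it changes `h` by a multiple of `ξ g'`. This brings the extra operator to normal form
(`exists_listed`). If `l ≠ 0`, translation and gauge give `t ∂_t + x ∂_x`, and `A`, `B`, `D` are
homogeneous: item III. If `l = l₂ = 0`, then `D` is affine in `t` and its constant part is some `L
g`: items I and II. If `l = 0 ≠ l₂`, then `A` and `B` are constant and scaling normalises them: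
items IV and V.

In items III to V the operator acts on the pair `(h₁, h₂)` by a constant 2×2 matrix with determinant
`m` and trace `1 - n` or `-n`. Its real normal form supplies the functions and the Lie type
(`triple_of_actsAt`, `Triple.hasType`). Inequivalence follows because the line of `(l, l₁, l₂)` is
transported by equivalences and separates the kinds of items, after which the coefficients are
compared (`item_eq`). -/

/-! ### The second prolongation in terms of Fréchet derivatives of the field -/

lemma hasDerivAt_affine (a b s : ℝ) : HasDerivAt (fun s : ℝ => a + s * b) b s := by
  simpa using ((hasDerivAt_id s).mul_const b).const_add a

lemma HasDerivAt.components {f : ℝ → ℝ × ℝ × ℝ} {f' : ℝ × ℝ × ℝ} {s : ℝ} (h : HasDerivAt f f' s) :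
    HasDerivAt (fun s => (f s).1) f'.1 s ∧ HasDerivAt (fun s => (f s).2.1) f'.2.1 s ∧
      HasDerivAt (fun s => (f s).2.2) f'.2.2 s := by
  have h' := h.hasFDerivAt
  refine ⟨?_, ?_, ?_⟩
  · simpa using h'.fst.hasDerivAt
  · simpa using h'.snd.fst.hasDerivAt
  · simpa using h'.snd.snd.hasDerivAt

/-- `D_t φ^t` already produces the terms `-u_tt D_t τ - u_tx D_t ξ`, and the definition subtracts
them once more, whence the factors `2`. Only the derivative of `prolT` along the one direction `(1,
0, p, a, b)` is needed, so everything is computed on a line. -/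
lemma prolTT_eq {Ω : Set (ℝ × ℝ × ℝ)} (hΩ : IsOpen Ω) {v : VF} (hv : ContDiffOn ℝ ∞ v Ω)
    {t x u : ℝ} (hz : (t, x, u) ∈ Ω) (p q a b : ℝ) :
    prolTT v (t, x, u, p, q) a b =
      (fderiv ℝ (fderiv ℝ v) (t, x, u) (1, 0, p) (1, 0, p)
        + fderiv ℝ v (t, x, u) (0, 0, a)).2.2
      - p * (fderiv ℝ (fderiv ℝ v) (t, x, u) (1, 0, p) (1, 0, p)
        + fderiv ℝ v (t, x, u) (0, 0, a)).1
      - q * (fderiv ℝ (fderiv ℝ v) (t, x, u) (1, 0, p) (1, 0, p)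
        + fderiv ℝ v (t, x, u) (0, 0, a)).2.1
      - 2 * a * (fderiv ℝ v (t, x, u) (1, 0, p)).1
      - 2 * b * (fderiv ℝ v (t, x, u) (1, 0, p)).2.1 := by
  have h1 : DifferentiableAt ℝ (fderiv ℝ v) (t, x, u) :=
    ((hv.contDiffAt (hΩ.mem_nhds hz)).fderiv_right (m := 1) (by norm_cast)).differentiableAt
      (by simp)
  have hL : HasDerivAt (fun s : ℝ => totalT v ((t, x, u, p, q) + s • (1, 0, p, a, b)))
      (fderiv ℝ (fderiv ℝ v) (t, x, u) (1, 0, p) (1, 0, p)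
        + fderiv ℝ v (t, x, u) (0, 0, a)) 0 := by
    have e1 : HasDerivAt (fun s : ℝ => (t + s * 1, x + s * 0, u + s * p)) (1, 0, p) 0 := by
      refine HasDerivAt.prodMk ?_ (HasDerivAt.prodMk ?_ ?_) <;>
        exact hasDerivAt_affine _ _ _
    have e2 : HasDerivAt (fun s : ℝ => ((1 : ℝ), (0 : ℝ), p + s * a)) (0, 0, a) 0 := by
      refine HasDerivAt.prodMk (hasDerivAt_const _ _) (HasDerivAt.prodMk (hasDerivAt_const _ _) ?_)
      exact hasDerivAt_affine _ _ _
    have e3 : HasDerivAt (fun s : ℝ => fderiv ℝ v (t + s * 1, x + s * 0, u + s * p))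
        (fderiv ℝ (fderiv ℝ v) (t, x, u) (1, 0, p)) 0 := by
      have h1' : HasFDerivAt (fderiv ℝ v) (fderiv ℝ (fderiv ℝ v) (t, x, u))
        (t + (0 : ℝ) * 1, x + (0 : ℝ) * 0, u + (0 : ℝ) * p) := by simpa using h1.hasFDerivAt
      exact h1'.comp_hasDerivAt (0 : ℝ) e1
    have := e3.clm_apply e2
    simpa [totalT] using this
  obtain ⟨c1, c2, c3⟩ := HasDerivAt.components hL
  have hT := (c3.sub ((hasDerivAt_affine p a 0).mul c1)).sub ((hasDerivAt_affine q b 0).mul c2)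
  have hd : fderiv ℝ (prolT v) (t, x, u, p, q) (1, 0, p, a, b) = _ :=
    ((differentiableAt_prolT hΩ hv (j := (t, x, u, p, q)) hz).hasFDerivAt.hasLineDerivAt
      (1, 0, p, a, b)).unique hT
  simp only [prolTT, hd]
  simp [totalT]
  ring

lemma prolXX_eq {Ω : Set (ℝ × ℝ × ℝ)} (hΩ : IsOpen Ω) {v : VF} (hv : ContDiffOn ℝ ∞ v Ω)
    {t x u : ℝ} (hz : (t, x, u) ∈ Ω) (p q b c : ℝ) :
    prolXX v (t, x, u, p, q) b c =
      (fderiv ℝ (fderiv ℝ v) (t, x, u) (0, 1, q) (0, 1, q)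
        + fderiv ℝ v (t, x, u) (0, 0, c)).2.2
      - p * (fderiv ℝ (fderiv ℝ v) (t, x, u) (0, 1, q) (0, 1, q)
        + fderiv ℝ v (t, x, u) (0, 0, c)).1
      - q * (fderiv ℝ (fderiv ℝ v) (t, x, u) (0, 1, q) (0, 1, q)
        + fderiv ℝ v (t, x, u) (0, 0, c)).2.1
      - 2 * b * (fderiv ℝ v (t, x, u) (0, 1, q)).1
      - 2 * c * (fderiv ℝ v (t, x, u) (0, 1, q)).2.1 := by
  have h1 : DifferentiableAt ℝ (fderiv ℝ v) (t, x, u) :=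
    ((hv.contDiffAt (hΩ.mem_nhds hz)).fderiv_right (m := 1) (by norm_cast)).differentiableAt
      (by simp)
  have hL : HasDerivAt (fun s : ℝ => totalX v ((t, x, u, p, q) + s • (0, 1, q, b, c)))
      (fderiv ℝ (fderiv ℝ v) (t, x, u) (0, 1, q) (0, 1, q)
        + fderiv ℝ v (t, x, u) (0, 0, c)) 0 := by
    have e1 : HasDerivAt (fun s : ℝ => (t + s * 0, x + s * 1, u + s * q)) (0, 1, q) 0 := by
      refine HasDerivAt.prodMk ?_ (HasDerivAt.prodMk ?_ ?_) <;>
        exact hasDerivAt_affine _ _ _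
    have e2 : HasDerivAt (fun s : ℝ => ((0 : ℝ), (1 : ℝ), q + s * c)) (0, 0, c) 0 := by
      refine HasDerivAt.prodMk (hasDerivAt_const _ _) (HasDerivAt.prodMk (hasDerivAt_const _ _) ?_)
      exact hasDerivAt_affine _ _ _
    have e3 : HasDerivAt (fun s : ℝ => fderiv ℝ v (t + s * 0, x + s * 1, u + s * q))
        (fderiv ℝ (fderiv ℝ v) (t, x, u) (0, 1, q)) 0 := by
      have h1' : HasFDerivAt (fderiv ℝ v) (fderiv ℝ (fderiv ℝ v) (t, x, u))
        (t + (0 : ℝ) * 0, x + (0 : ℝ) * 1, u + (0 : ℝ) * q) := by simpa using h1.hasFDerivAt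
      exact h1'.comp_hasDerivAt (0 : ℝ) e1
    have := e3.clm_apply e2
    simpa [totalX] using this
  obtain ⟨c1, c2, c3⟩ := HasDerivAt.components hL
  have hT := (c3.sub ((hasDerivAt_affine p b 0).mul c1)).sub ((hasDerivAt_affine q c 0).mul c2)
  have hd : fderiv ℝ (prolX v) (t, x, u, p, q) (0, 1, q, b, c) = _ :=
    ((differentiableAt_prolX hΩ hv (j := (t, x, u, p, q)) hz).hasFDerivAt.hasLineDerivAt
      (0, 1, q, b, c)).unique hT
  simp only [prolXX, hd]
  simp [totalX]
  ring

/-! ### Regions and the derivative of the nonlinearity -/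

lemma Region.mem_Ω {R : Region} {t x u : ℝ} :
    (t, x, u) ∈ R.Ω ↔ t ∈ R.J ∧ x ∈ R.I ∧ u ∈ R.U := by
  simp [Region.Ω]

lemma Region.isOpen_U (R : Region) : IsOpen R.U := by
  rcases R.U_eq with h | h <;> rw [h]
  exacts [isOpen_Ioi, isOpen_Iio]

lemma Region.ne_zero_of_mem_U {R : Region} {u : ℝ} (hu : u ∈ R.U) : u ≠ 0 := by
  rcases R.U_eq with h | h <;> rw [h] at hu
  exacts [ne_of_gt hu, ne_of_lt hu]

lemma Region.convex_U (R : Region) : Convex ℝ R.U := by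
  rcases R.U_eq with h | h <;> rw [h]
  exacts [convex_Ioi 0, convex_Iio 0]

lemma Region.convex_J (R : Region) : Convex ℝ R.J := R.ordConnected_J.convex

lemma Region.convex_I (R : Region) : Convex ℝ R.I := R.ordConnected_I.convex

lemma Region.isOpen_JI (R : Region) : IsOpen (R.J ×ˢ R.I) := R.isOpen_J.prod R.isOpen_I

lemma Region.exists_sign (R : Region) : ∃ s : ℝ, |s| = 1 ∧ ∀ y, 0 < y → s * y ∈ R.U := by
  rcases R.U_eq with h | h
  · exact ⟨1, by simp, fun y hy => by simpa [h] using hy⟩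
  · exact ⟨-1, by simp, fun y hy => by simpa [h] using hy⟩

/-- On `U` the functions `u ln|u|` and `u` are linearly independent. -/
lemma Region.eq_zero_of_log (R : Region) {α β : ℝ}
    (h : ∀ u ∈ R.U, α * (u * Real.log |u|) + β * u = 0) : α = 0 ∧ β = 0 := by
  obtain ⟨s, hs, hU⟩ := R.exists_sign
  have hs0 : s ≠ 0 := by rintro rfl; simp at hs
  -- At `u = s` the logarithm vanishes and at `u = s e` it equals one, so two evaluations separate
  -- the coefficients.
  have h1 := h _ (hU 1 one_pos)
  have h2 := h _ (hU _ (Real.exp_pos 1))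
  simp only [abs_mul, hs, one_mul, abs_one, Real.log_one, Real.abs_exp, Real.log_exp] at h1 h2
  have hb : β = 0 := by
    have : β * s = 0 := by linarith
    exact (mul_eq_zero.1 this).resolve_right hs0
  subst hb
  have : α * (s * Real.exp 1) = 0 := by linarith
  exact ⟨(mul_eq_zero.1 this).resolve_right (mul_ne_zero hs0 (Real.exp_pos 1).ne'), rfl⟩

namespace Equation

variable {R : Region}

lemma differentiableAt_A (E : Equation R) {x : ℝ} (hx : x ∈ R.I) : DifferentiableAt ℝ E.A x :=
  (E.smooth_A.contDiffAt (R.isOpen_I.mem_nhds hx)).differentiableAt (by simp)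

lemma differentiableAt_B (E : Equation R) {x : ℝ} (hx : x ∈ R.I) : DifferentiableAt ℝ E.B x :=
  (E.smooth_B.contDiffAt (R.isOpen_I.mem_nhds hx)).differentiableAt (by simp)

lemma differentiableAt_D (E : Equation R) {t x : ℝ} (ht : t ∈ R.J) (hx : x ∈ R.I) :
    DifferentiableAt ℝ E.D (t, x) :=
  (E.smooth_D.contDiffAt (R.isOpen_JI.mem_nhds ⟨ht, hx⟩)).differentiableAt (by simp)

lemma fderiv_F (E : Equation R) {t x u : ℝ} (ht : t ∈ R.J) (hx : x ∈ R.I) (hu : u ≠ 0)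
    (q a b c d : ℝ) :
    fderiv ℝ E.F (t, x, u, q) (a, b, c, d) =
      u * fderiv ℝ E.D (t, x) (a, b) + b * (deriv E.A x * q + deriv E.B x * (u * Real.log |u|))
        + c * (q ^ 2 / u ^ 2 + E.B x * (Real.log |u| + 1) + E.D (t, x))
        + d * (-2 * q / u + E.A x) := by
  have hA := (E.differentiableAt_A hx).hasDerivAt
  have hB := (E.differentiableAt_B hx).hasDerivAt
  have hD := (E.differentiableAt_D ht hx).hasFDerivAt
  have pt : HasFDerivAt (𝕜 := ℝ) (fun y : ℝ × ℝ × ℝ × ℝ => y.1) _ (t, x, u, q) := hasFDerivAt_fst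
  have ps : HasFDerivAt (𝕜 := ℝ) (fun y : ℝ × ℝ × ℝ × ℝ => y.2) _ (t, x, u, q) := hasFDerivAt_snd
  have px := ps.fst
  have pu := ps.snd.fst
  have pq := ps.snd.snd
  have dA : HasFDerivAt (fun y : ℝ × ℝ × ℝ × ℝ => E.A y.2.1) _ (t, x, u, q) :=
    HasDerivAt.comp_hasFDerivAt (t, x, u, q) hA px
  have dB : HasFDerivAt (fun y : ℝ × ℝ × ℝ × ℝ => E.B y.2.1) _ (t, x, u, q) :=
    HasDerivAt.comp_hasFDerivAt (t, x, u, q) hB px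
  have dI : HasFDerivAt (fun y : ℝ × ℝ × ℝ × ℝ => (y.2.2.1)⁻¹) _ (t, x, u, q) :=
    HasDerivAt.comp_hasFDerivAt (t, x, u, q) (hasDerivAt_inv hu) pu
  -- `Real.log` is even, so the absolute value can be dropped and the logarithm differentiated at
  -- any `u ≠ 0`.
  have dL : HasFDerivAt (fun y : ℝ × ℝ × ℝ × ℝ => Real.log y.2.2.1) _ (t, x, u, q) :=
    HasDerivAt.comp_hasFDerivAt (t, x, u, q) (Real.hasDerivAt_log hu) pu
  have dD : HasFDerivAt (fun y : ℝ × ℝ × ℝ × ℝ => E.D (y.1, y.2.1)) _ (t, x, u, q) :=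
    HasFDerivAt.comp (t, x, u, q) hD (pt.prodMk px)
  have key := (((dI.neg.mul (pq.pow 2)).add (dA.mul pq)).add ((dB.mul pu).mul dL)).add (pu.mul dD)
  have hF : E.F = (((-fun y : ℝ × ℝ × ℝ × ℝ => (y.2.2.1)⁻¹) * fun y : ℝ × ℝ × ℝ × ℝ => y.2.2.2 ^ 2)
      + (fun y : ℝ × ℝ × ℝ × ℝ => E.A y.2.1) * (fun y : ℝ × ℝ × ℝ × ℝ => y.2.2.2)
      + (fun y : ℝ × ℝ × ℝ × ℝ => E.B y.2.1) * (fun y : ℝ × ℝ × ℝ × ℝ => y.2.2.1)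
        * (fun y : ℝ × ℝ × ℝ × ℝ => Real.log y.2.2.1))
      + (fun y : ℝ × ℝ × ℝ × ℝ => y.2.2.1) * (fun y : ℝ × ℝ × ℝ × ℝ => E.D (y.1, y.2.1)) := by
    funext y
    simp [Equation.F, Real.log_abs]
  have := key.fderiv
  rw [hF, key.fderiv]
  simp [Real.log_abs]
  field_simp
  ring

end Equation

/-! ### Splitting the criterion along the jet variables -/

lemma clm_triple {F : Type*} [NormedAddCommGroup F] [NormedSpace ℝ F] (L : ℝ × ℝ × ℝ →L[ℝ] F)
    (a b c : ℝ) : L (a, b, c) = a • L (1, 0, 0) + b • L (0, 1, 0) + c • L (0, 0, 1) := by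
  rw [← map_smul, ← map_smul, ← map_smul, ← map_add, ← map_add]
  simp

/-- The components of the second derivative of a vector field. -/
lemma hasFDerivAt_fderiv_apply {Ω : Set (ℝ × ℝ × ℝ)} (hΩ : IsOpen Ω) {v : VF}
    (hv : ContDiffOn ℝ ∞ v Ω) {z : ℝ × ℝ × ℝ} (hz : z ∈ Ω) (e : ℝ × ℝ × ℝ) :
    HasFDerivAt (fun z => fderiv ℝ v z e) ((fderiv ℝ (fderiv ℝ v) z).flip e) z := by
  have h1 : DifferentiableAt ℝ (fderiv ℝ v) z :=
    ((hv.contDiffAt (hΩ.mem_nhds hz)).fderiv_right (m := 1) (by norm_cast)).differentiableAt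
      (by simp)
  have := h1.hasFDerivAt.clm_apply (hasFDerivAt_const e z)
  simpa using this

/-- A relation between first derivatives that holds on an open set can be differentiated. -/
lemma fderiv_fderiv_eq_zero {Ω : Set (ℝ × ℝ × ℝ)} (hΩ : IsOpen Ω) {v : VF}
    (hv : ContDiffOn ℝ ∞ v Ω) (e e' : ℝ × ℝ × ℝ) (f g : ℝ × ℝ × ℝ →L[ℝ] ℝ)
    (h : ∀ z ∈ Ω, f (fderiv ℝ v z e) = g (fderiv ℝ v z e')) {z : ℝ × ℝ × ℝ} (hz : z ∈ Ω)
    (w : ℝ × ℝ × ℝ) :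
    f (fderiv ℝ (fderiv ℝ v) z w e) = g (fderiv ℝ (fderiv ℝ v) z w e') := by
  have h1 := f.hasFDerivAt.comp z (hasFDerivAt_fderiv_apply hΩ hv hz e)
  have h2 := g.hasFDerivAt.comp z (hasFDerivAt_fderiv_apply hΩ hv hz e')
  have he : (f ∘ fun z => fderiv ℝ v z e) =ᶠ[nhds z] (g ∘ fun z => fderiv ℝ v z e') := by
    filter_upwards [hΩ.mem_nhds hz] with y hy using h y hy
  have := (h1.congr_of_eventuallyEq he.symm).unique h2
  simpa using DFunLike.congr_fun this w

section Determining

variable {R : Region} {E : Equation R} {v : VF}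

/-- The criterion is affine in the free variables `u_tx` and `u_xx`. Their coefficients are, up to
the factor 2, `τ_x + u_x τ_u - ξ_t - u_t ξ_u` and `ξ_x + u_x ξ_u - τ_t - u_t τ_u`, and these vanish
for all `u_t`, `u_x`. -/
lemma IsSymmetry.first_order (h : IsSymmetry R.Ω E.F v) {t x u : ℝ} (hz : (t, x, u) ∈ R.Ω) :
    (fderiv ℝ v (t, x, u) (0, 0, 1)).1 = 0 ∧ (fderiv ℝ v (t, x, u) (0, 0, 1)).2.1 = 0 ∧
      (fderiv ℝ v (t, x, u) (1, 0, 0)).2.1 = (fderiv ℝ v (t, x, u) (0, 1, 0)).1 ∧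
      (fderiv ℝ v (t, x, u) (1, 0, 0)).1 = (fderiv ℝ v (t, x, u) (0, 1, 0)).2.1 := by
  have key := h.2.2 t x u hz
  simp only [prolTT_eq R.isOpen_Ω h.2.1 hz, prolXX_eq R.isOpen_Ω h.2.1 hz] at key
  generalize fderiv ℝ (fderiv ℝ v) (t, x, u) = S at key
  have hX : ∀ p q, prolX v (t, x, u, p, q) = (fderiv ℝ v (t, x, u) (0, 1, q)).2.2
      - p * (fderiv ℝ v (t, x, u) (0, 1, q)).1 - q * (fderiv ℝ v (t, x, u) (0, 1, q)).2.1 :=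
    fun _ _ => rfl
  generalize fderiv ℝ v (t, x, u) = L at key hX ⊢
  obtain ⟨a₁, h₁⟩ : ∃ w, L (1, 0, 0) = w := ⟨_, rfl⟩
  obtain ⟨a₂, h₂⟩ : ∃ w, L (0, 1, 0) = w := ⟨_, rfl⟩
  obtain ⟨a₃, h₃⟩ : ∃ w, L (0, 0, 1) = w := ⟨_, rfl⟩
  have hp : ∀ p, L (1, 0, p) = a₁ + p • a₃ := fun p => by rw [clm_triple, h₁, h₃]; simp
  have hq : ∀ p, L (0, 1, p) = a₂ + p • a₃ := fun p => by rw [clm_triple, h₂, h₃]; simp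
  have hr : ∀ p, L (0, 0, p) = p • a₃ := fun p => by rw [clm_triple, h₃]; simp
  rw [h₁, h₂, h₃]
  simp only [hp, hq, hr, Prod.fst_add, Prod.snd_add, Prod.smul_fst,
    Prod.smul_snd, smul_eq_mul] at key
  have b1 := fun p q => (key p q 1 0)
  have b0 := fun p q => (key p q 0 0)
  -- `b1 - b0` at `(p, q)` is the coefficient of `u_tx`; comparing `q = 0, 1` isolates `τ_u`, and
  -- comparing `p = 0, 1` isolates `ξ_u`.
  have hτu : a₃.1 = 0 := by linarith [b1 0 0, b0 0 0, b1 0 1, b0 0 1]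
  have hξu : a₃.2.1 = 0 := by linarith [b1 0 0, b0 0 0, b1 1 0, b0 1 0]
  refine ⟨hτu, hξu, by linarith [b1 0 0, b0 0 0], ?_⟩
  have c1 := key 0 0 0 1
  have c0 := key 0 0 0 0
  rw [hτu, hξu] at c1 c0
  linarith

/-- What remains at `u_tx = u_xx = 0` after the first-order relations and their derivatives are
inserted. It is a polynomial in `p = u_t` and `q = u_x`, and its coefficients are the remaining
determining equations. -/
lemma IsSymmetry.residual (h : IsSymmetry R.Ω E.F v) {t x u : ℝ} (hz : (t, x, u) ∈ R.Ω)
    (p q : ℝ) :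
    (fderiv ℝ (fderiv ℝ v) (t, x, u) (1, 0, 0) (1, 0, 0)).2.2
      + 2 * p * (fderiv ℝ (fderiv ℝ v) (t, x, u) (1, 0, 0) (0, 0, 1)).2.2
      + p ^ 2 * (fderiv ℝ (fderiv ℝ v) (t, x, u) (0, 0, 1) (0, 0, 1)).2.2
      + E.F (t, x, u, q) * ((fderiv ℝ v (t, x, u) (0, 0, 1)).2.2
        - 2 * (fderiv ℝ v (t, x, u) (0, 1, 0)).2.1)
      - p * (fderiv ℝ (fderiv ℝ v) (t, x, u) (1, 0, 0) (1, 0, 0)).1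
      - q * (fderiv ℝ (fderiv ℝ v) (t, x, u) (1, 0, 0) (1, 0, 0)).2.1
      - ((fderiv ℝ (fderiv ℝ v) (t, x, u) (0, 1, 0) (0, 1, 0)).2.2
        + 2 * q * (fderiv ℝ (fderiv ℝ v) (t, x, u) (0, 1, 0) (0, 0, 1)).2.2
        + q ^ 2 * (fderiv ℝ (fderiv ℝ v) (t, x, u) (0, 0, 1) (0, 0, 1)).2.2
        - p * (fderiv ℝ (fderiv ℝ v) (t, x, u) (0, 1, 0) (0, 1, 0)).1
        - q * (fderiv ℝ (fderiv ℝ v) (t, x, u) (0, 1, 0) (0, 1, 0)).2.1)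
      - fderiv ℝ E.F (t, x, u, q) ((v (t, x, u)).1, (v (t, x, u)).2.1, (v (t, x, u)).2.2,
          (fderiv ℝ v (t, x, u) (0, 1, 0)).2.2 + q * (fderiv ℝ v (t, x, u) (0, 0, 1)).2.2
          - p * (fderiv ℝ v (t, x, u) (0, 1, 0)).1
          - q * (fderiv ℝ v (t, x, u) (0, 1, 0)).2.1) = 0 := by
  have key := h.2.2 t x u hz p q 0 0
  rw [prolTT_eq R.isOpen_Ω h.2.1 hz, prolXX_eq R.isOpen_Ω h.2.1 hz] at key
  have hsymm : IsSymmSndFDerivAt ℝ v (t, x, u) :=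
    (h.2.1.contDiffAt (R.isOpen_Ω.mem_nhds hz)).isSymmSndFDerivAt
      (by rw [minSmoothness_of_isRCLikeNormedField]; norm_cast)
  have f1 : ∀ w, (fderiv ℝ (fderiv ℝ v) (t, x, u) w (0, 0, 1)).1 = 0 := fun w =>
    fderiv_fderiv_eq_zero R.isOpen_Ω h.2.1 (0, 0, 1) 0 (.fst ℝ ℝ (ℝ × ℝ)) 0
      (fun z hz => h.first_order hz |>.1) hz w
  have f2 : ∀ w, (fderiv ℝ (fderiv ℝ v) (t, x, u) w (0, 0, 1)).2.1 = 0 := fun w =>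
    fderiv_fderiv_eq_zero R.isOpen_Ω h.2.1 (0, 0, 1) 0
      ((.fst ℝ ℝ ℝ : ℝ × ℝ →L[ℝ] ℝ).comp (.snd ℝ ℝ (ℝ × ℝ))) 0
      (fun z hz => h.first_order hz |>.2.1) hz w
  obtain ⟨g1, g2, g3, g4⟩ := h.first_order hz
  have hX : prolX v (t, x, u, p, q) = (fderiv ℝ v (t, x, u) (0, 1, q)).2.2
      - p * (fderiv ℝ v (t, x, u) (0, 1, q)).1 - q * (fderiv ℝ v (t, x, u) (0, 1, q)).2.1 := rfl
  rw [hX] at key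
  have s13 := hsymm (0, 0, 1) (1, 0, 0)
  have s23 := hsymm (0, 0, 1) (0, 1, 0)
  have f11 := f1 (1, 0, 0)
  have f12 := f1 (0, 1, 0)
  have f13 := f1 (0, 0, 1)
  have f21 := f2 (1, 0, 0)
  have f22 := f2 (0, 1, 0)
  have f23 := f2 (0, 0, 1)
  clear hX hsymm f1 f2
  generalize fderiv ℝ (fderiv ℝ v) (t, x, u) = S at *
  generalize fderiv ℝ v (t, x, u) = L at *
  obtain ⟨a₁, h₁⟩ : ∃ w, L (1, 0, 0) = w := ⟨_, rfl⟩
  obtain ⟨a₂, h₂⟩ : ∃ w, L (0, 1, 0) = w := ⟨_, rfl⟩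
  obtain ⟨a₃, h₃⟩ : ∃ w, L (0, 0, 1) = w := ⟨_, rfl⟩
  have hp : ∀ p, L (1, 0, p) = a₁ + p • a₃ := fun p => by rw [clm_triple, h₁, h₃]; simp
  have hq : ∀ p, L (0, 1, p) = a₂ + p • a₃ := fun p => by rw [clm_triple, h₂, h₃]; simp
  have hr : ∀ p, L (0, 0, p) = p • a₃ := fun p => by rw [clm_triple, h₃]; simp
  obtain ⟨s11, k11⟩ : ∃ w, S (1, 0, 0) (1, 0, 0) = w := ⟨_, rfl⟩
  obtain ⟨s22, k22⟩ : ∃ w, S (0, 1, 0) (0, 1, 0) = w := ⟨_, rfl⟩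
  obtain ⟨s33, k33⟩ : ∃ w, S (0, 0, 1) (0, 0, 1) = w := ⟨_, rfl⟩
  obtain ⟨s13', k13⟩ : ∃ w, S (1, 0, 0) (0, 0, 1) = w := ⟨_, rfl⟩
  obtain ⟨s23', k23⟩ : ∃ w, S (0, 1, 0) (0, 0, 1) = w := ⟨_, rfl⟩
  have hSp : S (1, 0, p) (1, 0, p) = s11 + (2 * p) • s13' + p ^ 2 • s33 := by
    rw [clm_triple (S (1, 0, p)), clm_triple S 1 0 p]
    simp only [one_smul, zero_smul, add_zero, add_apply, smul_apply, s13, k11, k13, k33]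
    module
  have hSq : S (0, 1, q) (0, 1, q) = s22 + (2 * q) • s23' + q ^ 2 • s33 := by
    rw [clm_triple (S (0, 1, q)), clm_triple S 0 1 q]
    simp only [one_smul, zero_smul, zero_add, add_apply, smul_apply, s23, k22, k23, k33]
    module
  have hvec : ((v (t, x, u)).1, (v (t, x, u)).2.1, (v (t, x, u)).2.2,
      (L (0, 1, q)).2.2 - p * (L (0, 1, q)).1 - q * (L (0, 1, q)).2.1)
      = ((v (t, x, u)).1, (v (t, x, u)).2.1, (v (t, x, u)).2.2,
        a₂.2.2 + q * a₃.2.2 - p * a₂.1 - q * a₂.2.1) := by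
    rw [h₃] at g1 g2
    simp [hq, g1, g2]
  rw [hvec] at key
  rw [k13] at f11 f21
  rw [k23] at f12 f22
  rw [k33] at f13 f23
  rw [h₃] at g1 g2
  rw [h₁, h₂] at g4
  rw [h₂, h₃, k11, k13, k22, k23, k33]
  simp only [hSp, hSq, hp, hq, hr, Prod.fst_add, Prod.snd_add, Prod.smul_fst, Prod.smul_snd,
    smul_eq_mul, f11, f12, f13, f21, f22, f23, g1, g2, g4] at key ⊢
  linear_combination key

/-- The term `-u⁻¹ u_x²` of the nonlinearity meets the term `-u_t τ_x` of `φ^x`, so `u_t u_x`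
carries the coefficient `-2 u⁻¹ τ_x`. This is what excludes Lorentz boosts. The coefficient of
`u_t²` is `η_uu`. -/
lemma IsSymmetry.second_order (h : IsSymmetry R.Ω E.F v) {t x u : ℝ} (hz : (t, x, u) ∈ R.Ω) :
    (fderiv ℝ v (t, x, u) (0, 1, 0)).1 = 0 ∧
      (fderiv ℝ (fderiv ℝ v) (t, x, u) (0, 0, 1) (0, 0, 1)).2.2 = 0 := by
  obtain ⟨ht, hx, hu⟩ := Region.mem_Ω.1 hz
  have hu0 := Region.ne_zero_of_mem_U hu
  have key := h.residual hz
  simp only [E.fderiv_F ht hx hu0] at key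
  refine ⟨?_, ?_⟩
  · have e1 := key 1 1
    have e2 := key 1 (-1)
    have e3 := key (-1) 1
    have e4 := key (-1) (-1)
    -- The alternating sum over the four sign choices keeps only the `p q` term.
    have : u⁻¹ * (fderiv ℝ v (t, x, u) (0, 1, 0)).1 = 0 := by
      simp only [div_eq_mul_inv] at e1 e2 e3 e4
      linear_combination (-e1 + e2 + e3 - e4) / 8
    exact (mul_eq_zero.1 this).resolve_left (inv_ne_zero hu0)
  · linear_combination (key 1 0 + key (-1) 0 - 2 * key 0 0) / 2

/-- The relations `τ_u = ξ_u = 0`, `τ_x = ξ_t = 0`, `τ_t = ξ_x` hold on an open set and can be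
differentiated. Symmetry of second derivatives then gives the missing `τ_tt = ξ_xt = ξ_tx = 0`, so
`τ` and `ξ` are affine. -/
lemma IsSymmetry.second_order' (h : IsSymmetry R.Ω E.F v) {z : ℝ × ℝ × ℝ} (hz : z ∈ R.Ω)
    (w : ℝ × ℝ × ℝ) :
    (fderiv ℝ (fderiv ℝ v) z w (1, 0, 0)).1 = 0 ∧
      (fderiv ℝ (fderiv ℝ v) z w (0, 1, 0)).1 = 0 ∧
      (fderiv ℝ (fderiv ℝ v) z w (0, 0, 1)).1 = 0 ∧
      (fderiv ℝ (fderiv ℝ v) z w (1, 0, 0)).2.1 = 0 ∧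
      (fderiv ℝ (fderiv ℝ v) z w (0, 1, 0)).2.1 = 0 ∧
      (fderiv ℝ (fderiv ℝ v) z w (0, 0, 1)).2.1 = 0 := by
  have hsymm : IsSymmSndFDerivAt ℝ v z :=
    (h.2.1.contDiffAt (R.isOpen_Ω.mem_nhds hz)).isSymmSndFDerivAt
      (by rw [minSmoothness_of_isRCLikeNormedField]; norm_cast)
  have a : ∀ w, (fderiv ℝ (fderiv ℝ v) z w (0, 0, 1)).1 = 0 := fun w =>
    fderiv_fderiv_eq_zero R.isOpen_Ω h.2.1 (0, 0, 1) 0 (.fst ℝ ℝ (ℝ × ℝ)) 0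
      (fun z hz => h.first_order hz |>.1) hz w
  have b : ∀ w, (fderiv ℝ (fderiv ℝ v) z w (0, 0, 1)).2.1 = 0 := fun w =>
    fderiv_fderiv_eq_zero R.isOpen_Ω h.2.1 (0, 0, 1) 0
      ((.fst ℝ ℝ ℝ : ℝ × ℝ →L[ℝ] ℝ).comp (.snd ℝ ℝ (ℝ × ℝ))) 0
      (fun z hz => h.first_order hz |>.2.1) hz w
  have c : ∀ w, (fderiv ℝ (fderiv ℝ v) z w (0, 1, 0)).1 = 0 := fun w =>
    fderiv_fderiv_eq_zero R.isOpen_Ω h.2.1 (0, 1, 0) 0 (.fst ℝ ℝ (ℝ × ℝ)) 0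
      (fun z hz => h.second_order hz |>.1) hz w
  have d : ∀ w, (fderiv ℝ (fderiv ℝ v) z w (1, 0, 0)).2.1 = 0 := fun w =>
    fderiv_fderiv_eq_zero R.isOpen_Ω h.2.1 (1, 0, 0) 0
      ((.fst ℝ ℝ ℝ : ℝ × ℝ →L[ℝ] ℝ).comp (.snd ℝ ℝ (ℝ × ℝ))) 0
      (fun z hz => (h.first_order hz).2.2.1.trans (h.second_order hz).1) hz w
  have e : ∀ w, (fderiv ℝ (fderiv ℝ v) z w (1, 0, 0)).1 =
      (fderiv ℝ (fderiv ℝ v) z w (0, 1, 0)).2.1 := fun w =>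
    fderiv_fderiv_eq_zero R.isOpen_Ω h.2.1 (1, 0, 0) (0, 1, 0) (.fst ℝ ℝ (ℝ × ℝ))
      ((.fst ℝ ℝ ℝ : ℝ × ℝ →L[ℝ] ℝ).comp (.snd ℝ ℝ (ℝ × ℝ)))
      (fun z hz => (h.first_order hz).2.2.2) hz w
  have e' : ∀ w, (fderiv ℝ (fderiv ℝ v) z w (1, 0, 0)).1 = 0 := by
    intro w
    obtain ⟨w₁, w₂, w₃⟩ := w
    have e1 : (fderiv ℝ (fderiv ℝ v) z (1, 0, 0) (1, 0, 0)).1 = 0 := by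
      rw [e, hsymm, d]
    have e2 : (fderiv ℝ (fderiv ℝ v) z (0, 1, 0) (1, 0, 0)).1 = 0 := by rw [hsymm, c]
    have e3 : (fderiv ℝ (fderiv ℝ v) z (0, 0, 1) (1, 0, 0)).1 = 0 := by rw [hsymm, a]
    rw [clm_triple (fderiv ℝ (fderiv ℝ v) z)]
    simp [e1, e2, e3]
  exact ⟨e' w, c w, a w, d w, by rw [← e, e'], b w⟩

/-- In the coefficient of `u_x²` the terms with `ξ_x` cancel and `u⁻¹ η_u - u⁻² η` remains; the
coefficient of `u_t` is `2 η_tu`. -/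
lemma IsSymmetry.eta (h : IsSymmetry R.Ω E.F v) {t x u : ℝ} (hz : (t, x, u) ∈ R.Ω) :
    (v (t, x, u)).2.2 = u * (fderiv ℝ v (t, x, u) (0, 0, 1)).2.2 ∧
      (fderiv ℝ (fderiv ℝ v) (t, x, u) (1, 0, 0) (0, 0, 1)).2.2 = 0 := by
  obtain ⟨ht, hx, hu⟩ := Region.mem_Ω.1 hz
  have hu0 := Region.ne_zero_of_mem_U hu
  have key := h.residual hz
  obtain ⟨a, b⟩ := h.second_order hz
  obtain ⟨c1, -, -, c2, -⟩ := h.second_order' hz (1, 0, 0)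
  obtain ⟨-, d1, -, -, d2, -⟩ := h.second_order' hz (0, 1, 0)
  simp only [E.fderiv_F ht hx hu0, Equation.F, a, b, c1, c2, d1, d2] at key
  refine ⟨?_, ?_⟩
  · have e1 := key 0 1
    have e2 := key 0 (-1)
    have e3 := key 0 0
    have := congrArg (fun y => y * u ^ 2) (congrArg₂ (· + ·) e1 e2)
    have e4 := congrArg (fun y => y * u ^ 2) e3
    field_simp at this e4
    linear_combination -this / 2 + e4
  · linear_combination (key 1 0 - key (-1) 0) / 4

end Determining

/-! ### The form of all symmetries and the equations for their coefficients -/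

section Determining

variable {R : Region}

lemma Region.op_apply {l l₁ l₂ : ℝ} {h : ℝ → ℝ} {z : ℝ × ℝ × ℝ} (hz : z ∈ R.Ω) :
    R.op l l₁ l₂ h z = (l * z.1 + l₁, l * z.2.1 + l₂, h z.2.1 * z.2.2) :=
  indicator_of_mem hz _

lemma Region.op_of_notMem {l l₁ l₂ : ℝ} {h : ℝ → ℝ} {z : ℝ × ℝ × ℝ} (hz : z ∉ R.Ω) :
    R.op l l₁ l₂ h z = 0 :=
  indicator_of_notMem hz _

lemma Region.contDiffOn_op (l l₁ l₂ : ℝ) {h : ℝ → ℝ} (hh : ContDiffOn ℝ ∞ h R.I) :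
    ContDiffOn ℝ ∞ (R.op l l₁ l₂ h) R.Ω := by
  have h1 : ContDiffOn ℝ ∞ (fun z : ℝ × ℝ × ℝ => h z.2.1) R.Ω :=
    hh.comp (by fun_prop) (fun z hz => hz.2.1)
  have h2 : ContDiffOn ℝ ∞
      (fun z : ℝ × ℝ × ℝ => (l * z.1 + l₁, l * z.2.1 + l₂, h z.2.1 * z.2.2)) R.Ω :=
    ((contDiff_fst.const_smul l).add contDiff_const).contDiffOn.prodMk
      ((((contDiff_fst.comp contDiff_snd).const_smul l).add contDiff_const).contDiffOn.prodMk
        (h1.mul (contDiff_snd.comp contDiff_snd).contDiffOn))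
  exact h2.congr fun z hz => Region.op_apply hz

lemma Region.hasDerivAt_of_contDiffOn {h : ℝ → ℝ} (hh : ContDiffOn ℝ ∞ h R.I) {x : ℝ}
    (hx : x ∈ R.I) : HasDerivAt h (deriv h x) x :=
  ((hh.contDiffAt (R.isOpen_I.mem_nhds hx)).differentiableAt (by simp)).hasDerivAt

lemma Region.contDiffOn_deriv {h : ℝ → ℝ} (hh : ContDiffOn ℝ ∞ h R.I) :
    ContDiffOn ℝ ∞ (deriv h) R.I :=
  ((contDiffOn_infty_iff_deriv_of_isOpen R.isOpen_I).1 hh).2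

lemma Region.fderiv_op (l l₁ l₂ : ℝ) {h : ℝ → ℝ} (hh : ContDiffOn ℝ ∞ h R.I) {z : ℝ × ℝ × ℝ}
    (hz : z ∈ R.Ω) (w : ℝ × ℝ × ℝ) :
    fderiv ℝ (R.op l l₁ l₂ h) z w =
      (l * w.1, l * w.2.1, deriv h z.2.1 * w.2.1 * z.2.2 + h z.2.1 * w.2.2) := by
  have he : R.op l l₁ l₂ h =ᶠ[nhds z]
      fun z => (l * z.1 + l₁, l * z.2.1 + l₂, h z.2.1 * z.2.2) := by
    filter_upwards [R.isOpen_Ω.mem_nhds hz] with y hy using Region.op_apply hy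
  have pt : HasFDerivAt (𝕜 := ℝ) (fun y : ℝ × ℝ × ℝ => y.1) _ z := hasFDerivAt_fst
  have ps : HasFDerivAt (𝕜 := ℝ) (fun y : ℝ × ℝ × ℝ => y.2) _ z := hasFDerivAt_snd
  have dh : HasFDerivAt (fun y : ℝ × ℝ × ℝ => h y.2.1) _ z :=
    HasDerivAt.comp_hasFDerivAt z (R.hasDerivAt_of_contDiffOn hh hz.2.1) ps.fst
  have key : HasFDerivAt (fun z : ℝ × ℝ × ℝ => (l * z.1 + l₁, l * z.2.1 + l₂, h z.2.1 * z.2.2)) _ z :=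
    ((pt.const_mul l).add_const l₁).prodMk (((ps.fst.const_mul l).add_const l₂).prodMk
      (dh.mul ps.snd))
  rw [he.fderiv_eq, key.fderiv]
  simp
  ring

lemma Region.fderiv_fderiv_op (l l₁ l₂ : ℝ) {h : ℝ → ℝ} (hh : ContDiffOn ℝ ∞ h R.I)
    {z : ℝ × ℝ × ℝ} (hz : z ∈ R.Ω) (w e : ℝ × ℝ × ℝ) :
    fderiv ℝ (fderiv ℝ (R.op l l₁ l₂ h)) z w e =
      (0, 0, deriv (deriv h) z.2.1 * w.2.1 * e.2.1 * z.2.2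
        + deriv h z.2.1 * (e.2.1 * w.2.2 + w.2.1 * e.2.2)) := by
  have he : (fun z => fderiv ℝ (R.op l l₁ l₂ h) z e) =ᶠ[nhds z]
      fun z => (l * e.1, l * e.2.1, deriv h z.2.1 * e.2.1 * z.2.2 + h z.2.1 * e.2.2) := by
    filter_upwards [R.isOpen_Ω.mem_nhds hz] with y hy using R.fderiv_op l l₁ l₂ hh hy e
  have ps : HasFDerivAt (𝕜 := ℝ) (fun y : ℝ × ℝ × ℝ => y.2) _ z := hasFDerivAt_snd
  have dh : HasFDerivAt (fun y : ℝ × ℝ × ℝ => h y.2.1) _ z :=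
    HasDerivAt.comp_hasFDerivAt z (R.hasDerivAt_of_contDiffOn hh hz.2.1) ps.fst
  have dh' : HasFDerivAt (fun y : ℝ × ℝ × ℝ => deriv h y.2.1) _ z :=
    HasDerivAt.comp_hasFDerivAt z
      (R.hasDerivAt_of_contDiffOn (R.contDiffOn_deriv hh) hz.2.1) ps.fst
  have key : HasFDerivAt (fun z : ℝ × ℝ × ℝ =>
      (l * e.1, l * e.2.1, deriv h z.2.1 * e.2.1 * z.2.2 + h z.2.1 * e.2.2)) _ z :=
    (hasFDerivAt_const (l * e.1) z).prodMk ((hasFDerivAt_const (l * e.2.1) z).prodMk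
      (((dh'.mul_const e.2.1).mul ps.snd).add (dh.mul_const e.2.2)))
  have := (hasFDerivAt_fderiv_apply R.isOpen_Ω (R.contDiffOn_op l l₁ l₂ hh) hz e).congr_of_eventuallyEq
    he.symm |>.unique key
  have := DFunLike.congr_fun this w
  rw [ContinuousLinearMap.flip_apply] at this
  rw [this]
  simp
  ring

/-- The determining equations for the operator `(l t + l₁) ∂_t + (l x + l₂) ∂_x + h(x) u ∂_u`. -/
structure Det (E : Equation R) (l l₁ l₂ : ℝ) (h : ℝ → ℝ) : Prop where
  smooth : ContDiffOn ℝ ∞ h R.I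
  eqA : ∀ x ∈ R.I, (l * x + l₂) * deriv E.A x + l * E.A x = 0
  eqB : ∀ x ∈ R.I, (l * x + l₂) * deriv E.B x + 2 * l * E.B x = 0
  eqD : ∀ t ∈ R.J, ∀ x ∈ R.I, deriv (deriv h) x + E.A x * deriv h x + E.B x * h x
    + fderiv ℝ E.D (t, x) (l * t + l₁, l * x + l₂) + 2 * l * E.D (t, x) = 0

/-- For operators of this shape all dependence on `u_t`, `u_tx`, `u_xx` cancels. The rest is a
combination of `u`, `u_x` and `u ln|u|` whose coefficients are the three equations of `Det`. -/
lemma op_criterion (E : Equation R) (l l₁ l₂ : ℝ) {h : ℝ → ℝ} (hh : ContDiffOn ℝ ∞ h R.I)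
    {t x u : ℝ} (hz : (t, x, u) ∈ R.Ω) (p q b c : ℝ) :
    prolTT (R.op l l₁ l₂ h) (t, x, u, p, q) (c + E.F (t, x, u, q)) b
      - prolXX (R.op l l₁ l₂ h) (t, x, u, p, q) b c
      - fderiv ℝ E.F (t, x, u, q) ((R.op l l₁ l₂ h (t, x, u)).1, (R.op l l₁ l₂ h (t, x, u)).2.1,
          (R.op l l₁ l₂ h (t, x, u)).2.2, prolX (R.op l l₁ l₂ h) (t, x, u, p, q))
    = -(u * (deriv (deriv h) x + E.A x * deriv h x + E.B x * h x
        + fderiv ℝ E.D (t, x) (l * t + l₁, l * x + l₂) + 2 * l * E.D (t, x)))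
      - q * ((l * x + l₂) * deriv E.A x + l * E.A x)
      - u * Real.log |u| * ((l * x + l₂) * deriv E.B x + 2 * l * E.B x) := by
  obtain ⟨ht, hx, hu⟩ := Region.mem_Ω.1 hz
  have hu0 := Region.ne_zero_of_mem_U hu
  rw [prolTT_eq R.isOpen_Ω (R.contDiffOn_op l l₁ l₂ hh) hz,
    prolXX_eq R.isOpen_Ω (R.contDiffOn_op l l₁ l₂ hh) hz, Region.op_apply hz]
  have hX : prolX (R.op l l₁ l₂ h) (t, x, u, p, q) = deriv h x * u + h x * q - q * l := by
    have : prolX (R.op l l₁ l₂ h) (t, x, u, p, q)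
      = (fderiv ℝ (R.op l l₁ l₂ h) (t, x, u) (0, 1, q)).2.2
        - p * (fderiv ℝ (R.op l l₁ l₂ h) (t, x, u) (0, 1, q)).1
        - q * (fderiv ℝ (R.op l l₁ l₂ h) (t, x, u) (0, 1, q)).2.1 := rfl
    rw [this, R.fderiv_op l l₁ l₂ hh hz]
    simp
  rw [hX]
  simp only [R.fderiv_op l l₁ l₂ hh hz, R.fderiv_fderiv_op l l₁ l₂ hh hz, E.fderiv_F ht hx hu0,
    Equation.F, Prod.fst_add, Prod.snd_add]
  field_simp
  ring

lemma Det.mem_maxAlg {E : Equation R} {l l₁ l₂ : ℝ} {h : ℝ → ℝ} (hd : Det E l l₁ l₂ h) :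
    R.op l l₁ l₂ h ∈ E.maxAlg := by
  refine ⟨fun z hz => Region.op_of_notMem hz, R.contDiffOn_op l l₁ l₂ hd.smooth, ?_⟩
  intro t x u hz p q b c
  obtain ⟨ht, hx, hu⟩ := Region.mem_Ω.1 hz
  rw [op_criterion E l l₁ l₂ hd.smooth hz, hd.eqA x hx, hd.eqB x hx, hd.eqD t ht x hx]
  ring

lemma det_of_mem_maxAlg {E : Equation R} {l l₁ l₂ : ℝ} {h : ℝ → ℝ} (hh : ContDiffOn ℝ ∞ h R.I)
    (hm : R.op l l₁ l₂ h ∈ E.maxAlg) : Det E l l₁ l₂ h := by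
  obtain ⟨t₀, ht₀⟩ := R.nonempty_J
  have key : ∀ t ∈ R.J, ∀ x ∈ R.I, ∀ u ∈ R.U, ∀ q, _ = _ := fun t ht x hx u hu q =>
    (op_criterion E l l₁ l₂ hh (Region.mem_Ω.2 ⟨ht, hx, hu⟩) 0 q 0 0).symm.trans
      (hm.2.2 t x u (Region.mem_Ω.2 ⟨ht, hx, hu⟩) 0 q 0 0)
  have hlog : ∀ t ∈ R.J, ∀ x ∈ R.I, _ := fun t ht x hx =>
    R.eq_zero_of_log (α := (l * x + l₂) * deriv E.B x + 2 * l * E.B x)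
      (β := deriv (deriv h) x + E.A x * deriv h x + E.B x * h x
        + fderiv ℝ E.D (t, x) (l * t + l₁, l * x + l₂) + 2 * l * E.D (t, x))
      fun u hu => by linear_combination -key t ht x hx u hu 0
  refine ⟨hh, fun x hx => ?_, fun x hx => (hlog t₀ ht₀ x hx).1, fun t ht x hx => (hlog t ht x hx).2⟩
  obtain ⟨s, -, hU⟩ := R.exists_sign
  linear_combination key t₀ ht₀ x hx _ (hU 1 one_pos) 0 - key t₀ ht₀ x hx _ (hU 1 one_pos) 1

lemma Region.convex_Ω (R : Region) : Convex ℝ R.Ω := R.convex_J.prod (R.convex_I.prod R.convex_U)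

/-- Integrating the vanishing second derivatives of `τ` and `ξ` over the convex set `Ω` gives affine
functions with a common slope. The relation `η = u η_u` with `η_uu = 0` makes `η / u` independent of
`u`, and `η_t = u η_tu = 0` makes it independent of `t`; so `h` can be read off at fixed `t₀`, `u₀`.
-/
lemma IsSymmetry.exists_eq_op {E : Equation R} {v : VF} (h : IsSymmetry R.Ω E.F v) :
    ∃ (l l₁ l₂ : ℝ) (a : ℝ → ℝ), ContDiffOn ℝ ∞ a R.I ∧ v = R.op l l₁ l₂ a := by
  obtain ⟨t₀, ht₀⟩ := R.nonempty_J
  obtain ⟨x₀, hx₀⟩ := R.nonempty_I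
  obtain ⟨s, -, hU⟩ := R.exists_sign
  set u₀ := s * 1
  have hu₀ : u₀ ∈ R.U := hU 1 one_pos
  have hu₀' := Region.ne_zero_of_mem_U hu₀
  have hpre : IsPreconnected R.Ω := R.convex_Ω.isPreconnected
  have hz₀ : (t₀, x₀, u₀) ∈ R.Ω := Region.mem_Ω.2 ⟨ht₀, hx₀, hu₀⟩
  have hdiff : ∀ z ∈ R.Ω, HasFDerivAt v (fderiv ℝ v z) z := fun z hz =>
    (differentiableAt_of R.isOpen_Ω h.2.1 hz).hasFDerivAt
  obtain ⟨l, hl⟩ : ∃ l, ∀ z ∈ R.Ω, (fderiv ℝ v z (1, 0, 0)).1 = l := by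
    refine R.isOpen_Ω.exists_is_const_of_fderiv_eq_zero hpre (𝕜 := ℝ) (fun z hz => ?_)
      (fun z hz => ?_)
    · exact (hasFDerivAt_fderiv_apply R.isOpen_Ω h.2.1 hz _).fst.differentiableAt.differentiableWithinAt
    · rw [(hasFDerivAt_fderiv_apply R.isOpen_Ω h.2.1 hz _).fst.fderiv]
      refine ContinuousLinearMap.ext fun w => ?_
      simpa using (h.second_order' hz w).1
  have hL : ∀ z ∈ R.Ω, ∀ w, (fderiv ℝ v z w).1 = l * w.1 ∧ (fderiv ℝ v z w).2.1 = l * w.2.1 := by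
    intro z hz w
    obtain ⟨g1, g2, g3, g4⟩ := h.first_order hz
    have g5 := (h.second_order hz).1
    have g6 := hl z hz
    obtain ⟨w₁, w₂, w₃⟩ := w
    rw [clm_triple (fderiv ℝ v z)]
    simp only [Prod.fst_add, Prod.snd_add, Prod.smul_fst, Prod.smul_snd, smul_eq_mul]
    rw [g1, g2, g3, ← g4, g5, g6]
    constructor <;> ring
  obtain ⟨l₁, hl₁⟩ : ∃ l₁, ∀ z ∈ R.Ω, (v z).1 - l * z.1 = l₁ := by
    have hd : ∀ z ∈ R.Ω, HasFDerivAt (fun z => (v z).1 - l * z.1) _ z := fun z hz =>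
      (hdiff z hz).fst.sub ((hasFDerivAt_fst (p := z)).const_mul l)
    refine R.isOpen_Ω.exists_is_const_of_fderiv_eq_zero hpre (𝕜 := ℝ)
      (fun z hz => (hd z hz).differentiableAt.differentiableWithinAt) (fun z hz => ?_)
    rw [(hd z hz).fderiv]
    refine ContinuousLinearMap.ext fun w => ?_
    simp [(hL z hz w).1]
  obtain ⟨l₂, hl₂⟩ : ∃ l₂, ∀ z ∈ R.Ω, (v z).2.1 - l * z.2.1 = l₂ := by
    have hd : ∀ z ∈ R.Ω, HasFDerivAt (fun z => (v z).2.1 - l * z.2.1) _ z := fun z hz =>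
      (hdiff z hz).snd.fst.sub ((hasFDerivAt_snd (p := z)).fst.const_mul l)
    refine R.isOpen_Ω.exists_is_const_of_fderiv_eq_zero hpre (𝕜 := ℝ)
      (fun z hz => (hd z hz).differentiableAt.differentiableWithinAt) (fun z hz => ?_)
    rw [(hd z hz).fderiv]
    refine ContinuousLinearMap.ext fun w => ?_
    simp [(hL z hz w).2]
  have hηt : ∀ z ∈ R.Ω, (fderiv ℝ v z (1, 0, 0)).2.2 = 0 := by
    intro z hz
    have e1 : HasFDerivAt (fun z => (v z).2.2) _ z := (hdiff z hz).snd.snd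
    have e2 : HasFDerivAt (fun z : ℝ × ℝ × ℝ => z.2.2 * (fderiv ℝ v z (0, 0, 1)).2.2) _ z :=
      (hasFDerivAt_snd (p := z)).snd.mul
        (hasFDerivAt_fderiv_apply R.isOpen_Ω h.2.1 hz (0, 0, 1)).snd.snd
    have he : (fun z => (v z).2.2) =ᶠ[nhds z]
        (fun z : ℝ × ℝ × ℝ => z.2.2 * (fderiv ℝ v z (0, 0, 1)).2.2) := by
      filter_upwards [R.isOpen_Ω.mem_nhds hz] with y hy using (h.eta hy).1
    have := DFunLike.congr_fun ((e2.congr_of_eventuallyEq he).unique e1) (1, 0, 0)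
    have h0 := (h.eta hz).2
    simp only [Prod.mk.eta] at h0
    simpa [h0] using this.symm
  refine ⟨l, l₁, l₂, fun x => (v (t₀, x, u₀)).2.2 / u₀, ?_, ?_⟩
  · have : ContDiffOn ℝ ∞ (fun x => v (t₀, x, u₀)) R.I :=
      h.2.1.comp (by fun_prop) (fun x hx => Region.mem_Ω.2 ⟨ht₀, hx, hu₀⟩)
    exact this.snd.snd.div_const u₀
  · funext z
    by_cases hz : z ∈ R.Ω
    swap
    · rw [h.1 z hz, Region.op_of_notMem hz]
    rw [Region.op_apply hz]
    obtain ⟨t, x, u⟩ := z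
    obtain ⟨ht, hx, hu⟩ := Region.mem_Ω.1 hz
    have hconst : (v (t, x, u)).2.2 / u = (v (t₀, x, u₀)).2.2 / u₀ := by
      have hd : ∀ y ∈ R.J ×ˢ R.U, HasFDerivAt
          (fun y : ℝ × ℝ => (v (y.1, x, y.2)).2.2 * y.2⁻¹) _ y := fun y hy =>
        ((hdiff (y.1, x, y.2) (Region.mem_Ω.2 ⟨hy.1, hx, hy.2⟩)).comp y
          ((hasFDerivAt_fst (p := y)).prodMk ((hasFDerivAt_const x y).prodMk
            (hasFDerivAt_snd (p := y))))).snd.snd.mul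
          ((hasDerivAt_inv (Region.ne_zero_of_mem_U hy.2)).comp_hasFDerivAt y
            (hasFDerivAt_snd (𝕜 := ℝ) (p := y)))
      have := (R.isOpen_J.prod R.isOpen_U).is_const_of_fderiv_eq_zero (𝕜 := ℝ)
        (R.convex_J.prod R.convex_U).isPreconnected
        (fun y hy => (hd y hy).differentiableAt.differentiableWithinAt) (fun y hy => ?_)
        (x := (t, u)) (y := (t₀, u₀)) ⟨ht, hu⟩ ⟨ht₀, hu₀⟩
      · simpa [div_eq_mul_inv] using this
      · rw [(hd y hy).fderiv]
        have hy' : (y.1, x, y.2) ∈ R.Ω := Region.mem_Ω.2 ⟨hy.1, hx, hy.2⟩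
        have hy0 := Region.ne_zero_of_mem_U hy.2
        have e1 := hηt _ hy'
        have e2 := (h.eta hy').1
        refine ContinuousLinearMap.ext fun w => ?_
        have e3 := clm_triple (fderiv ℝ v (y.1, x, y.2)) w.1 0 w.2
        simp [e3, e1, e2]
        field_simp
        ring
    have hu0 := Region.ne_zero_of_mem_U hu
    have a := hl₁ _ hz
    have b := hl₂ _ hz
    simp only at a b
    refine Prod.ext (by simp; linarith) (Prod.ext (by simp; linarith) ?_)
    simp only [← hconst]
    field_simp

/-- This turns the maximal algebra into a linear system for `(l, l₁, l₂, h)`, on which the whole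
classification is carried out. -/
theorem mem_maxAlg_iff {E : Equation R} {v : VF} :
    v ∈ E.maxAlg ↔ ∃ (l l₁ l₂ : ℝ) (h : ℝ → ℝ), Det E l l₁ l₂ h ∧ v = R.op l l₁ l₂ h := by
  constructor
  · intro hv
    obtain ⟨l, l₁, l₂, a, ha, rfl⟩ := IsSymmetry.exists_eq_op hv
    exact ⟨l, l₁, l₂, a, det_of_mem_maxAlg ha hv, rfl⟩
  · rintro ⟨l, l₁, l₂, a, ha, rfl⟩
    exact ha.mem_maxAlg

end Determining

/-! ### Global solutions of second-order linear differential equations on an interval -/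

section ODE

/-- The right side of the first-order system of `h'' + A h' + B h = d`. -/
def odeField (A B d : ℝ → ℝ) (t : ℝ) (y : ℝ × ℝ) : ℝ × ℝ :=
  (y.2, d t - A t * y.2 - B t * y.1)

lemma norm_odeField_sub_le {A B d : ℝ → ℝ} {t a b : ℝ} (ha : |A t| ≤ a) (hb : |B t| ≤ b)
    (y z : ℝ × ℝ) : ‖odeField A B d t y - odeField A B d t z‖ ≤ (1 + a + b) * ‖y - z‖ := by
  have h1 : |y.1 - z.1| ≤ ‖y - z‖ := norm_fst_le (y - z)
  have h2 : |y.2 - z.2| ≤ ‖y - z‖ := norm_snd_le (y - z)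
  have h0 := norm_nonneg (y - z)
  have ha0 : 0 ≤ a := (abs_nonneg _).trans ha
  have hb0 : 0 ≤ b := (abs_nonneg _).trans hb
  refine max_le ?_ ?_
  · simp only [odeField, Prod.fst_sub, Real.norm_eq_abs]
    nlinarith [mul_nonneg ha0 h0, mul_nonneg hb0 h0]
  · have e : (odeField A B d t y - odeField A B d t z).2
        = -(A t * (y.2 - z.2)) - B t * (y.1 - z.1) := by
      simp only [odeField, Prod.snd_sub]; ring
    rw [e, Real.norm_eq_abs]
    calc |-(A t * (y.2 - z.2)) - B t * (y.1 - z.1)|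
        ≤ |A t| * |y.2 - z.2| + |B t| * |y.1 - z.1| := by
          rw [← abs_mul, ← abs_mul, ← abs_neg (A t * _)]
          exact abs_sub _ _
      _ ≤ a * ‖y - z‖ + b * ‖y - z‖ := by gcongr
      _ ≤ _ := by linarith

/-- Truncation of a number to `[-r, r]`. -/
def clamp (r y : ℝ) : ℝ := max (-r) (min r y)

lemma clamp_sub_le (r y z : ℝ) : |clamp r y - clamp r z| ≤ |y - z| := by
  unfold clamp
  have := ((LipschitzWith.id.const_min r).const_max (-r)).dist_le_mul y z
  simpa [Real.dist_eq] using this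

lemma clamp_le {r : ℝ} (hr : 0 ≤ r) (y : ℝ) : |clamp r y| ≤ r :=
  abs_le.2 ⟨le_max_left _ _, max_le (by linarith) (min_le_left _ _)⟩

lemma clamp_eq {r y : ℝ} (h : |y| ≤ r) : clamp r y = y := by
  unfold clamp
  rw [min_eq_right (abs_le.1 h).2, max_eq_right (abs_le.1 h).1]

lemma clamp_abs_le {r : ℝ} (hr : 0 ≤ r) (y : ℝ) : |clamp r y| ≤ |y| := by
  have := clamp_sub_le r y 0
  rwa [clamp_eq (y := 0) (by simpa using hr), sub_zero, sub_zero] at this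

/-- The field is Lipschitz but unbounded, whereas Picard–Lindelöf on a prescribed interval needs a
bound on the field. The argument is therefore clamped at the Grönwall bound `r`. The solution of the
clamped system obeys the same estimate, so it never reaches the clamp and solves the original
system. -/
lemma exists_ode_solution_Icc {A B d : ℝ → ℝ} {a b x₀ : ℝ} (hx₀ : x₀ ∈ Icc a b)
    (hA : ContinuousOn A (Icc a b)) (hB : ContinuousOn B (Icc a b))
    (hd : ContinuousOn d (Icc a b)) (y₀ : ℝ × ℝ) :
    ∃ α : ℝ → ℝ × ℝ, α x₀ = y₀ ∧
      ∀ t ∈ Icc a b, HasDerivWithinAt α (odeField A B d t (α t)) (Icc a b) t := by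
  obtain ⟨a₁, ha₁⟩ := isCompact_Icc.exists_bound_of_continuousOn hA
  obtain ⟨b₁, hb₁⟩ := isCompact_Icc.exists_bound_of_continuousOn hB
  obtain ⟨β, hβ⟩ := isCompact_Icc.exists_bound_of_continuousOn hd
  have ha0 : 0 ≤ a₁ := (norm_nonneg _).trans (ha₁ x₀ hx₀)
  have hb0 : 0 ≤ b₁ := (norm_nonneg _).trans (hb₁ x₀ hx₀)
  have hβ0 : 0 ≤ β := (norm_nonneg _).trans (hβ x₀ hx₀)
  set K : ℝ := 1 + a₁ + b₁ with hKdef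
  have hK : 0 ≤ K := by positivity
  set T : ℝ := max (b - x₀) (x₀ - a) with hTdef
  have hT : 0 ≤ T := (sub_nonneg.2 hx₀.2).trans (le_max_left _ _)
  have hmono : Monotone (gronwallBound ‖y₀‖ K β) := gronwallBound_mono (norm_nonneg _) hβ0 hK
  -- An a priori bound for solutions with initial value `y₀` at all times within distance `T` of
  -- `x₀`.
  set r : ℝ := gronwallBound ‖y₀‖ K β T with hrdef
  have hr : 0 ≤ r := (norm_nonneg y₀).trans (by
    have := hmono hT
    rwa [gronwallBound_x0] at this)
  set c : ℝ × ℝ → ℝ × ℝ := fun y => (clamp r y.1, clamp r y.2) with hc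
  set f : ℝ → ℝ × ℝ → ℝ × ℝ := fun t y => odeField A B d t (c y) with hf
  have hc1 : ∀ y z, ‖c y - c z‖ ≤ ‖y - z‖ := fun y z =>
    max_le_max (clamp_sub_le r y.1 z.1) (clamp_sub_le r y.2 z.2)
  have hc2 : ∀ y, ‖c y‖ ≤ ‖y‖ := fun y => max_le_max (clamp_abs_le hr y.1) (clamp_abs_le hr y.2)
  have hc3 : ∀ y, ‖c y‖ ≤ r := fun y => max_le (clamp_le hr y.1) (clamp_le hr y.2)
  have hc4 : ∀ y, ‖y‖ ≤ r → c y = y := fun y hy =>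
    Prod.ext (clamp_eq ((norm_fst_le y).trans hy)) (clamp_eq ((norm_snd_le y).trans hy))
  have hzero : ∀ t ∈ Icc a b, ‖odeField A B d t 0‖ ≤ β := fun t ht => by
    simpa [odeField, Prod.norm_def, hβ0] using hβ t ht
  have hlin : ∀ t ∈ Icc a b, ∀ y, ‖odeField A B d t y‖ ≤ K * ‖y‖ + β := fun t ht y => by
    have h1 := norm_odeField_sub_le (d := d) (ha₁ t ht) (hb₁ t ht) y 0
    rw [sub_zero] at h1
    calc ‖odeField A B d t y‖ ≤ ‖odeField A B d t y - odeField A B d t 0‖ + ‖odeField A B d t 0‖ := by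
          simpa using norm_add_le (odeField A B d t y - odeField A B d t 0) (odeField A B d t 0)
      _ ≤ _ := add_le_add h1 (hzero t ht)
  -- The clamped field is bounded by `K r + β`, so a ball of radius `(K r + β) T` suffices for the
  -- whole interval.
  have hPL : IsPicardLindelof f (⟨x₀, hx₀⟩ : Icc a b) y₀
      ⟨(K * r + β) * T, by positivity⟩ 0 ⟨K * r + β, by positivity⟩ ⟨K, hK⟩ := by
    refine ⟨fun t ht => ?_, fun y _ => ?_, fun t ht y _ => ?_, ?_⟩
    · refine LipschitzOnWith.of_dist_le_mul fun y _ z _ => ?_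
      rw [dist_eq_norm, dist_eq_norm]
      exact (norm_odeField_sub_le (ha₁ t ht) (hb₁ t ht) _ _).trans
        (mul_le_mul_of_nonneg_left (hc1 y z) hK)
    · simp only [hf, odeField]
      fun_prop
    · refine (hlin t ht _).trans ?_
      change K * ‖c y‖ + β ≤ K * r + β
      gcongr
      exact hc3 y
    · simp only [NNReal.coe_zero, sub_zero]
      exact le_rfl
  obtain ⟨α, hα0, hα⟩ := hPL.exists_eq_forall_mem_Icc_hasDerivWithinAt₀
  have hα0' : α x₀ = y₀ := hα0
  have hcont : ContinuousOn α (Icc a b) := fun t ht => (hα t ht).continuousWithinAt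
  have hfb : ∀ t ∈ Icc a b, ‖f t (α t)‖ ≤ K * ‖α t‖ + β := fun t ht =>
    (hlin t ht _).trans (by gcongr; exact hc2 _)
  have hbound : ∀ t ∈ Icc a b, ‖α t‖ ≤ r := by
    intro t ht
    rcases le_total x₀ t with h | h
    · have := norm_le_gronwallBound_of_norm_deriv_right_le (f := α) (f' := fun t => f t (α t))
        (a := x₀) (b := b) (δ := ‖y₀‖) (K := K) (ε := β)
        (hcont.mono (Icc_subset_Icc_left hx₀.1))
        (fun s hs => (hα s ⟨hx₀.1.trans hs.1, hs.2.le⟩).mono_of_mem_nhdsWithin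
          (Icc_mem_nhdsGE_of_mem ⟨hx₀.1.trans hs.1, hs.2⟩)) (by rw [hα0'])
        (fun s hs => hfb s ⟨hx₀.1.trans hs.1, hs.2.le⟩) t ⟨h, ht.2⟩
      exact this.trans (hmono ((sub_le_sub_right ht.2 _).trans (le_max_left _ _)))
    -- Grönwall's inequality runs forwards; times before `x₀` are reached by reflecting the
    -- solution.
    · have := norm_le_gronwallBound_of_norm_deriv_right_le (f := fun s => α (-s))
        (f' := fun s => -f (-s) (α (-s)))
        (a := -x₀) (b := -a) (δ := ‖y₀‖) (K := K) (ε := β)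
        (hcont.comp continuous_neg.continuousOn (fun s hs => ⟨by linarith [hs.2], by
          linarith [hs.1, hx₀.2]⟩))
        (fun s hs => by
          have h1 : -s ∈ Ioc a b := ⟨by linarith [hs.2], by linarith [hs.1, hx₀.2]⟩
          have h2 : HasDerivWithinAt α (f (-s) (α (-s))) (Iic (-s)) (-s) :=
            (hα (-s) ⟨h1.1.le, h1.2⟩).mono_of_mem_nhdsWithin (Icc_mem_nhdsLE_of_mem h1)
          have := h2.scomp s (hasDerivAt_neg s).hasDerivWithinAt
            (s := Ici s) (fun z hz => mem_Iic.2 (neg_le_neg hz))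
          simpa [Function.comp_def] using this) (by simp [hα0'])
        (fun s hs => by
          rw [norm_neg]
          exact hfb (-s) ⟨by linarith [hs.2], by linarith [hs.1, hx₀.2]⟩) (-t)
          ⟨neg_le_neg h, neg_le_neg ht.1⟩
      simp only [neg_neg] at this
      exact this.trans (hmono (le_trans (by linarith [ht.1]) (le_max_right _ _)))
  refine ⟨α, hα0', fun t ht => ?_⟩
  have := hα t ht
  simp only [hf] at this
  rwa [hc4 _ (hbound t ht)] at this

lemma exists_Icc_subset {I : Set ℝ} (hI : IsOpen I) (hI' : I.OrdConnected) {x y : ℝ} (hx : x ∈ I)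
    (hy : y ∈ I) : ∃ a b, x ∈ Ioo a b ∧ y ∈ Ioo a b ∧ Icc a b ⊆ I := by
  have hm : min x y ∈ I := by rcases min_choice x y with h | h <;> rw [h] <;> assumption
  have hM : max x y ∈ I := by rcases max_choice x y with h | h <;> rw [h] <;> assumption
  obtain ⟨ε, hε, h⟩ := Metric.isOpen_iff.1 hI _ hm
  obtain ⟨δ, hδ, h'⟩ := Metric.isOpen_iff.1 hI _ hM
  refine ⟨min x y - ε / 2, max x y + δ / 2, ⟨?_, ?_⟩, ⟨?_, ?_⟩, hI'.out (h ?_) (h' ?_)⟩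
  · linarith [min_le_left x y]
  · linarith [le_max_left x y]
  · linarith [min_le_right x y]
  · linarith [le_max_right x y]
  · rw [Real.ball_eq_Ioo]; constructor <;> linarith
  · rw [Real.ball_eq_Ioo]; constructor <;> linarith

/-- Solutions on compact subintervals through `x₀` agree on overlaps by uniqueness. They are glued
by taking the value at `x` from the subinterval chosen for `x`. -/
lemma exists_ode_solution {A B d : ℝ → ℝ} {I : Set ℝ} (hI : IsOpen I) (hI' : I.OrdConnected)
    {x₀ : ℝ} (hx₀ : x₀ ∈ I) (hA : ContinuousOn A I) (hB : ContinuousOn B I)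
    (hd : ContinuousOn d I) (y₀ : ℝ × ℝ) :
    ∃ α : ℝ → ℝ × ℝ, α x₀ = y₀ ∧ ∀ t ∈ I, HasDerivAt α (odeField A B d t (α t)) t := by
  have H : ∀ x : I, ∃ (a b : ℝ) (α : ℝ → ℝ × ℝ), (x : ℝ) ∈ Ioo a b ∧ x₀ ∈ Ioo a b ∧ Icc a b ⊆ I ∧
      α x₀ = y₀ ∧ ∀ t ∈ Ioo a b, HasDerivAt α (odeField A B d t (α t)) t := by
    rintro ⟨x, hx⟩
    obtain ⟨a, b, h1, h2, h3⟩ := exists_Icc_subset hI hI' hx hx₀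
    obtain ⟨α, h4, h5⟩ := exists_ode_solution_Icc (Ioo_subset_Icc_self h2) (hA.mono h3)
      (hB.mono h3) (hd.mono h3) y₀
    exact ⟨a, b, α, h1, h2, h3, h4, fun t ht =>
      (h5 t (Ioo_subset_Icc_self ht)).hasDerivAt (Icc_mem_nhds ht.1 ht.2)⟩
  choose a b α h1 h2 h3 h4 h5 using H
  have huniq : ∀ x y : I, ∀ t ∈ Ioo (a x) (b x), t ∈ Ioo (a y) (b y) → α x t = α y t := by
    intro x y t ht ht'
    obtain ⟨a₁, ha₁⟩ := isCompact_Icc.exists_bound_of_continuousOn (hA.mono (h3 x))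
    obtain ⟨b₁, hb₁⟩ := isCompact_Icc.exists_bound_of_continuousOn (hB.mono (h3 x))
    have ha0 : 0 ≤ a₁ := (norm_nonneg _).trans (ha₁ x₀ (Ioo_subset_Icc_self (h2 x)))
    have hb0 : 0 ≤ b₁ := (norm_nonneg _).trans (hb₁ x₀ (Ioo_subset_Icc_self (h2 x)))
    have hsub : ∀ s ∈ Ioo (max (a x) (a y)) (min (b x) (b y)),
        s ∈ Ioo (a x) (b x) ∧ s ∈ Ioo (a y) (b y) := fun s hs =>
      ⟨⟨(le_max_left _ _).trans_lt hs.1, hs.2.trans_le (min_le_left _ _)⟩,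
        ⟨(le_max_right _ _).trans_lt hs.1, hs.2.trans_le (min_le_right _ _)⟩⟩
    refine ODE_solution_unique_of_mem_Ioo (v := odeField A B d) (s := fun _ => univ)
      (K := ⟨1 + a₁ + b₁, by positivity⟩) (a := max (a x) (a y)) (b := min (b x) (b y)) (t₀ := x₀)
      (fun s hs => ?_) ⟨max_lt (h2 x).1 (h2 y).1, lt_min (h2 x).2 (h2 y).2⟩
      (fun s hs => ⟨h5 x s (hsub s hs).1, mem_univ _⟩)
      (fun s hs => ⟨h5 y s (hsub s hs).2, mem_univ _⟩) ((h4 x).trans (h4 y).symm)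
      ⟨max_lt ht.1 ht'.1, lt_min ht.2 ht'.2⟩
    refine LipschitzOnWith.of_dist_le_mul fun y _ z _ => ?_
    rw [dist_eq_norm, dist_eq_norm]
    exact norm_odeField_sub_le (ha₁ s (Ioo_subset_Icc_self (hsub s hs).1))
      (hb₁ s (Ioo_subset_Icc_self (hsub s hs).1)) _ _
  classical
  refine ⟨fun x => if hx : x ∈ I then α ⟨x, hx⟩ x else 0, ?_, fun t ht => ?_⟩
  · simp [hx₀, h4]
  · have he : (fun x => if hx : x ∈ I then α ⟨x, hx⟩ x else 0) =ᶠ[nhds t] α ⟨t, ht⟩ := by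
      filter_upwards [Ioo_mem_nhds (h1 ⟨t, ht⟩).1 (h1 ⟨t, ht⟩).2] with x hx
      have hxI : x ∈ I := h3 _ (Ioo_subset_Icc_self hx)
      rw [dif_pos hxI]
      exact huniq ⟨x, hxI⟩ ⟨t, ht⟩ x (h1 ⟨x, hxI⟩) hx
    have h6 := h5 ⟨t, ht⟩ t (h1 ⟨t, ht⟩)
    rw [← he.eq_of_nhds] at h6
    exact h6.congr_of_eventuallyEq he

/-- Bootstrapping: the derivatives of `h` and `k` are built from `h`, `k` and smooth coefficients,
so each order of differentiability yields the next. -/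
lemma contDiffOn_of_system {A B d h k : ℝ → ℝ} {I : Set ℝ} (hI : IsOpen I)
    (hA : ContDiffOn ℝ ∞ A I) (hB : ContDiffOn ℝ ∞ B I) (hd : ContDiffOn ℝ ∞ d I)
    (hh : ∀ x ∈ I, HasDerivAt h (k x) x)
    (hk : ∀ x ∈ I, HasDerivAt k (d x - A x * k x - B x * h x) x) : ContDiffOn ℝ ∞ h I := by
  have key : ∀ n : ℕ, ContDiffOn ℝ n h I ∧ ContDiffOn ℝ n k I := by
    intro n
    induction n with
    | zero =>
      exact ⟨contDiffOn_zero.2 fun x hx => (hh x hx).continuousAt.continuousWithinAt,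
        contDiffOn_zero.2 fun x hx => (hk x hx).continuousAt.continuousWithinAt⟩
    | succ n ih =>
      obtain ⟨ih1, ih2⟩ := ih
      have hn : ((n : ℕ) : WithTop ℕ∞) ≤ ∞ := by exact_mod_cast le_top
      refine ⟨?_, ?_⟩
      · push_cast
        refine (contDiffOn_succ_iff_deriv_of_isOpen hI).2
          ⟨fun x hx => (hh x hx).differentiableAt.differentiableWithinAt, by simp, ?_⟩
        exact ih2.congr fun x hx => (hh x hx).deriv
      · push_cast
        refine (contDiffOn_succ_iff_deriv_of_isOpen hI).2
          ⟨fun x hx => (hk x hx).differentiableAt.differentiableWithinAt, by simp, ?_⟩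
        exact (((hd.of_le hn).sub ((hA.of_le hn).mul ih2)).sub ((hB.of_le hn).mul ih1)).congr
          fun x hx => (hk x hx).deriv
  exact contDiffOn_infty.2 fun n => (key n).1

/-- The operator `h ↦ h'' + A h' + B h`. -/
noncomputable def Equation.L {R : Region} (E : Equation R) (h : ℝ → ℝ) (x : ℝ) : ℝ :=
  deriv (deriv h) x + E.A x * deriv h x + E.B x * h x

lemma Equation.exists_solution {R : Region} (E : Equation R) {d : ℝ → ℝ}
    (hd : ContDiffOn ℝ ∞ d R.I) {x₀ : ℝ} (hx₀ : x₀ ∈ R.I) (a b : ℝ) :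
    ∃ h : ℝ → ℝ, ContDiffOn ℝ ∞ h R.I ∧ h x₀ = a ∧ deriv h x₀ = b ∧
      ∀ x ∈ R.I, E.L h x = d x := by
  obtain ⟨α, h0, hα⟩ := exists_ode_solution R.isOpen_I R.ordConnected_I hx₀
    E.smooth_A.continuousOn E.smooth_B.continuousOn hd.continuousOn (a, b)
  have h1 : ∀ x ∈ R.I, HasDerivAt (fun x => (α x).1) (α x).2 x := fun x hx => by
    simpa [odeField] using (hα x hx).hasFDerivAt.fst.hasDerivAt
  have h2 : ∀ x ∈ R.I, HasDerivAt (fun x => (α x).2)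
      (d x - E.A x * (α x).2 - E.B x * (α x).1) x := fun x hx => by
    simpa [odeField] using (hα x hx).hasFDerivAt.snd.hasDerivAt
  refine ⟨fun x => (α x).1, contDiffOn_of_system R.isOpen_I E.smooth_A E.smooth_B hd h1 h2,
    by simp [h0], by rw [(h1 x₀ hx₀).deriv, h0], fun x hx => ?_⟩
  have he : deriv (fun x => (α x).1) =ᶠ[nhds x] fun x => (α x).2 := by
    filter_upwards [R.isOpen_I.mem_nhds hx] with y hy using (h1 y hy).deriv
  rw [Equation.L, he.deriv_eq, (h2 x hx).deriv, (h1 x hx).deriv]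
  ring

end ODE

/-! ### Primitives and Hadamard's division lemma -/

section Calculus

lemma exists_primitive {I : Set ℝ} (hI : IsOpen I) (hI' : I.OrdConnected) {k : ℝ → ℝ}
    (hk : ContDiffOn ℝ ∞ k I) :
    ∃ g : ℝ → ℝ, ContDiffOn ℝ ∞ g I ∧ ∀ x ∈ I, HasDerivAt g (k x) x := by
  rcases I.eq_empty_or_nonempty with rfl | ⟨x₀, hx₀⟩
  · exact ⟨0, contDiffOn_const, fun x hx => hx.elim⟩
  -- With `A = B = 0` the second component of the system has derivative `k`.
  obtain ⟨α, -, hα⟩ := exists_ode_solution hI hI' hx₀ (A := fun _ => 0) (B := fun _ => 0)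
    continuousOn_const continuousOn_const hk.continuousOn (0, 0)
  have h : ∀ x ∈ I, HasDerivAt (fun x => (α x).2) (k x) x := fun x hx => by
    simpa [odeField] using (hα x hx).hasFDerivAt.snd.hasDerivAt
  exact ⟨_, (contDiffOn_infty_iff_deriv_of_isOpen hI).2
    ⟨fun x hx => (h x hx).differentiableAt.differentiableWithinAt,
      hk.congr fun x hx => (h x hx).deriv⟩, h⟩

lemma segment_mem {I : Set ℝ} (hI' : I.OrdConnected) {c x s : ℝ} (hc : c ∈ I) (hx : x ∈ I)
    (hs : s ∈ Icc (0 : ℝ) 1) : c + s * (x - c) ∈ I := by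
  have := hI'.convex.add_smul_sub_mem hc hx hs
  simpa using this

/-- Each differentiation in `x` under the integral brings out one more factor `s`. Carrying the
power `s ^ n` makes the induction on smoothness in `exists_eq_sub_mul` close. -/
lemma hasDerivAt_integral_segment {I : Set ℝ} (hI : IsOpen I) (hI' : I.OrdConnected) {c : ℝ}
    (hc : c ∈ I) {φ : ℝ → ℝ} (hφ : ContDiffOn ℝ ∞ φ I) (n : ℕ) {x : ℝ} (hx : x ∈ I) :
    HasDerivAt (fun x => ∫ s in (0 : ℝ)..1, s ^ n * φ (c + s * (x - c)))
      (∫ s in (0 : ℝ)..1, s ^ (n + 1) * deriv φ (c + s * (x - c))) x := by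
  obtain ⟨a, b, hxa, hca, hsub⟩ := exists_Icc_subset hI hI' hx hc
  have hφ' : ContDiffOn ℝ ∞ (deriv φ) I := ((contDiffOn_infty_iff_deriv_of_isOpen hI).1 hφ).2
  obtain ⟨C, hC⟩ := isCompact_Icc.exists_bound_of_continuousOn (hφ'.continuousOn.mono hsub)
  have hmem : ∀ y ∈ Ioo a b, ∀ s ∈ Icc (0 : ℝ) 1, c + s * (y - c) ∈ Ioo a b := fun y hy s hs =>
    segment_mem ordConnected_Ioo hca hy hs
  have hsubo : Ioo a b ⊆ I := Ioo_subset_Icc_self.trans hsub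
  have hcont : ∀ ψ : ℝ → ℝ, ContinuousOn ψ I → ∀ m : ℕ, ∀ y ∈ Ioo a b,
      ContinuousOn (fun s => s ^ m * ψ (c + s * (y - c))) (uIcc 0 1) := by
    intro ψ hψ m y hy
    rw [uIcc_of_le zero_le_one]
    exact (continuous_pow m).continuousOn.mul (hψ.comp (by fun_prop)
      fun s hs => hsubo (hmem y hy s hs))
  have key := intervalIntegral.hasDerivAt_integral_of_dominated_loc_of_deriv_le
    (μ := MeasureTheory.volume) (a := 0) (b := 1) (bound := fun _ => C)
    (F := fun y s => s ^ n * φ (c + s * (y - c)))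
    (F' := fun y s => s ^ (n + 1) * deriv φ (c + s * (y - c))) (x₀ := x) (s := Ioo a b)
    (Ioo_mem_nhds hxa.1 hxa.2) ?_ ?_ ?_ ?_ ?_ ?_
  · exact key.2
  · filter_upwards [Ioo_mem_nhds hxa.1 hxa.2] with y hy
    exact ((hcont φ hφ.continuousOn n y hy).intervalIntegrable.1).aestronglyMeasurable.mono_measure
      (by rw [uIoc_of_le zero_le_one])
  · exact (hcont φ hφ.continuousOn n x hxa).intervalIntegrable
  · exact ((hcont _ hφ'.continuousOn (n + 1) x hxa).intervalIntegrable.1).aestronglyMeasurable.mono_measure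
      (by rw [uIoc_of_le zero_le_one])
  · refine Filter.Eventually.of_forall fun s hs y hy => ?_
    rw [uIoc_of_le zero_le_one] at hs
    have h1 := hC _ (Ioo_subset_Icc_self (hmem y hy s ⟨hs.1.le, hs.2⟩))
    rw [norm_mul]
    have h2 : ‖s ^ (n + 1)‖ ≤ 1 := by
      rw [norm_pow, Real.norm_eq_abs, abs_of_pos hs.1]
      exact pow_le_one₀ hs.1.le hs.2
    calc _ ≤ 1 * C := mul_le_mul h2 h1 (norm_nonneg _) zero_le_one
      _ = C := one_mul C
  · exact intervalIntegrable_const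
  · refine Filter.Eventually.of_forall fun s hs y hy => ?_
    rw [uIoc_of_le zero_le_one] at hs
    have h1 : HasDerivAt φ (deriv φ (c + s * (y - c))) (c + s * (y - c)) :=
      ((hφ.contDiffAt (hI.mem_nhds (hsubo (hmem y hy s ⟨hs.1.le, hs.2⟩)))).differentiableAt
        (by simp)).hasDerivAt
    have h2 : HasDerivAt (fun y => c + s * (y - c)) s y := by
      simpa using (((hasDerivAt_id y).sub_const c).const_mul s).const_add c
    exact ((h1.comp y h2).const_mul (s ^ n)).congr_deriv (by ring)

/-- Division of a smooth function that vanishes at `c` by `x - c`. -/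
lemma exists_eq_sub_mul {I : Set ℝ} (hI : IsOpen I) (hI' : I.OrdConnected) {c : ℝ}
    (hc : c ∈ I) {h : ℝ → ℝ} (hh : ContDiffOn ℝ ∞ h I) (h0 : h c = 0) :
    ∃ k : ℝ → ℝ, ContDiffOn ℝ ∞ k I ∧ ∀ x ∈ I, h x = (x - c) * k x := by
  have hsm : ∀ m : ℕ, ∀ φ : ℝ → ℝ, ContDiffOn ℝ ∞ φ I → ∀ n : ℕ,
      ContDiffOn ℝ m (fun x => ∫ s in (0 : ℝ)..1, s ^ n * φ (c + s * (x - c))) I := by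
    intro m
    induction m with
    | zero =>
      intro φ hφ n
      exact contDiffOn_zero.2 fun x hx =>
        (hasDerivAt_integral_segment hI hI' hc hφ n hx).continuousAt.continuousWithinAt
    | succ m ih =>
      intro φ hφ n
      push_cast
      refine (contDiffOn_succ_iff_deriv_of_isOpen hI).2
        ⟨fun x hx => (hasDerivAt_integral_segment hI hI' hc hφ n
          hx).differentiableAt.differentiableWithinAt, by simp, ?_⟩
      exact (ih _ ((contDiffOn_infty_iff_deriv_of_isOpen hI).1 hφ).2 (n + 1)).congr
        fun x hx => (hasDerivAt_integral_segment hI hI' hc hφ n hx).deriv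
  have hh' : ContDiffOn ℝ ∞ (deriv h) I := ((contDiffOn_infty_iff_deriv_of_isOpen hI).1 hh).2
  -- The quotient is `∫₀¹ h'(c + s (x - c)) ds`, by the fundamental theorem of calculus along the
  -- segment from `c` to `x`.
  refine ⟨_, contDiffOn_infty.2 fun m => hsm m (deriv h) hh' 0, fun x hx => ?_⟩
  have hcont : ContinuousOn (fun s => (x - c) * deriv h (c + s * (x - c))) (uIcc 0 1) := by
    rw [uIcc_of_le zero_le_one]
    exact continuousOn_const.mul (hh'.continuousOn.comp (by fun_prop)
      fun s hs => segment_mem hI' hc hx hs)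
  have := intervalIntegral.integral_eq_sub_of_hasDerivAt (a := 0) (b := 1)
    (f := fun s => h (c + s * (x - c))) (f' := fun s => (x - c) * deriv h (c + s * (x - c)))
    (fun s hs => by
      rw [uIcc_of_le zero_le_one] at hs
      have h1 : HasDerivAt h (deriv h (c + s * (x - c))) (c + s * (x - c)) :=
        ((hh.contDiffAt (hI.mem_nhds (segment_mem hI' hc hx hs))).differentiableAt
          (by simp)).hasDerivAt
      have h2 : HasDerivAt (fun s => c + s * (x - c)) (x - c) s := hasDerivAt_affine _ _ _
      exact (h1.comp s h2).congr_deriv (by ring)) hcont.intervalIntegrable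
  rw [intervalIntegral.integral_const_mul] at this
  simp only [pow_zero, one_mul]
  rw [this]
  simp [h0]

end Calculus

/-! ### The solution space of `L h = 0` and the form of the coefficients -/

section Solutions

variable {R : Region} {E : Equation R}

lemma Region.isPreconnected_I (R : Region) : IsPreconnected R.I := R.convex_I.isPreconnected

/-- The derivative of a Wronskian. -/
lemma hasDerivAt_wr {f g : ℝ → ℝ} (hf : ContDiffOn ℝ ∞ f R.I) (hg : ContDiffOn ℝ ∞ g R.I) {x : ℝ}
    (hx : x ∈ R.I) : HasDerivAt (wr f g) (deriv (deriv f) x * g x - f x * deriv (deriv g) x) x := by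
  have h1 := R.hasDerivAt_of_contDiffOn hf hx
  have h2 := R.hasDerivAt_of_contDiffOn hg hx
  have h3 := R.hasDerivAt_of_contDiffOn (R.contDiffOn_deriv hf) hx
  have h4 := R.hasDerivAt_of_contDiffOn (R.contDiffOn_deriv hg) hx
  have := (h3.mul h2).sub (h1.mul h4)
  exact this.congr_deriv (by ring)

/-- A zero direction kills the derivative of `D`, so `D` drops out and only the linear equation
survives. -/
lemma det_zero_iff {h : ℝ → ℝ} :
    Det E 0 0 0 h ↔ ContDiffOn ℝ ∞ h R.I ∧ ∀ x ∈ R.I, E.L h x = 0 := by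
  obtain ⟨t₀, ht₀⟩ := R.nonempty_J
  constructor
  · intro hd
    refine ⟨hd.smooth, fun x hx => ?_⟩
    have := hd.eqD t₀ ht₀ x hx
    have h0 : fderiv ℝ E.D (t₀, x) (0, 0) = 0 := map_zero _
    simpa [h0, Equation.L] using this
  · rintro ⟨h1, h2⟩
    refine ⟨h1, by simp, by simp, fun t _ x hx => ?_⟩
    have h0 : fderiv ℝ E.D (t, x) (0, 0) = 0 := map_zero _
    simpa [h0, Equation.L] using h2 x hx

/-- `L f = L g = 0` is a linear system for `A`, `B` with determinant `σ = wr f g`; the prescribed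
formulas are Cramer's rule. -/
lemma invariantForm_iff {f g : ℝ → ℝ} : InvariantForm E f g ↔
    Det E 0 0 0 f ∧ Det E 0 0 0 g ∧ ∀ x ∈ R.I, wr f g x ≠ 0 := by
  rw [det_zero_iff, det_zero_iff]
  constructor
  · rintro ⟨hf, hg, h⟩
    refine ⟨⟨hf, fun x hx => ?_⟩, ⟨hg, fun x hx => ?_⟩, fun x hx => (h x hx).1⟩ <;>
    · obtain ⟨h0, hA, hB⟩ := h x hx
      rw [(hasDerivAt_wr hf hg hx).deriv] at hA
      rw [Equation.L, hA, hB]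
      field_simp
      simp only [wr, rh]
      ring
  · rintro ⟨⟨hf, hLf⟩, ⟨hg, hLg⟩, h⟩
    refine ⟨hf, hg, fun x hx => ⟨h x hx, ?_, ?_⟩⟩
    · have h0 := h x hx
      have e1 := hLf x hx
      have e2 := hLg x hx
      rw [(hasDerivAt_wr hf hg hx).deriv]
      simp only [Equation.L] at e1 e2
      field_simp
      simp only [wr]
      linear_combination g x * e1 - f x * e2
    · have h0 := h x hx
      have e1 := hLf x hx
      have e2 := hLg x hx
      simp only [Equation.L] at e1 e2
      field_simp
      simp only [wr, rh]
      linear_combination -deriv g x * e1 + deriv f x * e2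

/-- The solutions with initial data `(0, 1)` and `(1, 0)` have Wronskian one at `x₀`. By Abel's
formula the Wronskian times `exp ∫ A` is constant, so it vanishes nowhere. -/
lemma exists_invariantForm (E : Equation R) : ∃ f g : ℝ → ℝ, InvariantForm E f g := by
  obtain ⟨x₀, hx₀⟩ := R.nonempty_I
  obtain ⟨f, hf, f0, f1, hLf⟩ := E.exists_solution (d := fun _ => 0) contDiffOn_const hx₀ 0 1
  obtain ⟨g, hg, g0, g1, hLg⟩ := E.exists_solution (d := fun _ => 0) contDiffOn_const hx₀ 1 0
  refine ⟨f, g, invariantForm_iff.2 ⟨det_zero_iff.2 ⟨hf, hLf⟩, det_zero_iff.2 ⟨hg, hLg⟩, ?_⟩⟩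
  obtain ⟨P, hP, hP'⟩ := exists_primitive R.isOpen_I R.ordConnected_I E.smooth_A
  have hd : ∀ x ∈ R.I, HasDerivAt (fun x => wr f g x * Real.exp (P x)) 0 x := fun x hx => by
    refine ((hasDerivAt_wr hf hg hx).mul (hP' x hx).exp).congr_deriv ?_
    have e1 := hLf x hx
    have e2 := hLg x hx
    simp only [Equation.L] at e1 e2
    simp only [wr]
    linear_combination Real.exp (P x) * (g x * e1 - f x * e2)
  intro x hx h0
  have := R.isOpen_I.is_const_of_deriv_eq_zero R.isPreconnected_I
    (fun x hx => (hd x hx).differentiableAt.differentiableWithinAt)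
    (fun x hx => (hd x hx).deriv) hx hx₀
  rw [h0, zero_mul] at this
  simp only [wr, f0, f1, g0, g1, mul_one, zero_mul, sub_zero, one_mul] at this
  exact (Real.exp_pos _).ne this

/-- Two solutions with nonvanishing Wronskian span the solution space. -/
lemma InvariantForm.exists_comb {f g h : ℝ → ℝ} (hfg : InvariantForm E f g)
    (hh : Det E 0 0 0 h) : ∃ a b : ℝ, ∀ x ∈ R.I, h x = a * f x + b * g x := by
  obtain ⟨hf, hg, h0⟩ := invariantForm_iff.1 hfg
  rw [det_zero_iff] at hf hg hh
  -- The coefficients are quotients of Wronskians by Cramer's rule. Numerator and denominator solve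
  -- the same equation `w' = -A w`, so the quotients are constant.
  have key : ∀ k : ℝ → ℝ, (ContDiffOn ℝ ∞ k R.I ∧ ∀ x ∈ R.I, E.L k x = 0) →
      ∃ a, ∀ x ∈ R.I, wr h k x / wr f g x = a := by
    rintro k ⟨hk, hLk⟩
    have hd : ∀ x ∈ R.I, HasDerivAt (fun x => wr h k x / wr f g x) 0 x := fun x hx => by
      refine ((hasDerivAt_wr hh.1 hk hx).div (hasDerivAt_wr hf.1 hg.1 hx) (h0 x hx)).congr_deriv ?_
      have e1 := hh.2 x hx
      have e2 := hLk x hx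
      have e3 := hf.2 x hx
      have e4 := hg.2 x hx
      rw [div_eq_zero_iff]
      left
      simp only [Equation.L] at e1 e2 e3 e4
      simp only [wr]
      linear_combination (k x * e1 - h x * e2) * (deriv f x * g x - f x * deriv g x)
        - (g x * e3 - f x * e4) * (deriv h x * k x - h x * deriv k x)
    exact R.isOpen_I.exists_is_const_of_deriv_eq_zero R.isPreconnected_I
      (fun x hx => (hd x hx).differentiableAt.differentiableWithinAt) (fun x hx => (hd x hx).deriv)
  obtain ⟨a, ha⟩ := key g hg
  obtain ⟨b, hb⟩ := key f hf
  refine ⟨a, -b, fun x hx => ?_⟩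
  rw [← ha x hx, ← hb x hx]
  have := h0 x hx
  field_simp
  simp only [wr]
  ring

end Solutions

/-! ### Linear relations between the operators -/

section Span

variable {R : Region} {E : Equation R}

lemma Region.op_congr {l l₁ l₂ : ℝ} {h h' : ℝ → ℝ} (hh : ∀ x ∈ R.I, h x = h' x) :
    R.op l l₁ l₂ h = R.op l l₁ l₂ h' := by
  funext z
  by_cases hz : z ∈ R.Ω
  · rw [Region.op_apply hz, Region.op_apply hz, hh _ hz.2.1]
  · rw [Region.op_of_notMem hz, Region.op_of_notMem hz]

lemma Region.op_add (l l₁ l₂ l' l₁' l₂' : ℝ) (h h' : ℝ → ℝ) :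
    R.op l l₁ l₂ h + R.op l' l₁' l₂' h'
      = R.op (l + l') (l₁ + l₁') (l₂ + l₂') (fun x => h x + h' x) := by
  funext z
  by_cases hz : z ∈ R.Ω
  · rw [Pi.add_apply, Region.op_apply hz, Region.op_apply hz, Region.op_apply hz]
    refine Prod.ext ?_ (Prod.ext ?_ ?_) <;> simp <;> ring
  · rw [Pi.add_apply, Region.op_of_notMem hz, Region.op_of_notMem hz, Region.op_of_notMem hz,
      add_zero]

lemma Region.smul_op (a l l₁ l₂ : ℝ) (h : ℝ → ℝ) :
    a • R.op l l₁ l₂ h = R.op (a * l) (a * l₁) (a * l₂) (fun x => a * h x) := by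
  funext z
  by_cases hz : z ∈ R.Ω
  · rw [Pi.smul_apply, Region.op_apply hz, Region.op_apply hz]
    refine Prod.ext ?_ (Prod.ext ?_ ?_) <;> simp <;> ring
  · rw [Pi.smul_apply, Region.op_of_notMem hz, Region.op_of_notMem hz, smul_zero]

lemma Region.op_zero : R.op 0 0 0 (fun _ => 0) = 0 := by
  funext z
  by_cases hz : z ∈ R.Ω
  · rw [Region.op_apply hz]; simp
  · rw [Region.op_of_notMem hz]; rfl

lemma eq_zero_of_affine {S : Set ℝ} (hS : IsOpen S) (hne : S.Nonempty) {a b : ℝ}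
    (h : ∀ t ∈ S, a * t + b = 0) : a = 0 ∧ b = 0 := by
  obtain ⟨t, ht⟩ := hne
  obtain ⟨ε, hε, hb⟩ := Metric.isOpen_iff.1 hS t ht
  have h1 := h t ht
  have h2 := h (t + ε / 2) (hb (by rw [Real.ball_eq_Ioo]; constructor <;> linarith))
  have : a * (ε / 2) = 0 := by linarith
  have ha : a = 0 := (mul_eq_zero.1 this).resolve_right (by positivity)
  subst ha
  exact ⟨rfl, by linarith⟩

lemma Region.op_inj {l l₁ l₂ l' l₁' l₂' : ℝ} {h h' : ℝ → ℝ}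
    (he : R.op l l₁ l₂ h = R.op l' l₁' l₂' h') :
    l = l' ∧ l₁ = l₁' ∧ l₂ = l₂' ∧ ∀ x ∈ R.I, h x = h' x := by
  obtain ⟨t₀, ht₀⟩ := R.nonempty_J
  obtain ⟨x₀, hx₀⟩ := R.nonempty_I
  obtain ⟨s, -, hU⟩ := R.exists_sign
  have hu := hU 1 one_pos
  have key : ∀ t ∈ R.J, ∀ x ∈ R.I, (l * t + l₁, l * x + l₂, h x * (s * 1)) =
      (l' * t + l₁', l' * x + l₂', h' x * (s * 1)) := fun t ht x hx => by
    have hz : (t, x, s * 1) ∈ R.Ω := Region.mem_Ω.2 ⟨ht, hx, hu⟩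
    have := congrFun he (t, x, s * 1)
    rwa [Region.op_apply hz, Region.op_apply hz] at this
  simp only [Prod.mk.injEq] at key
  obtain ⟨h1, h2⟩ := eq_zero_of_affine R.isOpen_J R.nonempty_J (a := l - l') (b := l₁ - l₁')
    (fun t ht => by linear_combination (key t ht x₀ hx₀).1)
  have h3 := (key t₀ ht₀ x₀ hx₀).2.1
  have hl : l = l' := by linarith
  refine ⟨hl, by linarith, by rw [hl] at h3; linarith, fun x hx => ?_⟩
  exact mul_right_cancel₀ (Region.ne_zero_of_mem_U hu) (key t₀ ht₀ x hx).2.2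

/-- Linearity is inherited from the subspace `maxAlg`, which spares checking the equations by hand.
-/
lemma Det.comb {l l₁ l₂ l' l₁' l₂' : ℝ} {h h' : ℝ → ℝ} (hd : Det E l l₁ l₂ h)
    (hd' : Det E l' l₁' l₂' h') (a : ℝ) :
    Det E (a * l + l') (a * l₁ + l₁') (a * l₂ + l₂') (fun x => a * h x + h' x) := by
  refine det_of_mem_maxAlg ((contDiffOn_const.mul hd.smooth).add hd'.smooth) ?_
  have := add_mem (E.maxAlg.smul_mem a hd.mem_maxAlg) hd'.mem_maxAlg
  rwa [Region.smul_op, Region.op_add] at this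

lemma Det.smul {l l₁ l₂ : ℝ} {h : ℝ → ℝ} (hd : Det E l l₁ l₂ h) (a : ℝ) :
    Det E (a * l) (a * l₁) (a * l₂) (fun x => a * h x) := by
  refine det_of_mem_maxAlg (contDiffOn_const.mul hd.smooth) ?_
  have := E.maxAlg.smul_mem a hd.mem_maxAlg
  rwa [Region.smul_op] at this

lemma Det.congr {l l₁ l₂ : ℝ} {h h' : ℝ → ℝ} (hd : Det E l l₁ l₂ h)
    (hh : ∀ x ∈ R.I, h' x = h x) : Det E l l₁ l₂ h' :=
  det_of_mem_maxAlg (hd.smooth.congr hh) (Region.op_congr hh ▸ hd.mem_maxAlg)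

/-- Functions whose Wronskian does not vanish identically are independent on `I`. -/
lemma Region.indep_of_wr {f g : ℝ → ℝ} (hf : ContDiffOn ℝ ∞ f R.I) (hg : ContDiffOn ℝ ∞ g R.I)
    (hw : ∃ x ∈ R.I, wr f g x ≠ 0) {a b : ℝ} (h : ∀ x ∈ R.I, a * f x + b * g x = 0) :
    a = 0 ∧ b = 0 := by
  obtain ⟨x, hx, h0⟩ := hw
  have h1 := R.hasDerivAt_of_contDiffOn hf hx
  have h2 := R.hasDerivAt_of_contDiffOn hg hx
  have hd : HasDerivAt (fun x => a * f x + b * g x) 0 x := by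
    refine (hasDerivAt_const x (0 : ℝ)).congr_of_eventuallyEq ?_
    filter_upwards [R.isOpen_I.mem_nhds hx] with y hy using h y hy
  have e1 := hd.unique ((h1.const_mul a).add (h2.const_mul b))
  have e2 := h x hx
  refine ⟨(mul_eq_zero.1 (?_ : a * wr f g x = 0)).resolve_right h0,
    (mul_eq_zero.1 (?_ : b * wr f g x = 0)).resolve_right h0⟩
  · simp only [wr]; linear_combination -g x * e1 - deriv g x * e2
  · simp only [wr]; linear_combination f x * e1 + deriv f x * e2

lemma Region.eq_zero_of_comb {l l₁ l₂ : ℝ} {h f g : ℝ → ℝ} (hne : l ≠ 0 ∨ l₁ ≠ 0 ∨ l₂ ≠ 0)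
    (hf : ContDiffOn ℝ ∞ f R.I) (hg : ContDiffOn ℝ ∞ g R.I) (hw : ∃ x ∈ R.I, wr f g x ≠ 0)
    {a b c : ℝ} (h0 : a • R.op l l₁ l₂ h + b • R.mulU f + c • R.mulU g = 0) :
    a = 0 ∧ b = 0 ∧ c = 0 := by
  rw [Region.smul_op, Region.smul_op, Region.smul_op, Region.op_add, Region.op_add,
    ← Region.op_zero (R := R)] at h0
  obtain ⟨e1, e2, e3, e4⟩ := Region.op_inj h0
  have ha : a = 0 := by
    by_contra ha
    simp [ha] at e1 e2 e3
    tauto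
  subst ha
  exact ⟨rfl, R.indep_of_wr hf hg hw fun x hx => by simpa using e4 x hx⟩

lemma Region.linearIndependent_op_first {l l₁ l₂ : ℝ} {h f g : ℝ → ℝ}
    (hne : l ≠ 0 ∨ l₁ ≠ 0 ∨ l₂ ≠ 0) (hf : ContDiffOn ℝ ∞ f R.I) (hg : ContDiffOn ℝ ∞ g R.I)
    (hw : ∃ x ∈ R.I, wr f g x ≠ 0) :
    LinearIndependent ℝ ![R.op l l₁ l₂ h, R.mulU f, R.mulU g] := by
  rw [Fintype.linearIndependent_iff]
  intro c hc
  rw [Fin.sum_univ_three] at hc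
  obtain ⟨h1, h2, h3⟩ := R.eq_zero_of_comb hne hf hg hw hc
  intro i
  fin_cases i <;> assumption

lemma Region.linearIndependent_op_last {l l₁ l₂ : ℝ} {h f g : ℝ → ℝ}
    (hne : l ≠ 0 ∨ l₁ ≠ 0 ∨ l₂ ≠ 0) (hf : ContDiffOn ℝ ∞ f R.I) (hg : ContDiffOn ℝ ∞ g R.I)
    (hw : ∃ x ∈ R.I, wr f g x ≠ 0) :
    LinearIndependent ℝ ![R.mulU f, R.mulU g, R.op l l₁ l₂ h] := by
  rw [Fintype.linearIndependent_iff]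
  intro c hc
  rw [Fin.sum_univ_three] at hc
  have hc' : c 2 • R.op l l₁ l₂ h + c 0 • R.mulU f + c 1 • R.mulU g = 0 := by
    rw [← hc]
    simp only [Matrix.cons_val]
    abel
  obtain ⟨h1, h2, h3⟩ := R.eq_zero_of_comb hne hf hg hw hc'
  intro i
  fin_cases i <;> assumption

lemma Region.linearIndependent_pair {f g : ℝ → ℝ} (hf : ContDiffOn ℝ ∞ f R.I)
    (hg : ContDiffOn ℝ ∞ g R.I) (hw : ∃ x ∈ R.I, wr f g x ≠ 0) :
    LinearIndependent ℝ ![R.mulU f, R.mulU g] := by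
  rw [LinearIndependent.pair_iff]
  intro a b h
  exact (R.eq_zero_of_comb (l := 1) (l₁ := 0) (l₂ := 0) (h := f) (a := 0)
    (.inl one_ne_zero) hf hg hw (by rwa [zero_smul, zero_add])).2

lemma finrank_span_triple {e₁ e₂ e₃ : VF} (h : LinearIndependent ℝ ![e₁, e₂, e₃]) :
    Module.finrank ℝ (Submodule.span ℝ {e₁, e₂, e₃}) = 3 := by
  have := finrank_span_eq_card h
  rwa [Matrix.range_cons, Matrix.range_cons_cons_empty, Set.singleton_union, Fintype.card_fin]
    at this

lemma span_triple_eq {e₁ e₂ e₃ : VF} {L : Submodule ℝ VF} (h : LinearIndependent ℝ ![e₁, e₂, e₃])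
    (hL : Module.finrank ℝ L = 3) (h₁ : e₁ ∈ L) (h₂ : e₂ ∈ L) (h₃ : e₃ ∈ L) :
    Submodule.span ℝ {e₁, e₂, e₃} = L := by
  have : FiniteDimensional ℝ L := FiniteDimensional.of_finrank_pos (by omega)
  refine Submodule.eq_of_le_of_finrank_eq ?_ ((finrank_span_triple h).trans hL.symm)
  rw [Submodule.span_le]
  rintro v (rfl | rfl | rfl) <;> assumption

/-- If no symmetry moves `t` or `x`, all symmetries come from solutions of `L h = 0`, which are
combinations of `f` and `g`. -/
lemma maxAlg_eq_span_pair {f g : ℝ → ℝ} (hfg : InvariantForm E f g)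
    (H : ∀ l l₁ l₂ h, Det E l l₁ l₂ h → l = 0 ∧ l₁ = 0 ∧ l₂ = 0) :
    E.maxAlg = Submodule.span ℝ {R.mulU f, R.mulU g} := by
  obtain ⟨hf, hg, -⟩ := invariantForm_iff.1 hfg
  refine le_antisymm (fun v hv => ?_) (Submodule.span_le.2 ?_)
  · obtain ⟨l, l₁, l₂, h, hd, rfl⟩ := mem_maxAlg_iff.1 hv
    obtain ⟨rfl, rfl, rfl⟩ := H _ _ _ _ hd
    obtain ⟨a, b, hab⟩ := hfg.exists_comb hd
    rw [Submodule.mem_span_pair]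
    refine ⟨a, b, ?_⟩
    rw [Region.smul_op, Region.smul_op, Region.op_add]
    simp only [mul_zero, add_zero]
    exact Region.op_congr fun x hx => (hab x hx).symm
  · rintro v (rfl | rfl)
    exacts [hf.mem_maxAlg, hg.mem_maxAlg]

/-- Otherwise two operators would span the whole algebra. -/
lemma exists_det_of_finrank (hE : Module.finrank ℝ E.maxAlg = 3) {f g : ℝ → ℝ}
    (hfg : InvariantForm E f g) :
    ∃ l l₁ l₂ h, Det E l l₁ l₂ h ∧ (l ≠ 0 ∨ l₁ ≠ 0 ∨ l₂ ≠ 0) := by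
  by_contra hcon
  push Not at hcon
  have := maxAlg_eq_span_pair hfg fun l l₁ l₂ h hd => by
    by_contra h'
    have := hcon l l₁ l₂ h hd
    tauto
  have h2 : Module.finrank ℝ (Submodule.span ℝ {R.mulU f, R.mulU g}) ≤ 2 := by
    classical
    have := finrank_span_finset_le_card (R := ℝ) ({R.mulU f, R.mulU g} : Finset VF)
    rw [Finset.coe_pair] at this
    exact this.trans Finset.card_le_two
  rw [← this] at h2
  omega

end Span

/-! ### Commutators and isomorphism types -/

section Types

variable {R : Region} {E : Equation R}

lemma bracket_apply (v w : VF) (z : ℝ × ℝ × ℝ) :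
    bracket v w z = fderiv ℝ w z (v z) - fderiv ℝ v z (w z) := rfl

lemma bracket_mulU_op (l l₁ l₂ : ℝ) {f h : ℝ → ℝ} (hf : ContDiffOn ℝ ∞ f R.I)
    (hh : ContDiffOn ℝ ∞ h R.I) :
    bracket (R.mulU f) (R.op l l₁ l₂ h) = R.mulU (fun x => -((l * x + l₂) * deriv f x)) := by
  funext z
  rw [bracket_apply]
  by_cases hz : z ∈ R.Ω
  · rw [R.fderiv_op _ _ _ hh hz, R.fderiv_op _ _ _ hf hz]
    simp only [Region.op_apply hz]
    simp
    ring
  · simp [Region.op_of_notMem hz]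

lemma bracket_op_mulU (l l₁ l₂ : ℝ) {f h : ℝ → ℝ} (hf : ContDiffOn ℝ ∞ f R.I)
    (hh : ContDiffOn ℝ ∞ h R.I) :
    bracket (R.op l l₁ l₂ h) (R.mulU f) = R.mulU (fun x => (l * x + l₂) * deriv f x) := by
  funext z
  rw [bracket_apply]
  by_cases hz : z ∈ R.Ω
  · rw [R.fderiv_op _ _ _ hh hz, R.fderiv_op _ _ _ hf hz]
    simp only [Region.op_apply hz]
    simp
    ring
  · simp [Region.op_of_notMem hz]

lemma bracket_mulU_mulU {f g : ℝ → ℝ} (hf : ContDiffOn ℝ ∞ f R.I) (hg : ContDiffOn ℝ ∞ g R.I) :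
    bracket (R.mulU f) (R.mulU g) = 0 := by
  rw [bracket_mulU_op 0 0 0 hf hg, ← Region.op_zero (R := R)]
  simp

/-- Normal forms of the matrix `(a, b; c, d)` of `ad` of an operator on the span of two operators
`h₁ u ∂_u`, `h₂ u ∂_u`, and the types of the resulting Lie algebras. -/
def ActType (a b c d : ℝ) : LieType → Prop
  | .A31 => a = 0 ∧ b = 0 ∧ c = 0 ∧ d = 0
  | .A32 => a = 0 ∧ b = 0 ∧ c = 0 ∧ d ≠ 0
  | .A33 => a = 0 ∧ b = 0 ∧ c ≠ 0 ∧ d = 0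
  | .A34 => a ≠ 0 ∧ b = 0 ∧ c ≠ 0 ∧ d = a
  | .A36 => a ≠ 0 ∧ b = 0 ∧ c = 0 ∧ d = -a
  | .A37 => a ≠ 0 ∧ b = 0 ∧ c = 0 ∧ d ≠ 0 ∧ |a| ≠ |d|
  | .A38 => a = 0 ∧ b ≠ 0 ∧ c = -b ∧ d = 0
  | .A39 => a ≠ 0 ∧ b ≠ 0 ∧ c = -b ∧ d = a

lemma ActType.smul {a b c d : ℝ} {ty : LieType} (h : ActType a b c d ty) {k : ℝ} (hk : k ≠ 0) :
    ActType (k * a) (k * b) (k * c) (k * d) ty := by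
  cases ty <;> simp only [ActType] at h ⊢ <;> simp_all [abs_mul]

/-- The operator `(l t + l₁) ∂_t + (l x + l₂) ∂_x + h u ∂_u` and the operators `h₁ u ∂_u`, `h₂ u ∂_u`
are independent symmetries of `E` that span a Lie algebra with matrix `(a, b; c, d)`. -/
structure Triple (E : Equation R) (l l₁ l₂ : ℝ) (h h₁ h₂ : ℝ → ℝ) (a b c d : ℝ) (ty : LieType) :
    Prop where
  det : Det E l l₁ l₂ h
  det₁ : Det E 0 0 0 h₁
  det₂ : Det E 0 0 0 h₂
  ne : l ≠ 0 ∨ l₁ ≠ 0 ∨ l₂ ≠ 0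
  wr_ne : ∃ x ∈ R.I, wr h₁ h₂ x ≠ 0
  act₁ : ∀ x ∈ R.I, (l * x + l₂) * deriv h₁ x = a * h₁ x + b * h₂ x
  act₂ : ∀ x ∈ R.I, (l * x + l₂) * deriv h₂ x = c * h₁ x + d * h₂ x
  type : ActType a b c d ty

variable {l l₁ l₂ : ℝ} {h h₁ h₂ : ℝ → ℝ} {a b c d : ℝ} {ty : LieType}

/-- The span of the operators in a `Triple`. -/
noncomputable def tripleSpan (R : Region) (l l₁ l₂ : ℝ) (h h₁ h₂ : ℝ → ℝ) : Submodule ℝ VF :=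
  Submodule.span ℝ {R.op l l₁ l₂ h, R.mulU h₁, R.mulU h₂}

lemma Triple.span_le (T : Triple E l l₁ l₂ h h₁ h₂ a b c d ty) :
    tripleSpan R l l₁ l₂ h h₁ h₂ ≤ E.maxAlg := by
  rw [tripleSpan, Submodule.span_le]
  rintro v (rfl | rfl | rfl)
  exacts [T.det.mem_maxAlg, T.det₁.mem_maxAlg, T.det₂.mem_maxAlg]

lemma Triple.linearIndependent (T : Triple E l l₁ l₂ h h₁ h₂ a b c d ty) :
    LinearIndependent ℝ ![R.op l l₁ l₂ h, R.mulU h₁, R.mulU h₂] :=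
  R.linearIndependent_op_first T.ne T.det₁.smooth T.det₂.smooth T.wr_ne

lemma Triple.finrank_span (T : Triple E l l₁ l₂ h h₁ h₂ a b c d ty) :
    Module.finrank ℝ (tripleSpan R l l₁ l₂ h h₁ h₂) = 3 :=
  finrank_span_triple T.linearIndependent

lemma Triple.op_mem (s : ℝ) :
    R.op (s * l) (s * l₁) (s * l₂) (fun x => s * h x) ∈ tripleSpan R l l₁ l₂ h h₁ h₂ := by
  rw [← Region.smul_op]
  exact Submodule.smul_mem _ _ (Submodule.subset_span (by simp))

lemma Triple.mulU_mem (s : ℝ) :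
    R.mulU (fun x => s * h₁ x) ∈ tripleSpan R l l₁ l₂ h h₁ h₂ := by
  have := Submodule.smul_mem (tripleSpan R l l₁ l₂ h h₁ h₂) s
    (Submodule.subset_span (by simp) : R.mulU h₁ ∈ _)
  rw [Region.smul_op] at this
  simpa using this

lemma tripleSpan_comm : tripleSpan R l l₁ l₂ h h₁ h₂ = tripleSpan R l l₁ l₂ h h₂ h₁ := by
  rw [tripleSpan, tripleSpan, Set.pair_comm]

/-- The type of the span from a rescaled basis with the operator in the last place. -/
lemma Triple.hasType_of_rescaled (T : Triple E l l₁ l₂ h h₁ h₂ a b c d ty) {s r : ℝ} (hs : s ≠ 0)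
    (hr : r ≠ 0) {ty' : LieType}
    (H : ∀ e₁ e₂ e₃ : VF, bracket e₁ e₂ = 0 →
      bracket e₁ e₃ = R.mulU (fun x => -(s * r * (a * h₁ x + b * h₂ x))) →
      bracket e₂ e₃ = R.mulU (fun x => -(s * (c * h₁ x + d * h₂ x))) →
      e₁ = R.mulU (fun x => r * h₁ x) → e₂ = R.mulU h₂ → Relations e₁ e₂ e₃ ty') :
    HasType (tripleSpan R l l₁ l₂ h h₁ h₂) ty' := by
  have h1 : ContDiffOn ℝ ∞ (fun x => r * h₁ x) R.I := contDiffOn_const.mul T.det₁.smooth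
  have h2 := T.det₂.smooth
  have hd : ∀ x ∈ R.I, deriv (fun x => r * h₁ x) x = r * deriv h₁ x := fun x hx =>
    ((R.hasDerivAt_of_contDiffOn T.det₁.smooth hx).const_mul r).deriv
  have hh : ContDiffOn ℝ ∞ (fun x => s * h x) R.I := contDiffOn_const.mul T.det.smooth
  have hli : LinearIndependent ℝ ![R.mulU (fun x => r * h₁ x), R.mulU h₂,
      R.op (s * l) (s * l₁) (s * l₂) (fun x => s * h x)] := by
    refine R.linearIndependent_op_last (by simpa [hs] using T.ne) h1 h2 ?_
    obtain ⟨x, hx, hw⟩ := T.wr_ne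
    refine ⟨x, hx, ?_⟩
    have : wr (fun x => r * h₁ x) h₂ x = r * wr h₁ h₂ x := by
      rw [wr, hd x hx, wr]; ring
    rw [this]
    exact mul_ne_zero hr hw
  refine ⟨_, _, _, hli, span_triple_eq hli T.finrank_span (Triple.mulU_mem r)
    (Submodule.subset_span (by simp)) (Triple.op_mem s),
    H _ _ _ (bracket_mulU_mulU h1 h2) ?_ ?_ rfl rfl⟩
  · rw [bracket_mulU_op _ _ _ h1 hh]
    refine Region.op_congr fun x hx => ?_
    rw [hd x hx]
    linear_combination -(s * r) * T.act₁ x hx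
  · rw [bracket_mulU_op _ _ _ h2 hh]
    refine Region.op_congr fun x hx => ?_
    linear_combination -s * T.act₂ x hx

lemma Triple.swap (T : Triple E l l₁ l₂ h h₁ h₂ a b c d ty) {ty' : LieType}
    (h' : ActType d c b a ty') : Triple E l l₁ l₂ h h₂ h₁ d c b a ty' := by
  obtain ⟨x, hx, hw⟩ := T.wr_ne
  refine ⟨T.det, T.det₂, T.det₁, T.ne, ⟨x, hx, fun h0 => hw ?_⟩, fun x hx => ?_, fun x hx => ?_, h'⟩
  · simp only [wr] at h0 ⊢
    linarith
  · rw [T.act₂ x hx, add_comm]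
  · rw [T.act₁ x hx, add_comm]

/-- Each matrix in normal form reaches the defining relations by rescaling: `s` normalises an
eigenvalue, a rotation speed or a sign, and `r` normalises the nilpotent entry. For `A32` the
operator itself becomes `e₁`. For `A37` the functions must be ordered so that `q` is the quotient of
the smaller eigenvalue by the larger in modulus, and for `A39` so that `q > 0`; `Triple.swap`
provides the other order. -/
theorem Triple.hasType (T : Triple E l l₁ l₂ h h₁ h₂ a b c d ty) :
    HasType (tripleSpan R l l₁ l₂ h h₁ h₂) ty := by
  have hT := T.type
  cases ty with
  | A31 =>
    obtain ⟨rfl, rfl, rfl, rfl⟩ := hT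
    refine T.hasType_of_rescaled one_ne_zero one_ne_zero fun e₁ e₂ e₃ r1 r2 r3 _ _ => ⟨r1, ?_, ?_⟩
    · rw [r2, ← Region.op_zero (R := R)]; simp
    · rw [r3, ← Region.op_zero (R := R)]; simp
  | A32 =>
    obtain ⟨rfl, rfl, rfl, hd0⟩ := hT
    have hh : ContDiffOn ℝ ∞ (fun x => d⁻¹ * h x) R.I := contDiffOn_const.mul T.det.smooth
    have hli : LinearIndependent ℝ
        ![R.op (d⁻¹ * l) (d⁻¹ * l₁) (d⁻¹ * l₂) (fun x => d⁻¹ * h x), R.mulU h₂, R.mulU h₁] := by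
      refine R.linearIndependent_op_first (by simpa [hd0] using T.ne) T.det₂.smooth T.det₁.smooth ?_
      obtain ⟨x, hx, hw⟩ := T.wr_ne
      refine ⟨x, hx, fun h0 => hw ?_⟩
      simp only [wr] at h0 ⊢
      linarith
    refine ⟨_, _, _, hli, span_triple_eq hli T.finrank_span (Triple.op_mem d⁻¹)
      (Submodule.subset_span (by simp)) (Submodule.subset_span (by simp)), ?_, ?_,
      bracket_mulU_mulU T.det₂.smooth T.det₁.smooth⟩
    · rw [bracket_op_mulU _ _ _ T.det₂.smooth hh]
      refine Region.op_congr fun x hx => ?_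
      have := T.act₂ x hx
      field_simp
      linarith
    · rw [bracket_op_mulU _ _ _ T.det₁.smooth hh, ← Region.op_zero (R := R)]
      refine Region.op_congr fun x hx => ?_
      have := T.act₁ x hx
      linear_combination d⁻¹ * this
  | A33 =>
    obtain ⟨rfl, rfl, hc, rfl⟩ := hT
    refine T.hasType_of_rescaled (s := -1) (r := c) (by norm_num) hc
      fun e₁ e₂ e₃ r1 r2 r3 r4 _ => ⟨r1, ?_, ?_⟩
    · rw [r2, ← Region.op_zero (R := R)]; simp
    · rw [r3, r4]; simp
  | A34 =>
    obtain ⟨ha, rfl, hc, rfl⟩ := hT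
    refine T.hasType_of_rescaled (s := -d⁻¹) (r := c / d) (by simpa using ha) (div_ne_zero hc ha)
      fun e₁ e₂ e₃ r1 r2 r3 r4 r5 => ⟨r1, ?_, ?_⟩
    · rw [r2, r4]
      refine Region.op_congr fun x _ => ?_
      field_simp
      ring
    · rw [r3, r4, r5, Region.op_add]
      simp only [add_zero]
      refine Region.op_congr fun x _ => ?_
      field_simp
  | A36 =>
    obtain ⟨ha, rfl, rfl, rfl⟩ := hT
    refine T.hasType_of_rescaled (s := -a⁻¹) (r := 1) (by simpa using ha) one_ne_zero
      fun e₁ e₂ e₃ r1 r2 r3 r4 r5 => ⟨r1, ?_, ?_⟩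
    · rw [r2, r4]
      refine Region.op_congr fun x _ => ?_
      field_simp
      ring
    · rw [r3, r5, ← neg_one_smul ℝ (R.mulU h₂), Region.smul_op]
      simp only [mul_zero]
      refine Region.op_congr fun x _ => ?_
      field_simp
      ring
  | A37 =>
    have key : ∀ {h₁ h₂ : ℝ → ℝ} {a d : ℝ}, Triple E l l₁ l₂ h h₁ h₂ a 0 0 d .A37 → |d| < |a| →
        HasType (tripleSpan R l l₁ l₂ h h₁ h₂) .A37 := by
      intro h₁ h₂ a d T hlt
      obtain ⟨ha, -, -, hd, -⟩ := T.type
      refine T.hasType_of_rescaled (s := -a⁻¹) (r := 1) (by simpa using ha) one_ne_zero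
        fun e₁ e₂ e₃ r1 r2 r3 r4 r5 => ⟨d / a, ?_, ?_, r1, ?_, ?_⟩
      · exact abs_pos.2 (div_ne_zero hd ha)
      · rw [abs_div, div_lt_one (abs_pos.2 ha)]
        exact hlt
      · rw [r2, r4]
        refine Region.op_congr fun x _ => ?_
        field_simp
        ring
      · rw [r3, r5, Region.smul_op]
        simp only [mul_zero]
        refine Region.op_congr fun x _ => ?_
        field_simp
        ring
    obtain ⟨ha, rfl, rfl, hd, hne⟩ := id hT
    rcases lt_or_gt_of_ne hne with hlt | hlt
    · rw [tripleSpan_comm]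
      exact key (T.swap ⟨hd, rfl, rfl, ha, hne.symm⟩) hlt
    · exact key T hlt
  | A38 =>
    obtain ⟨rfl, hb, rfl, rfl⟩ := hT
    refine T.hasType_of_rescaled (s := b⁻¹) (r := 1) (by simpa using hb) one_ne_zero
      fun e₁ e₂ e₃ r1 r2 r3 r4 r5 => ⟨r1, ?_, ?_⟩
    · rw [r2, r5, ← neg_one_smul ℝ (R.mulU h₂), Region.smul_op]
      simp only [mul_zero]
      refine Region.op_congr fun x _ => ?_
      field_simp
      ring
    · rw [r3, r4]
      refine Region.op_congr fun x _ => ?_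
      field_simp
      ring
  | A39 =>
    have key : ∀ {h₁ h₂ : ℝ → ℝ} {a b : ℝ}, Triple E l l₁ l₂ h h₁ h₂ a b (-b) a .A39 → a / b < 0 →
        HasType (tripleSpan R l l₁ l₂ h h₁ h₂) .A39 := by
      intro h₁ h₂ a b T hlt
      obtain ⟨ha, hb, -, -⟩ := T.type
      refine T.hasType_of_rescaled (s := b⁻¹) (r := 1) (by simpa using hb) one_ne_zero
        fun e₁ e₂ e₃ r1 r2 r3 r4 r5 => ⟨-(a / b), neg_pos.2 hlt, r1, ?_, ?_⟩
      · rw [r2, r4, r5, sub_eq_add_neg, ← neg_one_smul ℝ (R.mulU h₂), Region.smul_op,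
          Region.smul_op, Region.op_add]
        simp only [mul_zero, add_zero]
        refine Region.op_congr fun x _ => ?_
        field_simp
        ring
      · rw [r3, r4, r5, Region.smul_op, Region.op_add]
        simp only [mul_zero, add_zero]
        refine Region.op_congr fun x _ => ?_
        field_simp
        ring
    obtain ⟨ha, hb, rfl, rfl⟩ := hT
    rcases lt_or_gt_of_ne (div_ne_zero ha hb) with hlt | hlt
    · exact key T hlt
    · rw [tripleSpan_comm]
      have T' := T.swap (ty' := .A39) ⟨ha, neg_ne_zero.2 hb, (neg_neg b).symm, rfl⟩
      have hb' : b = -(-b) := (neg_neg b).symm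
      refine key (b := -b) (a := d) ?_ ?_
      · rw [neg_neg]; exact T'
      · rw [div_neg]; exact neg_neg_of_pos hlt

lemma Triple.maxAlg_eq (T : Triple E l l₁ l₂ h h₁ h₂ a b c d ty)
    (hE : Module.finrank ℝ E.maxAlg = 3) : E.maxAlg = tripleSpan R l l₁ l₂ h h₁ h₂ :=
  (span_triple_eq T.linearIndependent hE T.det.mem_maxAlg T.det₁.mem_maxAlg T.det₂.mem_maxAlg).symm

lemma mem_tripleSpan {q q₁ q₂ : ℝ} {k : ℝ → ℝ} :
    R.op q q₁ q₂ k ∈ tripleSpan R l l₁ l₂ h h₁ h₂ ↔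
      ∃ α β γ : ℝ, q = α * l ∧ q₁ = α * l₁ ∧ q₂ = α * l₂ ∧
        ∀ x ∈ R.I, k x = α * h x + β * h₁ x + γ * h₂ x := by
  rw [tripleSpan, Submodule.mem_span_triple]
  refine exists_congr fun α => exists_congr fun β => exists_congr fun γ => ?_
  rw [Region.smul_op, Region.smul_op, Region.smul_op, Region.op_add, Region.op_add]
  simp only [mul_zero, add_zero]
  constructor
  · intro he
    obtain ⟨e1, e2, e3, e4⟩ := Region.op_inj he
    exact ⟨e1.symm, e2.symm, e3.symm, fun x hx => (e4 x hx).symm⟩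
  · rintro ⟨rfl, rfl, rfl, e⟩
    exact Region.op_congr fun x hx => (e x hx).symm

end Types

/-! ### The functions of the list as eigenvectors, Jordan chains and rotations -/

section Cases

/-- At `x` the derivative of the pair `(h₁, h₂)` is `p` times its image under `(a, b; c, d)`, and the
Wronskian does not vanish there unless `p = 0`. -/
structure ActsAt (h₁ h₂ : ℝ → ℝ) (p a b c d x : ℝ) : Prop where
  deriv₁ : HasDerivAt h₁ (p * (a * h₁ x + b * h₂ x)) x
  deriv₂ : HasDerivAt h₂ (p * (c * h₁ x + d * h₂ x)) x
  ne : (a * h₁ x + b * h₂ x) * h₂ x - h₁ x * (c * h₁ x + d * h₂ x) ≠ 0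

lemma ActsAt.congr {h₁ h₂ k₁ k₂ : ℝ → ℝ} {p a b c d x : ℝ} (h : ActsAt h₁ h₂ p a b c d x)
    (e₁ : k₁ =ᶠ[nhds x] h₁) (e₂ : k₂ =ᶠ[nhds x] h₂) : ActsAt k₁ k₂ p a b c d x := by
  have h1 := h.deriv₁.congr_of_eventuallyEq e₁
  have h2 := h.deriv₂.congr_of_eventuallyEq e₂
  have h3 := h.ne
  rw [← e₁.eq_of_nhds, ← e₂.eq_of_nhds] at h1 h2 h3
  exact ⟨h1, h2, h3⟩

section Models

variable {L : ℝ → ℝ} {p x : ℝ}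

/-- This and the next two lemmas are models of the real normal forms of a 2×2 matrix: real
eigenvalues, a Jordan block, a rotation with scaling. They are written in a variable `L` with `L' =
p`; `L = ln|x|` serves the Euler cases and `L = x` the constant ones. -/
lemma actsAt_exp (hL : HasDerivAt L p x) {r r' : ℝ} (hr : r ≠ r') :
    ActsAt (fun x => Real.exp (r * L x)) (fun x => Real.exp (r' * L x)) p r 0 0 r' x := by
  refine ⟨(hL.const_mul r).exp.congr_deriv (by ring), (hL.const_mul r').exp.congr_deriv (by ring), ?_⟩
  have : Real.exp (r * L x) * Real.exp (r' * L x) * (r - r') ≠ 0 := by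
    have := sub_ne_zero.2 hr
    positivity
  exact fun h => this (by linear_combination h)

lemma actsAt_jordan (hL : HasDerivAt L p x) (r : ℝ) :
    ActsAt (fun x => Real.exp (r * L x)) (fun x => Real.exp (r * L x) * L x) p r 0 1 r x := by
  refine ⟨(hL.const_mul r).exp.congr_deriv (by ring),
    ((hL.const_mul r).exp.mul hL).congr_deriv (by ring), ?_⟩
  have : -(Real.exp (r * L x) ^ 2) ≠ 0 := by simp
  exact fun h => this (by linear_combination h)

lemma actsAt_rot (hL : HasDerivAt L p x) (r : ℝ) {s : ℝ} (hs : s ≠ 0) :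
    ActsAt (fun x => Real.exp (r * L x) * Real.cos (s * L x))
      (fun x => Real.exp (r * L x) * Real.sin (s * L x)) p r (-s) s r x := by
  refine ⟨((hL.const_mul r).exp.mul (hL.const_mul s).cos).congr_deriv (by ring),
    ((hL.const_mul r).exp.mul (hL.const_mul s).sin).congr_deriv (by ring), ?_⟩
  have : -s * Real.exp (r * L x) ^ 2 ≠ 0 := by simp [hs]
  exact fun h => this (by
    linear_combination h + s * Real.exp (r * L x) ^ 2 * Real.sin_sq_add_cos_sq (s * L x))

end Models

lemma eventually_ne_zero {x : ℝ} (hx : x ≠ 0) : ∀ᶠ y : ℝ in nhds x, y ≠ 0 :=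
  isOpen_ne.mem_nhds hx

lemma hasDerivAt_log_abs {x : ℝ} (hx : x ≠ 0) :
    HasDerivAt (fun x : ℝ => Real.log |x|) x⁻¹ x := by
  simpa only [Real.log_abs] using Real.hasDerivAt_log hx

lemma rpow_eq_exp_log {x : ℝ} (hx : x ≠ 0) (r : ℝ) : |x| ^ r = Real.exp (r * Real.log |x|) := by
  rw [Real.rpow_def_of_pos (abs_pos.2 hx), mul_comm]

lemma sqrt_rpow_eq_exp_log {x : ℝ} (hx : x ≠ 0) (r : ℝ) :
    √|x| ^ r = Real.exp (r / 2 * Real.log |x|) := by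
  rw [Real.sqrt_eq_rpow, ← Real.rpow_mul (abs_nonneg x), rpow_eq_exp_log hx]
  ring_nf

lemma sqrt_eq_exp_log {x : ℝ} (hx : x ≠ 0) : √|x| = Real.exp (1 / 2 * Real.log |x|) := by
  rw [← sqrt_rpow_eq_exp_log hx 1, Real.rpow_one]

/-- The matrix `(a, b; c, d)` of a case with trace `1 - n` or `-n` and determinant `m`. -/
lemma EulerCase.acts {i : ℕ} {n m : ℝ} {ty : LieType} {h₁ h₂ : ℝ → ℝ}
    (hi : EulerCase i n m ty h₁ h₂) : ∃ a b c d : ℝ, ActType a b c d ty ∧ a + d = 1 - n ∧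
      a * d - b * c = m ∧ ∀ x, x ≠ 0 → ActsAt h₁ h₂ x⁻¹ a b c d x := by
  cases hi with
  | c1 n hn =>
    -- Because `h₂` has the factor `x` and not `|x|`, it matches the exponential model only up to a
    -- sign; its derivative is computed directly.
    have hn' : 1 - n ≠ 0 := sub_ne_zero.2 hn.symm
    refine ⟨0, 0, 0, 1 - n, ⟨rfl, rfl, rfl, hn'⟩, by ring, by ring, fun x hx => ⟨?_, ?_, ?_⟩⟩
    · simpa using hasDerivAt_const x (1 : ℝ)
    · have h1 : HasDerivAt (fun x : ℝ => x * Real.exp (-n * Real.log |x|)) _ x :=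
        (hasDerivAt_id x).mul ((hasDerivAt_log_abs hx).const_mul (-n)).exp
      refine (h1.congr_of_eventuallyEq ?_).congr_deriv ?_
      · filter_upwards [eventually_ne_zero hx] with y hy
        rw [rpow_eq_exp_log hy]
      · rw [rpow_eq_exp_log hx]
        field_simp
        simp
        ring
    · rw [rpow_eq_exp_log hx]
      have := mul_ne_zero hn' (mul_ne_zero hx (Real.exp_pos (-n * Real.log |x|)).ne')
      exact fun h => this (by linear_combination -h)
  | c2 =>
    refine ⟨0, 0, 1, 0, ⟨rfl, rfl, one_ne_zero, rfl⟩, by ring, by ring, fun x hx => ?_⟩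
    refine (actsAt_jordan (hasDerivAt_log_abs hx) 0).congr ?_ ?_ <;>
    exact Filter.Eventually.of_forall fun y => by simp
  | c3 =>
    refine ⟨1 / 2, 0, 1, 1 / 2, ⟨by norm_num, rfl, one_ne_zero, rfl⟩, by ring, by ring,
      fun x hx => ?_⟩
    refine (actsAt_jordan (hasDerivAt_log_abs hx) (1 / 2)).congr ?_ ?_ <;>
    filter_upwards [eventually_ne_zero hx] with y hy using by rw [sqrt_eq_exp_log hy]
  | c4 m β hm hβ =>
    have hb : β ^ 2 = 4 * m - 1 := by rw [hβ, Real.sq_sqrt (by linarith)]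
    have hb0 : 1 / 2 * β ≠ 0 := by
      rw [hβ]; have := Real.sqrt_pos.2 (show 0 < 4 * m - 1 by linarith); positivity
    refine ⟨1 / 2, -(1 / 2 * β), 1 / 2 * β, 1 / 2,
      ⟨by norm_num, neg_ne_zero.2 hb0, (neg_neg _).symm, rfl⟩, by ring,
      by linear_combination hb / 4, fun x hx => ?_⟩
    refine (actsAt_rot (hasDerivAt_log_abs hx) (1 / 2) hb0).congr ?_ ?_ <;>
    filter_upwards [eventually_ne_zero hx] with y hy using by rw [sqrt_eq_exp_log hy]
  | c5 m β hm hm0 hβ =>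
    have hb : β ^ 2 = 1 - 4 * m := by rw [hβ, Real.sq_sqrt (by linarith)]
    have hb0 : 0 < β := by rw [hβ]; exact Real.sqrt_pos.2 (by linarith)
    have hb1 : β ≠ 1 := fun h => hm0 (by rw [h] at hb; linarith)
    have hne : 1 - β ≠ 0 := sub_ne_zero.2 hb1.symm
    refine ⟨(1 + β) / 2, 0, 0, (1 - β) / 2, ⟨by positivity, rfl, rfl,
      div_ne_zero hne two_ne_zero, fun h => ?_⟩, by ring, by linear_combination -hb / 4,
      fun x hx => ?_⟩
    · rcases abs_eq_abs.1 h with h | h <;> linarith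
    · refine (actsAt_exp (hasDerivAt_log_abs hx) (by linarith)).congr ?_ ?_ <;>
      filter_upwards [eventually_ne_zero hx] with y hy using by rw [sqrt_rpow_eq_exp_log hy]
  | c6 m hm =>
    have hs : √m ≠ 0 := (Real.sqrt_pos.2 hm).ne'
    refine ⟨0, -√m, √m, 0, ⟨rfl, neg_ne_zero.2 hs, (neg_neg _).symm, rfl⟩, by ring,
      by linear_combination Real.sq_sqrt hm.le, fun x hx => ?_⟩
    refine (actsAt_rot (hasDerivAt_log_abs hx) 0 hs).congr ?_ ?_ <;>
    exact Filter.Eventually.of_forall fun y => by simp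
  | c7 m hm =>
    have hs : √|m| ≠ 0 := (Real.sqrt_pos.2 (abs_pos.2 hm.ne)).ne'
    refine ⟨√|m|, 0, 0, -√|m|, ⟨hs, rfl, rfl, rfl⟩, by ring, ?_, fun x hx => ?_⟩
    · have := Real.sq_sqrt (abs_nonneg m)
      rw [abs_of_neg hm] at this ⊢
      linear_combination -this
    · refine (actsAt_exp (hasDerivAt_log_abs hx) (fun h => hs (by linarith))).congr ?_ ?_ <;>
      filter_upwards [eventually_ne_zero hx] with y hy using by rw [rpow_eq_exp_log hy]
  | c8 n hn0 hn1 =>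
    have hn' : (1 - n) / 2 ≠ 0 := div_ne_zero (sub_ne_zero.2 hn1.symm) two_ne_zero
    refine ⟨(1 - n) / 2, 0, 1, (1 - n) / 2, ⟨hn', rfl, one_ne_zero, rfl⟩, by ring, by ring,
      fun x hx => ?_⟩
    refine (actsAt_jordan (hasDerivAt_log_abs hx) ((1 - n) / 2)).congr ?_ ?_ <;>
    filter_upwards [eventually_ne_zero hx] with y hy using by rw [sqrt_rpow_eq_exp_log hy]
  | c9 n m β hn0 hn1 hm hβ =>
    have hn' : (1 - n) / 2 ≠ 0 := div_ne_zero (sub_ne_zero.2 hn1.symm) two_ne_zero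
    have hb : β ^ 2 = 4 * m - (n - 1) ^ 2 := by rw [hβ, Real.sq_sqrt (by linarith)]
    have hb0 : 1 / 2 * β ≠ 0 := by
      rw [hβ]; have := Real.sqrt_pos.2 (show 0 < 4 * m - (n - 1) ^ 2 by linarith); positivity
    refine ⟨(1 - n) / 2, -(1 / 2 * β), 1 / 2 * β, (1 - n) / 2,
      ⟨hn', neg_ne_zero.2 hb0, (neg_neg _).symm, rfl⟩, by ring,
      by linear_combination hb / 4, fun x hx => ?_⟩
    refine (actsAt_rot (hasDerivAt_log_abs hx) ((1 - n) / 2) hb0).congr ?_ ?_ <;>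
    filter_upwards [eventually_ne_zero hx] with y hy using by rw [sqrt_rpow_eq_exp_log hy]
  | c10 n m β hn0 hn1 hm hm0 hβ =>
    have hn' : 1 - n ≠ 0 := sub_ne_zero.2 hn1.symm
    have hb : β ^ 2 = (n - 1) ^ 2 - 4 * m := by rw [hβ, Real.sq_sqrt (by linarith)]
    have hb0 : 0 < β := by rw [hβ]; exact Real.sqrt_pos.2 (by linarith)
    -- The product of the two eigenvalues is `m`, so `m ≠ 0` makes both nonzero.
    have hprod : (1 - β - n) * (1 - n + β) ≠ 0 := by
      have : (1 - β - n) * (1 - n + β) = 4 * m := by linear_combination -hb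
      rw [this]; positivity
    refine ⟨(1 - β - n) / 2, 0, 0, (1 - n + β) / 2,
      ⟨div_ne_zero (left_ne_zero_of_mul hprod) two_ne_zero, rfl, rfl,
      div_ne_zero (right_ne_zero_of_mul hprod) two_ne_zero, fun h => ?_⟩, by ring,
      by linear_combination -hb / 4, fun x hx => ?_⟩
    · rcases abs_eq_abs.1 h with h | h
      · linarith
      · exact hn' (by linarith)
    · refine (actsAt_exp (hasDerivAt_log_abs hx) (by linarith)).congr ?_ ?_ <;>
      filter_upwards [eventually_ne_zero hx] with y hy using by rw [sqrt_rpow_eq_exp_log hy]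

lemma ConstCase.acts {i : ℕ} {n m : ℝ} {ty : LieType} {h₁ h₂ : ℝ → ℝ}
    (hi : ConstCase i n m ty h₁ h₂) : ∃ a b c d : ℝ, ActType a b c d ty ∧ a + d = -n ∧
      a * d - b * c = m ∧ ∀ x, ActsAt h₁ h₂ 1 a b c d x := by
  cases hi with
  | c1 =>
    refine ⟨0, 0, 1, 0, ⟨rfl, rfl, one_ne_zero, rfl⟩, by ring, by ring, fun x => ?_⟩
    refine (actsAt_jordan (hasDerivAt_id x) 0).congr ?_ ?_ <;>
    exact Filter.Eventually.of_forall fun y => by simp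
  | c2 =>
    refine ⟨0, 0, 0, 1, ⟨rfl, rfl, rfl, one_ne_zero⟩, by ring, by ring, fun x => ?_⟩
    refine (actsAt_exp (hasDerivAt_id x) zero_ne_one).congr ?_ ?_ <;>
    exact Filter.Eventually.of_forall fun y => by simp
  | c3 =>
    refine ⟨0, -1, 1, 0, ⟨rfl, by norm_num, by norm_num, rfl⟩, by ring, by ring, fun x => ?_⟩
    refine (actsAt_rot (hasDerivAt_id x) 0 one_ne_zero).congr ?_ ?_ <;>
    exact Filter.Eventually.of_forall fun y => by simp
  | c4 =>
    refine ⟨1, 0, 0, -1, ⟨one_ne_zero, rfl, rfl, rfl⟩, by ring, by ring, fun x => ?_⟩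
    refine (actsAt_exp (hasDerivAt_id x) (by norm_num)).congr ?_ ?_ <;>
    exact Filter.Eventually.of_forall fun y => by simp
  | c5 =>
    refine ⟨1 / 2, 0, 1, 1 / 2, ⟨by norm_num, rfl, one_ne_zero, rfl⟩, by ring, by ring,
      fun x => actsAt_jordan (hasDerivAt_id x) (1 / 2)⟩
  | c6 m β hm hm0 hβ =>
    have hb : β ^ 2 = 1 - 4 * m := by rw [hβ, Real.sq_sqrt (by linarith)]
    have hb0 : 0 < β := by rw [hβ]; exact Real.sqrt_pos.2 (by linarith)
    have hb1 : β ≠ 1 := fun h => hm0 (by rw [h] at hb; linarith)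
    have hne : 1 - β ≠ 0 := sub_ne_zero.2 hb1.symm
    refine ⟨1 / 2 * (1 + β), 0, 0, 1 / 2 * (1 - β), ⟨by positivity, rfl, rfl,
      mul_ne_zero (by norm_num) hne, fun h => ?_⟩, by ring, by linear_combination -hb / 4,
      fun x => actsAt_exp (hasDerivAt_id x) (by linarith)⟩
    rcases abs_eq_abs.1 h with h | h <;> linarith
  | c7 m β hm hβ =>
    have hb : β ^ 2 = 4 * m - 1 := by rw [hβ, Real.sq_sqrt (by linarith)]
    have hb0 : 1 / 2 * β ≠ 0 := by
      rw [hβ]; have := Real.sqrt_pos.2 (show 0 < 4 * m - 1 by linarith); positivity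
    exact ⟨1 / 2, -(1 / 2 * β), 1 / 2 * β, 1 / 2,
      ⟨by norm_num, neg_ne_zero.2 hb0, (neg_neg _).symm, rfl⟩, by ring,
      by linear_combination hb / 4, fun x => actsAt_rot (hasDerivAt_id x) (1 / 2) hb0⟩

variable {R : Region} {E : Equation R}

lemma contDiffOn_of_actsAt {h₁ h₂ p : ℝ → ℝ} {a b c d : ℝ} (hp : ContDiffOn ℝ ∞ p R.I)
    (h : ∀ x ∈ R.I, ActsAt h₁ h₂ (p x) a b c d x) :
    ContDiffOn ℝ ∞ h₁ R.I ∧ ContDiffOn ℝ ∞ h₂ R.I := by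
  have key : ∀ n : ℕ, ContDiffOn ℝ n h₁ R.I ∧ ContDiffOn ℝ n h₂ R.I := by
    intro n
    induction n with
    | zero =>
      exact ⟨contDiffOn_zero.2 fun x hx => (h x hx).deriv₁.continuousAt.continuousWithinAt,
        contDiffOn_zero.2 fun x hx => (h x hx).deriv₂.continuousAt.continuousWithinAt⟩
    | succ n ih =>
      have hn : ((n : ℕ) : WithTop ℕ∞) ≤ ∞ := by exact_mod_cast le_top
      have hcomb : ∀ r s : ℝ, ContDiffOn ℝ n (fun x => p x * (r * h₁ x + s * h₂ x)) R.I :=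
        fun r s => (hp.of_le hn).mul
          ((contDiffOn_const.mul ih.1).add (contDiffOn_const.mul ih.2))
      push_cast
      exact ⟨(contDiffOn_succ_iff_deriv_of_isOpen R.isOpen_I).2
        ⟨fun x hx => (h x hx).deriv₁.differentiableAt.differentiableWithinAt, by simp,
          (hcomb a b).congr fun x hx => (h x hx).deriv₁.deriv⟩,
        (contDiffOn_succ_iff_deriv_of_isOpen R.isOpen_I).2
        ⟨fun x hx => (h x hx).deriv₂.differentiableAt.differentiableWithinAt, by simp,
          (hcomb c d).congr fun x hx => (h x hx).deriv₂.deriv⟩⟩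
  exact ⟨contDiffOn_infty.2 fun n => (key n).1, contDiffOn_infty.2 fun n => (key n).2⟩

/-- A pair of functions on which a first-order operator acts by a matrix solves the linear equation
given by the characteristic polynomial of the matrix. -/
lemma triple_of_actsAt {h₁ h₂ p h : ℝ → ℝ} {a b c d l l₁ l₂ κ : ℝ} {ty : LieType}
    (hp : ContDiffOn ℝ ∞ p R.I) (hacts : ∀ x ∈ R.I, ActsAt h₁ h₂ (p x) a b c d x)
    (hA : ∀ x ∈ R.I, deriv p x + (a + d) * p x ^ 2 + E.A x * p x = 0)
    (hB : ∀ x ∈ R.I, E.B x = (a * d - b * c) * p x ^ 2)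
    (hdet : Det E l l₁ l₂ h) (hκ : κ ≠ 0) (hξ : ∀ x ∈ R.I, (l * x + l₂) * p x = κ)
    (hty : ActType a b c d ty) :
    Triple E l l₁ l₂ h h₁ h₂ (κ * a) (κ * b) (κ * c) (κ * d) ty := by
  obtain ⟨s1, s2⟩ := contDiffOn_of_actsAt hp hacts
  -- For the vector `w = (h₁, h₂)` and the matrix `M`, `w' = p M w` gives `w'' = p' M w + p² M² w`.
  -- By Cayley–Hamilton `M² = (tr M) M - det M`, so `hA` and `hB` say exactly that `L w = 0`.
  have hsecond : ∀ x ∈ R.I,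
      deriv (deriv h₁) x = deriv p x * (a * h₁ x + b * h₂ x)
        + p x ^ 2 * (a * (a * h₁ x + b * h₂ x) + b * (c * h₁ x + d * h₂ x)) ∧
      deriv (deriv h₂) x = deriv p x * (c * h₁ x + d * h₂ x)
        + p x ^ 2 * (c * (a * h₁ x + b * h₂ x) + d * (c * h₁ x + d * h₂ x)) := by
    intro x hx
    have hpx := R.hasDerivAt_of_contDiffOn hp hx
    have h1 := (hacts x hx).deriv₁
    have h2 := (hacts x hx).deriv₂
    have e1 : deriv h₁ =ᶠ[nhds x] fun x => p x * (a * h₁ x + b * h₂ x) := by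
      filter_upwards [R.isOpen_I.mem_nhds hx] with y hy using (hacts y hy).deriv₁.deriv
    have e2 : deriv h₂ =ᶠ[nhds x] fun x => p x * (c * h₁ x + d * h₂ x) := by
      filter_upwards [R.isOpen_I.mem_nhds hx] with y hy using (hacts y hy).deriv₂.deriv
    rw [e1.deriv_eq, e2.deriv_eq]
    exact ⟨((hpx.mul ((h1.const_mul a).add (h2.const_mul b))).deriv).trans (by simp only [Pi.add_apply]; ring),
      ((hpx.mul ((h1.const_mul c).add (h2.const_mul d))).deriv).trans (by simp only [Pi.add_apply]; ring)⟩
  obtain ⟨x₀, hx₀⟩ := R.nonempty_I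
  have hξ₀ := hξ x₀ hx₀
  have hp0 : p x₀ ≠ 0 := fun h0 => hκ (by rw [← hξ₀, h0, mul_zero])
  refine ⟨hdet, det_zero_iff.2 ⟨s1, fun x hx => ?_⟩, det_zero_iff.2 ⟨s2, fun x hx => ?_⟩, ?_,
    ⟨x₀, hx₀, ?_⟩, fun x hx => ?_, fun x hx => ?_, hty.smul hκ⟩
  · rw [Equation.L, (hsecond x hx).1, (hacts x hx).deriv₁.deriv, hB x hx]
    linear_combination (a * h₁ x + b * h₂ x) * hA x hx
  · rw [Equation.L, (hsecond x hx).2, (hacts x hx).deriv₂.deriv, hB x hx]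
    linear_combination (c * h₁ x + d * h₂ x) * hA x hx
  · by_contra hcon
    push Not at hcon
    obtain ⟨rfl, -, rfl⟩ := hcon
    exact hκ (by rw [← hξ₀]; ring)
  · rw [wr, (hacts x₀ hx₀).deriv₁.deriv, (hacts x₀ hx₀).deriv₂.deriv]
    have := mul_ne_zero hp0 (hacts x₀ hx₀).ne
    exact fun h0 => this (by linear_combination h0)
  · rw [(hacts x hx).deriv₁.deriv, ← hξ x hx]; ring
  · rw [(hacts x hx).deriv₂.deriv, ← hξ x hx]; ring

end Cases

section Listed

variable {R : Region} {E : Equation R}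

/-- A derivative of `D` along a line, computed from the values on the line. -/
lemma fderiv_D_eq {t x a b φ' : ℝ} {φ : ℝ → ℝ} (ht : t ∈ R.J) (hx : x ∈ R.I)
    (hφ : HasDerivAt φ φ' 0)
    (h : ∀ᶠ s in nhds 0, t + s * a ∈ R.J → x + s * b ∈ R.I → E.D (t + s * a, x + s * b) = φ s) :
    fderiv ℝ E.D (t, x) (a, b) = φ' := by
  have h1 := (E.differentiableAt_D ht hx).hasFDerivAt.hasLineDerivAt (a, b)
  have h2 : HasDerivAt (fun s : ℝ => E.D ((t, x) + s • (a, b))) _ 0 := h1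
  refine h2.unique (hφ.congr_of_eventuallyEq ?_)
  have c1 : ContinuousAt (fun s : ℝ => t + s * a) 0 := by fun_prop
  have c2 : ContinuousAt (fun s : ℝ => x + s * b) 0 := by fun_prop
  filter_upwards [c1.preimage_mem_nhds (R.isOpen_J.mem_nhds (by simpa using ht)),
    c2.preimage_mem_nhds (R.isOpen_I.mem_nhds (by simpa using hx)), h] with s hs hs' h
  have := h hs hs'
  simpa using this

/-- A continuous function on `I` that vanishes off the origin vanishes. -/
lemma Region.eq_zero_of_ne {φ : ℝ → ℝ} (hφ : ContinuousOn φ R.I)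
    (h : ∀ x ∈ R.I, x ≠ 0 → φ x = 0) : ∀ x ∈ R.I, φ x = 0 := by
  intro x hx
  by_cases hx0 : x = 0
  swap
  · exact h x hx hx0
  subst hx0
  have h1 : Filter.Tendsto φ (nhdsWithin 0 {0}ᶜ) (nhds (φ 0)) :=
    ((hφ.continuousAt (R.isOpen_I.mem_nhds hx)).tendsto).mono_left nhdsWithin_le_nhds
  have h2 : Filter.Tendsto φ (nhdsWithin 0 {0}ᶜ) (nhds 0) := by
    refine tendsto_const_nhds.congr' ?_
    filter_upwards [self_mem_nhdsWithin, nhdsWithin_le_nhds (R.isOpen_I.mem_nhds hx)] with y hy hy'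
    exact (h y hy' hy).symm
  exact tendsto_nhds_unique h1 h2

lemma Region.exists_ne_zero (R : Region) : ∃ x ∈ R.I, x ≠ 0 := by
  by_contra hcon
  push Not at hcon
  obtain ⟨h, -⟩ := eq_zero_of_affine R.isOpen_I R.nonempty_I (a := 1) (b := 0)
    (fun x hx => by rw [hcon x hx]; ring)
  exact one_ne_zero h

lemma contDiffOn_D_snd {t : ℝ} (ht : t ∈ R.J) : ContDiffOn ℝ ∞ (fun x => E.D (t, x)) R.I :=
  E.smooth_D.comp (contDiff_const.prodMk contDiff_id).contDiffOn fun _ hx => ⟨ht, hx⟩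

lemma contDiffOn_fderiv_D : ContDiffOn ℝ ∞ (fderiv ℝ E.D) (R.J ×ˢ R.I) :=
  ((contDiffOn_infty_iff_fderiv_of_isOpen R.isOpen_JI).1 E.smooth_D).2

/-- Dilation symmetry of equations with `A = n x⁻¹`, `B = m x⁻²`, `D = x⁻² G(t/x)`. -/
lemma det_dil {n m : ℝ} {G : ℝ → ℝ} (hA : ∀ x ∈ R.I, x ≠ 0 → E.A x = n * x⁻¹)
    (hB : ∀ x ∈ R.I, x ≠ 0 → E.B x = m * (x ^ 2)⁻¹)
    (hD : ∀ t ∈ R.J, ∀ x ∈ R.I, x ≠ 0 → E.D (t, x) = (x ^ 2)⁻¹ * G (t * x⁻¹)) :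
    Det E 1 0 0 (fun _ => 0) := by
  have cA := (R.contDiffOn_deriv E.smooth_A).continuousOn
  have cB := (R.contDiffOn_deriv E.smooth_B).continuousOn
  have cA' := E.smooth_A.continuousOn
  have cB' := E.smooth_B.continuousOn
  -- The coefficients are known only for `x ≠ 0`; the equations extend to the origin by continuity.
  refine ⟨contDiffOn_const, R.eq_zero_of_ne (by fun_prop) fun x hx hx0 => ?_,
    R.eq_zero_of_ne (by fun_prop) fun x hx hx0 => ?_, fun t ht => ?_⟩
  · have he : E.A =ᶠ[nhds x] fun x => n * x⁻¹ := by
      filter_upwards [R.isOpen_I.mem_nhds hx, eventually_ne_zero hx0] with y hy hy' using hA y hy hy'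
    rw [he.deriv_eq, ((hasDerivAt_inv hx0).const_mul n).deriv, hA x hx hx0]
    field_simp
    ring
  · have he : E.B =ᶠ[nhds x] fun x => m * (x ^ 2)⁻¹ := by
      filter_upwards [R.isOpen_I.mem_nhds hx, eventually_ne_zero hx0] with y hy hy' using hB y hy hy'
    have hd : HasDerivAt (fun x : ℝ => m * (x ^ 2)⁻¹) _ x :=
      ((hasDerivAt_pow 2 x).inv (pow_ne_zero 2 hx0)).const_mul m
    rw [he.deriv_eq, hd.deriv, hB x hx hx0]
    field_simp
    ring
  · have key : ∀ x ∈ R.I, fderiv ℝ E.D (t, x) (t, x) + 2 * E.D (t, x) = 0 := by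
      refine R.eq_zero_of_ne ?_ fun x hx hx0 => ?_
      · have h1 : ContinuousOn (fun x => fderiv ℝ E.D (t, x)) R.I :=
          contDiffOn_fderiv_D.continuousOn.comp (by fun_prop) fun x hx => ⟨ht, hx⟩
        exact (h1.clm_apply (by fun_prop)).add
          (continuousOn_const.mul (contDiffOn_D_snd ht).continuousOn)
      -- `D` is homogeneous of degree `-2`, so along the ray through `(t, x)` it scales by `(1 +
      -- s)⁻²`. The derivative at `s = 0` is Euler's relation.
      · have hφ : HasDerivAt (fun s : ℝ => ((1 + s * 1) ^ 2)⁻¹ * E.D (t, x)) (-2 * E.D (t, x)) 0 := by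
          have h0 : HasDerivAt (fun s : ℝ => 1 + s * 1) 1 0 := hasDerivAt_affine 1 1 0
          exact (((h0.pow 2).inv (by simp)).mul_const (E.D (t, x))).congr_deriv (by simp)
        rw [fderiv_D_eq (E := E) (a := t) (b := x) ht hx hφ ?_]
        · ring
        have c1 : ContinuousAt (fun s : ℝ => 1 + s * 1) 0 := by fun_prop
        filter_upwards [c1.preimage_mem_nhds (isOpen_ne.mem_nhds (by simp : 1 + (0 : ℝ) * 1 ≠ 0))]
          with s (hs : 1 + s * 1 ≠ 0) h1 h2
        have e1 : t + s * t = (1 + s * 1) * t := by ring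
        have e2 : x + s * x = (1 + s * 1) * x := by ring
        rw [hD _ h1 _ h2 (by rw [e2]; exact mul_ne_zero hs hx0), hD t ht x hx hx0, e1, e2]
        have e3 : (1 + s * 1) * t * ((1 + s * 1) * x)⁻¹ = t * x⁻¹ := by
          rw [mul_inv]; generalize 1 + s * 1 = r at hs; field_simp
        rw [e3, mul_pow, mul_inv]
        ring
    intro x hx
    have := key x hx
    simpa using this

lemma det_const {n m a b : ℝ} (hA : ∀ x ∈ R.I, E.A x = n) (hB : ∀ x ∈ R.I, E.B x = m)
    (hD : ∀ t ∈ R.J, ∀ x ∈ R.I, ∀ s, t + s * a ∈ R.J → x + s * b ∈ R.I →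
      E.D (t + s * a, x + s * b) = E.D (t, x)) : Det E 0 a b (fun _ => 0) := by
  have hd : ∀ {φ : ℝ → ℝ} {r : ℝ}, (∀ x ∈ R.I, φ x = r) → ∀ x ∈ R.I, deriv φ x = 0 := by
    intro φ r h x hx
    have he : φ =ᶠ[nhds x] fun _ => r := by
      filter_upwards [R.isOpen_I.mem_nhds hx] with y hy using h y hy
    rw [he.deriv_eq, deriv_const]
  refine ⟨contDiffOn_const, fun x hx => ?_, fun x hx => ?_, fun t ht x hx => ?_⟩
  · rw [hd hA x hx]; ring
  · rw [hd hB x hx]; ring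
  · have := fderiv_D_eq (E := E) ht hx (hasDerivAt_const (0 : ℝ) (E.D (t, x)))
      (.of_forall (hD t ht x hx))
    simpa using this

/-- The operators `∂_t + ψ u ∂_u` admitted by equations with `D` linear in `t`. -/
lemma det_dt {ψ δ : ℝ → ℝ} (hψ : ContDiffOn ℝ ∞ ψ R.I)
    (hD : ∀ t ∈ R.J, ∀ x ∈ R.I, E.D (t, x) = -t * E.L ψ x + δ x) : Det E 0 1 0 ψ := by
  refine ⟨hψ, fun x hx => by ring, fun x hx => by ring, fun t ht x hx => ?_⟩
  have hφ : HasDerivAt (fun s : ℝ => -(t + s * 1) * E.L ψ x + δ x) (-1 * E.L ψ x) 0 :=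
    ((hasDerivAt_affine t 1 0).neg.mul_const _).add_const _
  have := fderiv_D_eq (E := E) (a := 1) (b := 0) ht hx hφ
    (.of_forall fun s hs hs' => by rw [hD _ hs _ hs', mul_zero, add_zero])
  simp only [zero_mul, zero_add, mul_zero, add_zero, this, Equation.L]
  ring

/-- This identifies `D` of item II as `-t L ψ`, the form in which `∂_t + ψ u ∂_u` is visibly a
symmetry. -/
lemma InvariantForm.L_eq {f φ : ℝ → ℝ} (h : InvariantForm E f φ) (ψ : ℝ → ℝ) {x : ℝ}
    (hx : x ∈ R.I) : (wr f φ x)⁻¹ * (deriv (wr f φ) x * deriv ψ x - ψ x * rh f φ x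
      - wr f φ x * deriv (deriv ψ) x) = -E.L ψ x := by
  obtain ⟨h0, hA, hB⟩ := h.2.2 x hx
  rw [Equation.L, hA, hB]
  field_simp
  ring

lemma InvariantForm.triple {f φ h : ℝ → ℝ} {l₁ : ℝ} (hf : InvariantForm E f φ) (hl : l₁ ≠ 0)
    (hd : Det E 0 l₁ 0 h) : Triple E 0 l₁ 0 h f φ 0 0 0 0 .A31 := by
  obtain ⟨h1, h2, h3⟩ := invariantForm_iff.1 hf
  obtain ⟨x₀, hx₀⟩ := R.nonempty_I
  exact ⟨hd, h1, h2, .inr (.inl hl), ⟨x₀, hx₀, h3 x₀ hx₀⟩, by simp, by simp, rfl, rfl, rfl, rfl⟩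

/-- Only the first Euler case allows `n = m = 0`, and there the functions `1`, `x` are smooth
through the origin. This is used for regions that contain `x = 0`. -/
lemma EulerCase.eq_of_zero {i : ℕ} {n m : ℝ} {ty : LieType} {h₁ h₂ : ℝ → ℝ}
    (hi : EulerCase i n m ty h₁ h₂) (hn : n = 0) (hm : m = 0) :
    ty = .A32 ∧ h₁ = (fun _ => 1) ∧ h₂ = fun x => x := by
  cases hi with
  | c1 n hn1 => subst hn; exact ⟨rfl, rfl, by simp⟩
  | c2 => norm_num at hn
  | c3 => norm_num at hm
  | c4 m β h => linarith
  | c5 m β h h' => exact absurd hm h'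
  | c6 => norm_num at hn
  | c7 => norm_num at hn
  | c8 n h => exact absurd hn h
  | c9 n m β h => exact absurd hn h
  | c10 n m β h => exact absurd hn h

/-- At the origin the identities `A = n x⁻¹`, `B = m x⁻²` force `n = m = 0`. -/
lemma eq_zero_of_zero_mem {n m : ℝ} (h0 : (0 : ℝ) ∈ R.I)
    (hA : ∀ x ∈ R.I, x ≠ 0 → E.A x = n * x⁻¹)
    (hB : ∀ x ∈ R.I, x ≠ 0 → E.B x = m * (x ^ 2)⁻¹) : n = 0 ∧ m = 0 := by
  have cA := E.smooth_A.continuousOn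
  have cB := E.smooth_B.continuousOn
  have h1 := R.eq_zero_of_ne (φ := fun x => x * E.A x - n) (by fun_prop)
    (fun x hx hx0 => by rw [hA x hx hx0]; field_simp; ring) 0 h0
  have h2 := R.eq_zero_of_ne (φ := fun x => x ^ 2 * E.B x - m) (by fun_prop)
    (fun x hx hx0 => by rw [hB x hx hx0]; field_simp; ring) 0 h0
  constructor <;> linarith

/-- The first two terms of the operator outside the span of the `h u ∂_u`, in each item. -/
def Item.Vec : Item → ℝ → ℝ → ℝ → Prop
  | .I, l, l₁, l₂ => l = 0 ∧ l₁ = 1 ∧ l₂ = 0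
  | .II, l, l₁, l₂ => l = 0 ∧ l₁ = 1 ∧ l₂ = 0
  | .III _, l, l₁, l₂ => l = 1 ∧ l₁ = 0 ∧ l₂ = 0
  | .IV _, l, l₁, l₂ => l = 0 ∧ l₁ = 0 ∧ l₂ = 1
  | .V _, l, l₁, l₂ => l = 0 ∧ l₁ = 1 ∧ 0 < l₂

/-- Off the origin the matrix description applies with `p = 1/x`. If `0` lies in `I`, this `p` is
singular, but smoothness of `A` and `B` forces `n = m = 0`, and the pair `1`, `x` is checked
directly. -/
lemma EulerCase.exists_triple {i : ℕ} {n m : ℝ} {ty : LieType} {h₁ h₂ : ℝ → ℝ}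
    (hi : EulerCase i n m ty h₁ h₂) (hA : ∀ x ∈ R.I, x ≠ 0 → E.A x = n * x⁻¹)
    (hB : ∀ x ∈ R.I, x ≠ 0 → E.B x = m * (x ^ 2)⁻¹) (hd : Det E 1 0 0 (fun _ => 0)) :
    ∃ a b c d, Triple E 1 0 0 (fun _ => 0) h₁ h₂ a b c d ty := by
  by_cases h0 : (0 : ℝ) ∈ R.I
  · obtain ⟨hn, hm⟩ := eq_zero_of_zero_mem h0 hA hB
    obtain ⟨rfl, rfl, rfl⟩ := hi.eq_of_zero hn hm
    refine ⟨0, 0, 0, 1, hd, det_zero_iff.2 ⟨contDiffOn_const, fun x hx => ?_⟩,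
      det_zero_iff.2 ⟨contDiffOn_id, fun x hx => ?_⟩, by simp, ⟨0, h0, by simp [wr]⟩, by simp,
      by simp, rfl, rfl, rfl, one_ne_zero⟩
    · have := R.eq_zero_of_ne E.smooth_B.continuousOn
        (fun x hx hx0 => by rw [hB x hx hx0, hm, zero_mul]) x hx
      simp [Equation.L, this]
    · have h1 := R.eq_zero_of_ne E.smooth_B.continuousOn
        (fun x hx hx0 => by rw [hB x hx hx0, hm, zero_mul]) x hx
      have h2 := R.eq_zero_of_ne E.smooth_A.continuousOn
        (fun x hx hx0 => by rw [hA x hx hx0, hn, zero_mul]) x hx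
      simp [Equation.L, h1, h2]
  · have hne : ∀ x ∈ R.I, x ≠ 0 := fun x hx h => h0 (h ▸ hx)
    obtain ⟨a, b, c, d, hty, htr, hdet, hacts⟩ := hi.acts
    refine ⟨_, _, _, _, triple_of_actsAt (p := fun x => x⁻¹) (κ := 1)
      (contDiffOn_id.inv hne) (fun x hx => hacts x (hne x hx)) (fun x hx => ?_) (fun x hx => ?_) hd
      one_ne_zero (fun x hx => ?_) hty⟩
    · have := hne x hx
      rw [deriv_inv, hA x hx this, htr]
      field_simp
      ring
    · rw [hB x hx (hne x hx), hdet, inv_pow]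
    · have := hne x hx
      field_simp
      ring

lemma ConstCase.exists_triple {i : ℕ} {n m l₁ l₂ : ℝ} {ty : LieType} {h h₁ h₂ : ℝ → ℝ}
    (hi : ConstCase i n m ty h₁ h₂) (hA : ∀ x ∈ R.I, E.A x = n) (hB : ∀ x ∈ R.I, E.B x = m)
    (hl : l₂ ≠ 0) (hd : Det E 0 l₁ l₂ h) :
    ∃ a b c d, Triple E 0 l₁ l₂ h h₁ h₂ a b c d ty := by
  obtain ⟨a, b, c, d, hty, htr, hdet, hacts⟩ := hi.acts
  refine ⟨_, _, _, _, triple_of_actsAt (p := fun _ => 1) (κ := l₂) contDiffOn_const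
    (fun x _ => hacts x) (fun x hx => ?_) (fun x hx => ?_) hd hl (fun x hx => by ring) hty⟩
  · rw [deriv_const, hA x hx, htr]; ring
  · rw [hB x hx, hdet]; ring

/-- A common shape for all items, from which admission, type and behaviour under equivalence follow
uniformly. -/
theorem Listed.exists_triple {s : Item} {ty : LieType} {e₁ e₂ e₃ : VF}
    (H : Listed E s ty e₁ e₂ e₃) : ∃ l l₁ l₂ h h₁ h₂ a b c d,
      Triple E l l₁ l₂ h h₁ h₂ a b c d ty ∧
        Submodule.span ℝ {e₁, e₂, e₃} = tripleSpan R l l₁ l₂ h h₁ h₂ ∧ s.Vec l l₁ l₂ := by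
  cases H with
  | I f φ hf hD =>
    refine ⟨0, 1, 0, _, f, φ, 0, 0, 0, 0, hf.triple one_ne_zero
      (det_dt (ψ := fun _ => 0) (δ := fun _ => 0) contDiffOn_const fun t ht x hx => ?_), rfl,
      rfl, rfl, rfl⟩
    simp [hD t ht x hx, Equation.L]
  | II f φ ψ hf hψ hD =>
    refine ⟨0, 1, 0, ψ, f, φ, 0, 0, 0, 0, hf.triple one_ne_zero
      (det_dt (δ := fun _ => 0) hψ fun t ht x hx => ?_), ?_, rfl, rfl, rfl⟩
    · rw [hD t ht x hx, mul_assoc, hf.L_eq ψ hx]; ring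
    · rw [tripleSpan]
      congr 1
      ext v
      simp only [mem_insert_iff, mem_singleton_iff]
      tauto
  | III i n m c h₁ h₂ G hi hA hB hG hG0 hD =>
    obtain ⟨a, b, c, d, T⟩ := hi.exists_triple hA hB (det_dil hA hB hD)
    exact ⟨1, 0, 0, _, h₁, h₂, a, b, c, d, T, rfl, rfl, rfl, rfl⟩
  | IV i n m c h₁ h₂ G hi hA hB hG hD =>
    obtain ⟨a, b, c, d, T⟩ := hi.exists_triple hA hB one_ne_zero
      (det_const (a := 0) hA hB fun t ht x hx s h1 h2 => by rw [hD _ h1 _ h2, hD _ ht _ hx]; simp)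
    exact ⟨0, 0, 1, _, h₁, h₂, a, b, c, d, T, rfl, rfl, rfl, rfl⟩
  | V i n m c h₁ h₂ k G hi hk hA hB hG hD =>
    obtain ⟨a, b, c, d, T⟩ := hi.exists_triple hA hB hk.ne'
      (det_const (a := 1) hA hB fun t ht x hx s h1 h2 => by
        rw [hD _ h1 _ h2, hD _ ht _ hx]; ring_nf)
    exact ⟨0, 1, k, _, h₁, h₂, a, b, c, d, T, rfl, rfl, rfl, hk⟩

end Listed

/-! ### Generic coefficients -/

section Generic

variable {R : Region}

lemma exists_iteratedFDeriv_bound {V : Type*} [NormedAddCommGroup V] [NormedSpace ℝ V] {f : V → ℝ}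
    (hf : ContDiff ℝ ∞ f) {K : Set V} (hK : IsCompact K) (N : ℕ) :
    ∃ C : ℝ, 0 < C ∧ ∀ n ≤ N, ∀ x ∈ K, ‖iteratedFDeriv ℝ n f x‖ ≤ C := by
  have h : ∀ n : ℕ, ∃ C, ∀ x ∈ K, ‖iteratedFDeriv ℝ n f x‖ ≤ C := fun n =>
    hK.exists_bound_of_continuousOn
      (hf.continuous_iteratedFDeriv (m := n) (by exact_mod_cast le_top)).continuousOn
  choose C hC using h
  refine ⟨∑ i ∈ Finset.range (N + 1), |C i| + 1, by positivity, fun n hn x hx => ?_⟩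
  have := Finset.single_le_sum (f := fun i => |C i|) (fun i _ => abs_nonneg _)
    (Finset.mem_range.2 (Nat.lt_succ_of_le hn))
  linarith [hC n x hx, le_abs_self (C n)]

/-- The equation with coefficients `A + ε a`, `B`, `D + ε d`. -/
def Equation.perturb (E : Equation R) (ε : ℝ) {a : ℝ → ℝ} {d : ℝ × ℝ → ℝ} (ha : ContDiff ℝ ∞ a)
    (hd : ContDiff ℝ ∞ d) : Equation R where
  A := E.A + ε • a
  B := E.B
  D := E.D + ε • d
  smooth_A := E.smooth_A.add (ha.contDiffOn.const_smul ε)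
  smooth_B := E.smooth_B
  smooth_D := E.smooth_D.add (hd.contDiffOn.const_smul ε)

lemma iteratedFDeriv_add_smul {V : Type*} [NormedAddCommGroup V] [NormedSpace ℝ V] {f a : V → ℝ}
    {S : Set V} (hS : IsOpen S) (hf : ContDiffOn ℝ ∞ f S) (ha : ContDiff ℝ ∞ a) (ε : ℝ) (n : ℕ)
    {x : V} (hx : x ∈ S) : iteratedFDeriv ℝ n (f + ε • a) x
      = iteratedFDeriv ℝ n f x + ε • iteratedFDeriv ℝ n a x := by
  have hn : ((n : ℕ) : WithTop ℕ∞) ≤ ∞ := by exact_mod_cast le_top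
  have e : f + ε • a = f + fun y => ε • a y := rfl
  rw [e, iteratedFDeriv_add_apply ((hf.contDiffAt (hS.mem_nhds hx)).of_le hn)
    ((ha.const_smul ε).contDiffAt.of_le hn)]
  congr 1
  exact iteratedFDeriv_const_smul_apply (a := ε) (ha.contDiffAt.of_le hn)

/-- Perturbations by small multiples of fixed functions are small in the `C^∞` topology. -/
lemma Equation.exists_perturb_mem (E : Equation R) {a : ℝ → ℝ} {d : ℝ × ℝ → ℝ}
    (ha : ContDiff ℝ ∞ a) (hd : ContDiff ℝ ∞ d) {S : Set (Equation R)} (hS : IsOpen S)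
    (hE : E ∈ S) : ∃ r > 0, ∀ ε ∈ Ioo 0 r, E.perturb ε ha hd ∈ S := by
  obtain ⟨N, K, L, δ, hK, hKI, hL, hLI, hδ, h⟩ := hS E hE
  obtain ⟨C, hC, hCa⟩ := exists_iteratedFDeriv_bound ha hK N
  obtain ⟨C', hC', hCd⟩ := exists_iteratedFDeriv_bound hd hL N
  refine ⟨min (δ / C) (δ / C'), by positivity, fun ε hε => h _ fun n hn =>
    ⟨fun x hx => ⟨?_, ?_⟩, fun y hy => ?_⟩⟩
  · rw [Equation.perturb, iteratedFDeriv_add_smul R.isOpen_I E.smooth_A ha ε n (hKI hx),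
      add_sub_cancel_left, norm_smul, Real.norm_eq_abs, abs_of_pos hε.1]
    calc ε * _ ≤ ε * C := by gcongr; exacts [hε.1.le, hCa n hn x hx]
      _ < δ := (lt_div_iff₀ hC).1 (hε.2.trans_le (min_le_left _ _))
  · simpa [Equation.perturb] using hδ
  · rw [Equation.perturb, iteratedFDeriv_add_smul R.isOpen_JI E.smooth_D hd ε n (hLI hy),
      add_sub_cancel_left, norm_smul, Real.norm_eq_abs, abs_of_pos hε.1]
    calc ε * _ ≤ ε * C' := by gcongr; exacts [hε.1.le, hCd n hn y hy]
      _ < δ := (lt_div_iff₀ hC').1 (hε.2.trans_le (min_le_right _ _))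

/-- The determinant of the conditions on `l`, `l₂` at two points, in terms of the values and
derivatives of `A` there. -/
def jetDet (x₁ x₂ : ℝ) (z : ℝ × ℝ × ℝ × ℝ) : ℝ :=
  (x₁ * z.2.1 + z.1) * z.2.2.2 - (x₂ * z.2.2.2 + z.2.2.1) * z.2.1

/-- `(A(x₁), A'(x₁), A(x₂), A'(x₂))` -/
noncomputable def Equation.jetA (E : Equation R) (x₁ x₂ : ℝ) : ℝ × ℝ × ℝ × ℝ :=
  (E.A x₁, deriv E.A x₁, E.A x₂, deriv E.A x₂)

/-- The second derivative `D_tt`. -/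
noncomputable def Equation.Dtt (E : Equation R) (y : ℝ × ℝ) : ℝ :=
  fderiv ℝ (fderiv ℝ E.D) y (1, 0) (1, 0)

lemma Equation.Dtt_eq (E : Equation R) (y : ℝ × ℝ) :
    E.Dtt y = iteratedFDeriv ℝ 2 E.D y (fun _ => (1, 0)) := by
  rw [iteratedFDeriv_two_apply, Equation.Dtt]

lemma deriv_eq_iteratedFDeriv (f : ℝ → ℝ) (x : ℝ) :
    deriv f x = iteratedFDeriv ℝ 1 f x (fun _ => 1) := by
  rw [iteratedFDeriv_one_apply, fderiv_eq_smul_deriv, one_smul]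

lemma abs_iteratedFDeriv_sub_le {V : Type*} [NormedAddCommGroup V] [NormedSpace ℝ V] (f g : V → ℝ)
    (n : ℕ) (x : V) {e : V} (he : ‖e‖ ≤ 1) :
    |iteratedFDeriv ℝ n f x (fun _ => e) - iteratedFDeriv ℝ n g x (fun _ => e)|
      ≤ ‖iteratedFDeriv ℝ n f x - iteratedFDeriv ℝ n g x‖ := by
  have := (iteratedFDeriv ℝ n f x - iteratedFDeriv ℝ n g x).le_opNorm (fun _ => e)
  refine (show _ ≤ _ from this).trans (mul_le_of_le_one_right (norm_nonneg _) ?_)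
  simpa using pow_le_one₀ (norm_nonneg e) he

/-- Coefficients in general position. -/
def genericSet (R : Region) (x₁ x₂ : ℝ) (y : ℝ × ℝ) : Set (Equation R) :=
  {E | jetDet x₁ x₂ (E.jetA x₁ x₂) ≠ 0 ∧ E.Dtt y ≠ 0}

/-- Membership depends continuously on finitely many numbers: values and first derivatives of `A` at
two points and a second derivative of `D` at one. Hence derivatives up to order two on finite sets
control it. -/
lemma isOpen_genericSet {x₁ x₂ : ℝ} {y : ℝ × ℝ} (h₁ : x₁ ∈ R.I) (h₂ : x₂ ∈ R.I)
    (hy : y ∈ R.J ×ˢ R.I) : IsOpen (genericSet R x₁ x₂ y) := by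
  rintro E ⟨hA, hD⟩
  have hc : Continuous (jetDet x₁ x₂) := by unfold jetDet; fun_prop
  obtain ⟨δ, hδ, hδ'⟩ := Metric.isOpen_iff.1 (isOpen_ne.preimage hc) _ hA
  refine ⟨2, {x₁, x₂}, {y}, min δ |E.Dtt y|, (toFinite _).isCompact, ?_, isCompact_singleton,
    by simpa using hy, lt_min hδ (abs_pos.2 hD), fun E' hE' => ⟨hδ' ?_, fun h0 => ?_⟩⟩
  · rintro x (rfl | rfl) <;> assumption
  · have h0 : ∀ x ∈ ({x₁, x₂} : Set ℝ), |E'.A x - E.A x| < δ := fun x hx => by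
      have := abs_iteratedFDeriv_sub_le E'.A E.A 0 x (e := 1) (by simp)
      simp only [iteratedFDeriv_zero_apply] at this
      exact this.trans_lt ((((hE' 0 (by norm_num)).1 x hx).1).trans_le (min_le_left _ _))
    have h1 : ∀ x ∈ ({x₁, x₂} : Set ℝ), |deriv E'.A x - deriv E.A x| < δ := fun x hx => by
      have := abs_iteratedFDeriv_sub_le E'.A E.A 1 x (e := 1) (by simp)
      rw [← deriv_eq_iteratedFDeriv, ← deriv_eq_iteratedFDeriv] at this
      exact this.trans_lt ((((hE' 1 (by norm_num)).1 x hx).1).trans_le (min_le_left _ _))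
    rw [Metric.mem_ball, dist_eq_norm]
    exact max_lt (h0 _ (by simp)) (max_lt (h1 _ (by simp)) (max_lt (h0 _ (by simp))
      (h1 _ (by simp))))
  · have := abs_iteratedFDeriv_sub_le E'.D E.D 2 y (e := (1, 0)) (by simp [Prod.norm_def])
    rw [← Equation.Dtt_eq, ← Equation.Dtt_eq, h0, zero_sub, abs_neg] at this
    exact absurd (this.trans_lt (((hE' 2 le_rfl).2 y rfl).trans_le (min_le_right _ _)))
      (lt_irrefl _)

/-- The product of the two expressions is a nonzero polynomial in `ε`, so its roots cannot fill an
interval. Both genericity conditions are met along one perturbation. -/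
lemma exists_ne_zero_of_quadratic {q₀ q₁ q₂ s r : ℝ} (hq : q₂ ≠ 0) (hr : 0 < r) :
    ∃ ε ∈ Ioo 0 r, q₂ * ε ^ 2 + q₁ * ε + q₀ ≠ 0 ∧ s + ε ≠ 0 := by
  by_contra hcon
  push Not at hcon
  set P : Polynomial ℝ := (.C q₂ * .X ^ 2 + .C q₁ * .X + .C q₀) * (.X + .C s)
  have h1 : P ≠ 0 := mul_ne_zero (fun h => hq (by
    rw [← Polynomial.leadingCoeff_quadratic hq (b := q₁) (c := q₀), h,
      Polynomial.leadingCoeff_zero])) (Polynomial.X_add_C_ne_zero s)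
  refine h1 (P.eq_zero_of_infinite_isRoot ((Ioo_infinite hr).mono fun ε hε => ?_))
  simp only [P, mem_ofPred_eq, Polynomial.IsRoot.def, Polynomial.eval_mul, Polynomial.eval_add,
    Polynomial.eval_C, Polynomial.eval_pow, Polynomial.eval_X]
  by_cases h : q₂ * ε ^ 2 + q₁ * ε + q₀ = 0
  · rw [h, zero_mul]
  · rw [add_comm ε s, hcon ε hε h, mul_zero]

/-- Along `A + ε (1 + (x - x₁)²)`, `D + ε t²/2` the determinant is quadratic in `ε` with leading
coefficient `2 (x₂ - x₁)`, because the perturbation of `A` has value one and slope zero at `x₁`; and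
`D_tt` becomes `D_tt + ε`. Arbitrarily small `ε` keep both nonzero. -/
lemma dense_genericSet {x₁ x₂ : ℝ} {y : ℝ × ℝ} (h₁ : x₁ ∈ R.I) (h₂ : x₂ ∈ R.I) (h : x₁ ≠ x₂)
    (hy : y ∈ R.J ×ˢ R.I) : Dense (genericSet R x₁ x₂ y) := by
  intro E
  rw [mem_closure_iff]
  intro S hS hE
  have ha : ContDiff ℝ ∞ fun x : ℝ => 1 + (x - x₁) ^ 2 := by fun_prop
  have hd : ContDiff ℝ ∞ fun y : ℝ × ℝ => y.1 ^ 2 * 2⁻¹ := by fun_prop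
  obtain ⟨r, hr, hmem⟩ := E.exists_perturb_mem ha hd hS hE
  have hA : ∀ ε, ∀ x ∈ R.I, (E.perturb ε ha hd).A x = E.A x + ε * (1 + (x - x₁) ^ 2) ∧
      deriv (E.perturb ε ha hd).A x = deriv E.A x + ε * (2 * (x - x₁)) := fun ε x hx => by
    have h2 : HasDerivAt (fun x : ℝ => 1 + (x - x₁) ^ 2) (2 * (x - x₁)) x :=
      ((((hasDerivAt_id x).sub_const x₁).pow 2).const_add 1).congr_deriv (by simp)
    exact ⟨rfl, ((E.differentiableAt_A hx).hasDerivAt.add (h2.const_mul ε)).deriv⟩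
  have hD : ∀ ε, (E.perturb ε ha hd).Dtt y = E.Dtt y + ε := fun ε => by
    have h1 : fderiv ℝ (fun y : ℝ × ℝ => y.1 ^ 2 * 2⁻¹)
        = fun y => y.1 • ContinuousLinearMap.fst ℝ ℝ ℝ := by
      funext y
      have : HasFDerivAt (𝕜 := ℝ) (fun y : ℝ × ℝ => y.1) _ y := hasFDerivAt_fst
      rw [((this.pow 2).mul_const (2 : ℝ)⁻¹).fderiv]
      ext <;> simp
    have h2 := ((ContinuousLinearMap.fst ℝ ℝ ℝ).smulRight
      (ContinuousLinearMap.fst ℝ ℝ ℝ)).hasFDerivAt (x := y)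
    rw [Equation.Dtt_eq, Equation.perturb, iteratedFDeriv_add_smul R.isOpen_JI E.smooth_D hd ε 2 hy,
      Equation.Dtt_eq]
    have h3 : iteratedFDeriv ℝ 2 (fun y : ℝ × ℝ => y.1 ^ 2 * 2⁻¹) y (fun _ => (1, 0)) = 1 := by
      rw [iteratedFDeriv_two_apply, h1]
      erw [h2.fderiv]
      simp
    rw [add_apply, smul_apply, h3, smul_eq_mul, mul_one]
  obtain ⟨ε, hε, hq, hs⟩ := exists_ne_zero_of_quadratic
    (q₀ := jetDet x₁ x₂ (E.jetA x₁ x₂))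
    (q₁ := (x₁ * deriv E.A x₁ + E.A x₁) * (2 * (x₂ - x₁)) + deriv E.A x₂
      - (x₂ * (2 * (x₂ - x₁)) + (1 + (x₂ - x₁) ^ 2)) * deriv E.A x₁)
    (q₂ := 2 * (x₂ - x₁)) (s := E.Dtt y) (mul_ne_zero two_ne_zero (sub_ne_zero.2 h.symm)) hr
  refine ⟨_, hmem ε hε, ?_, by rwa [hD]⟩
  obtain ⟨e1, e2⟩ := hA ε x₁ h₁
  obtain ⟨e3, e4⟩ := hA ε x₂ h₂
  convert hq using 1
  simp only [jetDet, Equation.jetA, e1, e2, e3, e4]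
  ring

/-- The equation for `A` at `x₁` and `x₂` is a linear system for `(l, l₂)` with determinant
`jetDet`. Once `l = l₂ = 0`, the equation for `D` makes `l₁ D_t` independent of `t`, and
differentiation gives `l₁ D_tt = 0`. -/
lemma Det.eq_zero_of_generic {E : Equation R} {x₁ x₂ t₀ x₀ : ℝ} (h₁ : x₁ ∈ R.I) (h₂ : x₂ ∈ R.I)
    (ht₀ : t₀ ∈ R.J) (hx₀ : x₀ ∈ R.I) (hE : E ∈ genericSet R x₁ x₂ (t₀, x₀)) {l l₁ l₂ : ℝ}
    {h : ℝ → ℝ} (hd : Det E l l₁ l₂ h) : l = 0 ∧ l₁ = 0 ∧ l₂ = 0 := by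
  obtain ⟨hA, hD⟩ := hE
  have e1 := hd.eqA x₁ h₁
  have e2 := hd.eqA x₂ h₂
  simp only [jetDet, Equation.jetA] at hA
  have hl : l = 0 := (mul_eq_zero.1 (?_ : l * _ = 0)).resolve_right hA
  have hl₂ : l₂ = 0 := (mul_eq_zero.1 (?_ : l₂ * _ = 0)).resolve_right hA
  · subst hl hl₂
    refine ⟨rfl, (mul_eq_zero.1 (?_ : l₁ * E.Dtt (t₀, x₀) = 0)).resolve_right hD, rfl⟩
    have hc : HasDerivAt (fun t => fderiv ℝ E.D (t, x₀) (l₁, 0)) 0 t₀ := by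
      refine (hasDerivAt_const t₀ (-(deriv (deriv h) x₀ + E.A x₀ * deriv h x₀ + E.B x₀ * h x₀)))
        |>.congr_of_eventuallyEq ?_
      filter_upwards [R.isOpen_J.mem_nhds ht₀] with t ht
      have := hd.eqD t ht x₀ hx₀
      simp only [zero_mul, zero_add, mul_zero, add_zero] at this
      linarith
    have hf : HasFDerivAt (fderiv ℝ E.D) (fderiv ℝ (fderiv ℝ E.D) (t₀, x₀)) (t₀, x₀) :=
      ((contDiffOn_fderiv_D.contDiffAt (R.isOpen_JI.mem_nhds ⟨ht₀, hx₀⟩)).differentiableAt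
        (by simp)).hasFDerivAt
    have hp : HasDerivAt (fun t : ℝ => (t, x₀)) ((1 : ℝ), (0 : ℝ)) t₀ :=
      (hasDerivAt_id t₀).prodMk (hasDerivAt_const t₀ x₀)
    have h3 := hf.comp_hasDerivAt t₀ hp
    have h4 := (ContinuousLinearMap.apply ℝ ℝ ((l₁, 0) : ℝ × ℝ)).hasFDerivAt.comp_hasDerivAt t₀ h3
    have := h4.unique hc
    simp only [ContinuousLinearMap.apply_apply] at this
    have e : ((l₁, 0) : ℝ × ℝ) = l₁ • (1, 0) := by simp
    rwa [e, map_smul] at this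
  · linear_combination -(x₂ * deriv E.A x₂ + E.A x₂) * e1 + (x₁ * deriv E.A x₁ + E.A x₁) * e2
  · linear_combination deriv E.A x₂ * e1 - deriv E.A x₁ * e2

theorem exists_generic (R : Region) : ∃ 𝒢 : Set (Equation R), IsOpen 𝒢 ∧ Dense 𝒢 ∧
    ∀ E ∈ 𝒢, ∀ f g : ℝ → ℝ, InvariantForm E f g →
      E.maxAlg = Submodule.span ℝ {R.mulU f, R.mulU g} ∧
      LinearIndependent ℝ ![R.mulU f, R.mulU g] ∧ bracket (R.mulU f) (R.mulU g) = 0 := by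
  obtain ⟨t₀, ht₀⟩ := R.nonempty_J
  obtain ⟨x₁, h₁⟩ := R.nonempty_I
  obtain ⟨x₂, h₂, hne⟩ : ∃ x₂ ∈ R.I, x₁ ≠ x₂ := by
    by_contra hcon
    push Not at hcon
    obtain ⟨h, -⟩ := eq_zero_of_affine R.isOpen_I R.nonempty_I (a := 1) (b := -x₁)
      (fun x hx => by rw [← hcon x hx]; ring)
    exact one_ne_zero h
  refine ⟨genericSet R x₁ x₂ (t₀, x₁), isOpen_genericSet h₁ h₂ ⟨ht₀, h₁⟩,
    dense_genericSet h₁ h₂ hne ⟨ht₀, h₁⟩, fun E hE f g hfg => ⟨maxAlg_eq_span_pair hfg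
      fun l l₁ l₂ h hd => hd.eq_zero_of_generic h₁ h₂ ht₀ h₁ hE, ?_, ?_⟩⟩
  · exact R.linearIndependent_pair hfg.1 hfg.2.1 ⟨x₁, h₁, (hfg.2.2 x₁ h₁).1⟩
  · exact bracket_mulU_mulU hfg.1 hfg.2.1

end Generic

/-! ### The equivalence group in terms of coefficients -/

section Equivalence

variable {R R' : Region} {E : Equation R} {E' : Equation R'}

/-- The transformation `t' = k t + k₁`, `x' = ε k x + k₂`, `v = ± exp(g(x)) u` takes `E` to `E'`, in
terms of the coefficients. -/
structure CoeffRel (E : Equation R) (E' : Equation R') (k k₁ k₂ ε : ℝ) (g : ℝ → ℝ) : Prop where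
  k_ne : k ≠ 0
  ε_eq : ε = 1 ∨ ε = -1
  smooth : ContDiffOn ℝ ∞ g R.I
  image_J : (fun t => k * t + k₁) '' R.J = R'.J
  image_I : (fun x => ε * k * x + k₂) '' R.I = R'.I
  eqA : ∀ x ∈ R.I, E.A x = ε * k * E'.A (ε * k * x + k₂)
  eqB : ∀ x ∈ R.I, E.B x = k ^ 2 * E'.B (ε * k * x + k₂)
  eqD : ∀ t ∈ R.J, ∀ x ∈ R.I,
    E.D (t, x) = k ^ 2 * E'.D (k * t + k₁, ε * k * x + k₂) + E.L g x

namespace CoeffRel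

variable {k k₁ k₂ ε : ℝ} {g : ℝ → ℝ}

lemma ε_sq (C : CoeffRel E E' k k₁ k₂ ε g) : ε ^ 2 = 1 := by
  rcases C.ε_eq with h | h <;> rw [h] <;> norm_num

lemma εk_ne (C : CoeffRel E E' k k₁ k₂ ε g) : ε * k ≠ 0 := by
  refine mul_ne_zero (fun h => ?_) C.k_ne
  have := C.ε_sq
  rw [h] at this
  norm_num at this

lemma mem_J (C : CoeffRel E E' k k₁ k₂ ε g) {t : ℝ} (ht : t ∈ R.J) : k * t + k₁ ∈ R'.J :=
  C.image_J ▸ mem_image_of_mem _ ht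

lemma mem_I (C : CoeffRel E E' k k₁ k₂ ε g) {x : ℝ} (hx : x ∈ R.I) : ε * k * x + k₂ ∈ R'.I :=
  C.image_I ▸ mem_image_of_mem _ hx

lemma exists_J (C : CoeffRel E E' k k₁ k₂ ε g) {s : ℝ} (hs : s ∈ R'.J) :
    ∃ t ∈ R.J, k * t + k₁ = s := by
  rw [← C.image_J] at hs; exact hs

lemma exists_I (C : CoeffRel E E' k k₁ k₂ ε g) {y : ℝ} (hy : y ∈ R'.I) :
    ∃ x ∈ R.I, ε * k * x + k₂ = y := by
  rw [← C.image_I] at hy; exact hy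

lemma hasDerivAt_comp (C : CoeffRel E E' k k₁ k₂ ε g) {h : ℝ → ℝ} (hh : ContDiffOn ℝ ∞ h R'.I)
    {x : ℝ} (hx : x ∈ R.I) :
    HasDerivAt (fun x => h (ε * k * x + k₂)) (ε * k * deriv h (ε * k * x + k₂)) x := by
  have h1 := R'.hasDerivAt_of_contDiffOn hh (C.mem_I hx)
  have h2 : HasDerivAt (fun x : ℝ => ε * k * x + k₂) (ε * k) x := by
    simpa using ((hasDerivAt_id x).const_mul (ε * k)).add_const k₂
  exact (h1.comp x h2).congr_deriv (mul_comm _ _)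

lemma deriv_deriv_comp (C : CoeffRel E E' k k₁ k₂ ε g) {h : ℝ → ℝ} (hh : ContDiffOn ℝ ∞ h R'.I)
    {x : ℝ} (hx : x ∈ R.I) : deriv (deriv fun x => h (ε * k * x + k₂)) x
      = k ^ 2 * deriv (deriv h) (ε * k * x + k₂) := by
  have he : (deriv fun x => h (ε * k * x + k₂)) =ᶠ[nhds x]
      fun x => ε * k * deriv h (ε * k * x + k₂) := by
    filter_upwards [R.isOpen_I.mem_nhds hx] with y hy using (C.hasDerivAt_comp hh hy).deriv
  rw [he.deriv_eq, ((C.hasDerivAt_comp (R'.contDiffOn_deriv hh) hx).const_mul (ε * k)).deriv]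
  linear_combination k ^ 2 * deriv (deriv h) (ε * k * x + k₂) * C.ε_sq

lemma contDiffOn_comp (C : CoeffRel E E' k k₁ k₂ ε g) {h : ℝ → ℝ} (hh : ContDiffOn ℝ ∞ h R'.I) :
    ContDiffOn ℝ ∞ (fun x => h (ε * k * x + k₂)) R.I :=
  hh.comp (by fun_prop) fun _ hx => C.mem_I hx

lemma contDiffOn_L {h : ℝ → ℝ} (hh : ContDiffOn ℝ ∞ h R.I) : ContDiffOn ℝ ∞ (E.L h) R.I :=
  ((R.contDiffOn_deriv (R.contDiffOn_deriv hh)).add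
    (E.smooth_A.mul (R.contDiffOn_deriv hh))).add (E.smooth_B.mul hh)

/-- Symmetries of `E'` are transformed into symmetries of `E`. -/
lemma det (C : CoeffRel E E' k k₁ k₂ ε g) {l l₁ l₂ l₁' l₂' : ℝ} {h : ℝ → ℝ}
    (hd : Det E' l l₁' l₂' h) (h₁ : l₁' = k * l₁ - l * k₁) (h₂ : l₂' = ε * k * l₂ - l * k₂) :
    Det E l l₁ l₂ (fun x => h (ε * k * x + k₂) - (l * x + l₂) * deriv g x) := by
  have hA : ∀ x ∈ R.I, deriv E.A x = k ^ 2 * deriv E'.A (ε * k * x + k₂) := fun x hx => by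
    have he : E.A =ᶠ[nhds x] fun x => ε * k * E'.A (ε * k * x + k₂) := by
      filter_upwards [R.isOpen_I.mem_nhds hx] with y hy using C.eqA y hy
    rw [he.deriv_eq, ((C.hasDerivAt_comp E'.smooth_A hx).const_mul (ε * k)).deriv]
    linear_combination k ^ 2 * deriv E'.A (ε * k * x + k₂) * C.ε_sq
  have hB : ∀ x ∈ R.I, deriv E.B x = k ^ 2 * (ε * k * deriv E'.B (ε * k * x + k₂)) := fun x hx => by
    have he : E.B =ᶠ[nhds x] fun x => k ^ 2 * E'.B (ε * k * x + k₂) := by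
      filter_upwards [R.isOpen_I.mem_nhds hx] with y hy using C.eqB y hy
    rw [he.deriv_eq, ((C.hasDerivAt_comp E'.smooth_B hx).const_mul (k ^ 2)).deriv]
  have eA : ∀ x ∈ R.I, (l * x + l₂) * deriv E.A x + l * E.A x = 0 := fun x hx => by
    have := hd.eqA _ (C.mem_I hx)
    rw [hA x hx, C.eqA x hx]
    rw [h₂] at this
    linear_combination ε * k * this
      - k ^ 2 * (l * x + l₂) * deriv E'.A (ε * k * x + k₂) * C.ε_sq
  have eB : ∀ x ∈ R.I, (l * x + l₂) * deriv E.B x + 2 * l * E.B x = 0 := fun x hx => by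
    have := hd.eqB _ (C.mem_I hx)
    rw [hB x hx, C.eqB x hx]
    rw [h₂] at this
    linear_combination k ^ 2 * this
  have g0 := C.smooth
  have g1 := R.contDiffOn_deriv g0
  have g2 := R.contDiffOn_deriv g1
  have hl : ∀ x, HasDerivAt (fun x : ℝ => l * x + l₂) l x := fun x => by
    simpa using ((hasDerivAt_id x).const_mul l).add_const l₂
  refine ⟨(C.contDiffOn_comp hd.smooth).sub (by fun_prop), eA, eB, fun t ht x hx => ?_⟩
  have d1 : ∀ x ∈ R.I, HasDerivAt (fun x => h (ε * k * x + k₂) - (l * x + l₂) * deriv g x)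
      (deriv (fun x => h (ε * k * x + k₂)) x
        - (l * deriv g x + (l * x + l₂) * deriv (deriv g) x)) x := fun x hx =>
    (R.hasDerivAt_of_contDiffOn (C.contDiffOn_comp hd.smooth) hx).sub
      ((hl x).mul (R.hasDerivAt_of_contDiffOn g1 hx))
  have d2 : deriv (deriv fun x => h (ε * k * x + k₂) - (l * x + l₂) * deriv g x) x
      = k ^ 2 * deriv (deriv h) (ε * k * x + k₂)
        - (2 * l * deriv (deriv g) x + (l * x + l₂) * deriv (deriv (deriv g)) x) := by
    have he : (deriv fun x => h (ε * k * x + k₂) - (l * x + l₂) * deriv g x) =ᶠ[nhds x] fun x =>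
        deriv (fun x => h (ε * k * x + k₂)) x
          - (l * deriv g x + (l * x + l₂) * deriv (deriv g) x) := by
      filter_upwards [R.isOpen_I.mem_nhds hx] with y hy using (d1 y hy).deriv
    rw [he.deriv_eq]
    refine ((R.hasDerivAt_of_contDiffOn
      (R.contDiffOn_deriv (C.contDiffOn_comp hd.smooth)) hx).sub
      (((R.hasDerivAt_of_contDiffOn g1 hx).const_mul l).add
        ((hl x).mul (R.hasDerivAt_of_contDiffOn g2 hx)))).deriv.trans ?_
    rw [C.deriv_deriv_comp hd.smooth hx]
    ring
  -- `eqD` is differentiated along the line with the direction of the operator; the summand `L g`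
  -- contributes `ξ (L g)'` with `ξ = l x + l₂`.
  have d3 : fderiv ℝ E.D (t, x) (l * t + l₁, l * x + l₂)
      = k ^ 2 * fderiv ℝ E'.D (k * t + k₁, ε * k * x + k₂)
          (k * (l * t + l₁), ε * k * (l * x + l₂)) + (l * x + l₂) * deriv (E.L g) x := by
    set τ := l * t + l₁
    set ξ := l * x + l₂
    have c1 : HasDerivAt (fun s : ℝ => (k * (t + s * τ) + k₁, ε * k * (x + s * ξ) + k₂))
        (k * τ, ε * k * ξ) 0 :=
      (((hasDerivAt_affine t τ 0).const_mul k).add_const k₁).prodMk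
        (((hasDerivAt_affine x ξ 0).const_mul (ε * k)).add_const k₂)
    have c2 : HasFDerivAt E'.D (fderiv ℝ E'.D (k * t + k₁, ε * k * x + k₂))
        (k * (t + 0 * τ) + k₁, ε * k * (x + 0 * ξ) + k₂) := by
      simp only [zero_mul, add_zero]
      exact (E'.differentiableAt_D (C.mem_J ht) (C.mem_I hx)).hasFDerivAt
    have c3 : HasDerivAt (E.L g) (deriv (E.L g) x) (x + 0 * ξ) := by
      rw [zero_mul, add_zero]
      exact R.hasDerivAt_of_contDiffOn (contDiffOn_L g0) hx
    have c4 := ((c2.comp_hasDerivAt (0 : ℝ) c1).const_mul (k ^ 2)).add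
      (c3.comp (0 : ℝ) (hasDerivAt_affine x ξ 0))
    rw [fderiv_D_eq ht hx c4 (.of_forall fun s h1 h2 => C.eqD _ h1 _ h2)]
    ring
  have d4 : deriv (E.L g) x = deriv (deriv (deriv g)) x + (deriv E.A x * deriv g x
      + E.A x * deriv (deriv g) x) + (deriv E.B x * g x + E.B x * deriv g x) :=
    (((R.hasDerivAt_of_contDiffOn g2 hx).add ((E.differentiableAt_A hx).hasDerivAt.mul
      (R.hasDerivAt_of_contDiffOn g1 hx))).add ((E.differentiableAt_B hx).hasDerivAt.mul
      (R.hasDerivAt_of_contDiffOn g0 hx))).deriv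
  have e := hd.eqD _ (C.mem_J ht) _ (C.mem_I hx)
  have v1 : l * (k * t + k₁) + l₁' = k * (l * t + l₁) := by rw [h₁]; ring
  have v2 : l * (ε * k * x + k₂) + l₂' = ε * k * (l * x + l₂) := by rw [h₂]; ring
  rw [v1, v2] at e
  rw [d2, (d1 x hx).deriv, (C.hasDerivAt_comp hd.smooth hx).deriv, d3, d4, C.eqD t ht x hx,
    Equation.L]
  have a0 := C.eqA x hx
  have b0 := C.eqB x hx
  have εs := C.ε_sq
  -- The terms with `g` collapse by `ξ (L g)' + 2 l L g - L (ξ g') = (ξ A' + l A) g' + (ξ B' + 2 l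
  -- B) g`, which vanishes by `eA` and `eB`.
  linear_combination k ^ 2 * e + g x * eB x hx + deriv g x * eA x hx
    + ε * k * deriv h (ε * k * x + k₂) * a0 + h (ε * k * x + k₂) * b0
    + k ^ 2 * E'.A (ε * k * x + k₂) * deriv h (ε * k * x + k₂) * εs

lemma det_mulU (C : CoeffRel E E' k k₁ k₂ ε g) {h : ℝ → ℝ} (hd : Det E' 0 0 0 h) :
    Det E 0 0 0 (fun x => h (ε * k * x + k₂)) :=
  (C.det (l₁ := 0) (l₂ := 0) hd (by ring) (by ring)).congr fun x _ => by ring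

lemma triple (C : CoeffRel E E' k k₁ k₂ ε g) {l l₁ l₂ l₁' l₂' a b c d : ℝ} {h h₁ h₂ : ℝ → ℝ}
    {ty : LieType} (T : Triple E' l l₁' l₂' h h₁ h₂ a b c d ty)
    (e₁ : l₁' = k * l₁ - l * k₁) (e₂ : l₂' = ε * k * l₂ - l * k₂) :
    Triple E l l₁ l₂ (fun x => h (ε * k * x + k₂) - (l * x + l₂) * deriv g x)
      (fun x => h₁ (ε * k * x + k₂)) (fun x => h₂ (ε * k * x + k₂)) a b c d ty := by
  refine ⟨C.det T.det e₁ e₂, C.det_mulU T.det₁, C.det_mulU T.det₂, ?_, ?_, fun x hx => ?_,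
    fun x hx => ?_, T.type⟩
  · by_contra hcon
    push Not at hcon
    obtain ⟨rfl, rfl, rfl⟩ := hcon
    rcases T.ne with h | h | h
    exacts [h rfl, h (by rw [e₁]; ring), h (by rw [e₂]; ring)]
  · obtain ⟨y, hy, hw⟩ := T.wr_ne
    obtain ⟨x, hx, rfl⟩ := C.exists_I hy
    refine ⟨x, hx, fun h0 => mul_ne_zero C.εk_ne hw ?_⟩
    rw [wr, (C.hasDerivAt_comp T.det₁.smooth hx).deriv,
      (C.hasDerivAt_comp T.det₂.smooth hx).deriv] at h0
    rw [wr]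
    linear_combination h0
  · rw [(C.hasDerivAt_comp T.det₁.smooth hx).deriv, ← T.act₁ _ (C.mem_I hx), e₂]; ring
  · rw [(C.hasDerivAt_comp T.det₂.smooth hx).deriv, ← T.act₂ _ (C.mem_I hx), e₂]; ring

end CoeffRel

lemma deriv_comp_affine (f : ℝ → ℝ) (c r s : ℝ) :
    deriv (fun s => f ((s - c) / r)) s = deriv f ((s - c) / r) / r := by
  have h1 : (fun s => f ((s - c) / r)) = fun s => (fun y => f (r⁻¹ * y)) (s - c) := by
    funext s; rw [div_eq_inv_mul]
  rw [h1, deriv_comp_sub_const (fun y => f (r⁻¹ * y)), deriv_comp_mul_left, div_eq_inv_mul, div_eq_inv_mul, smul_eq_mul]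

lemma iteratedDeriv_two (f : ℝ → ℝ) : iteratedDeriv 2 f = deriv (deriv f) := by
  rw [iteratedDeriv_succ, iteratedDeriv_one]

lemma iteratedDeriv_comp_affine (f : ℝ → ℝ) (c r s : ℝ) :
    iteratedDeriv 2 (fun s => f ((s - c) / r)) s = iteratedDeriv 2 f ((s - c) / r) / r ^ 2 := by
  have h : (deriv fun s => f ((s - c) / r)) = fun s => r⁻¹ * deriv f ((s - c) / r) := by
    funext s; rw [deriv_comp_affine, div_eq_inv_mul]
  rw [iteratedDeriv_two, iteratedDeriv_two, h, deriv_const_mul_field, deriv_comp_affine]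
  ring

namespace Transformation

variable (T : Transformation R)

lemma ε_ne : T.ε ≠ 0 := by rcases T.ε_eq with h | h <;> rw [h] <;> norm_num

/-- The transformed equation at a point, in terms of the original coordinates. -/
lemma solvesAt_onFunction_iff (hY : ∀ t ∈ R.J, ∀ x ∈ R.I, T.Y (t, x) = 0) (F : ℝ × ℝ × ℝ × ℝ → ℝ)
    {u : ℝ × ℝ → ℝ} (hu : ContDiff ℝ ∞ u) {t x : ℝ} (ht : t ∈ R.J) (hx : x ∈ R.I) :
    SolvesAt F (T.onFunction u) (T.k * t + T.k₁) (T.ε * T.k * x + T.k₂) ↔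
      T.X x * iteratedDeriv 2 (fun s => u (s, x)) t =
        deriv (deriv T.X) x * u (t, x) + 2 * deriv T.X x * deriv (fun y => u (t, y)) x
          + T.X x * iteratedDeriv 2 (fun y => u (t, y)) x
          + T.k ^ 2 * F (T.k * t + T.k₁, T.ε * T.k * x + T.k₂, T.X x * u (t, x),
            (deriv T.X x * u (t, x) + T.X x * deriv (fun y => u (t, y)) x) / (T.ε * T.k)) := by
  have hk := T.k_ne
  have hεk : T.ε * T.k ≠ 0 := mul_ne_zero T.ε_ne hk
  have ε2 : T.ε ^ 2 = 1 := by rcases T.ε_eq with h | h <;> rw [h] <;> norm_num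
  have et : (T.k * t + T.k₁ - T.k₁) / T.k = t := by field_simp; ring
  have ex : (T.ε * T.k * x + T.k₂ - T.k₂) / (T.ε * T.k) = x := by
    rw [add_sub_cancel_right, mul_div_cancel_left₀ _ hεk]
  have ut : ContDiff ℝ ∞ fun s => u (s, x) := hu.comp (contDiff_id.prodMk contDiff_const)
  have ux : ContDiff ℝ ∞ fun y => u (t, y) := hu.comp (contDiff_const.prodMk contDiff_id)
  set ψ : ℝ → ℝ := fun y => T.X y * u (t, y) with hψ
  have c1 : ContinuousAt (fun s => (s - T.k₁) / T.k) (T.k * t + T.k₁) := by fun_prop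
  have c2 : ContinuousAt (fun s => (s - T.k₂) / (T.ε * T.k)) (T.ε * T.k * x + T.k₂) := by fun_prop
  have n1 := c1.preimage_mem_nhds (R.isOpen_J.mem_nhds (et.symm ▸ ht))
  have n2 := c2.preimage_mem_nhds (R.isOpen_I.mem_nhds (ex.symm ▸ hx))
  have v1 : (fun s => T.onFunction u (s, T.ε * T.k * x + T.k₂)) =ᶠ[nhds (T.k * t + T.k₁)]
      fun s => (fun s => T.X x * u (s, x)) ((s - T.k₁) / T.k) := by
    filter_upwards [n1] with s hs
    simp only [onFunction, ex, hY _ hs _ hx, add_zero]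
  have v2 : (fun y => T.onFunction u (T.k * t + T.k₁, y)) =ᶠ[nhds (T.ε * T.k * x + T.k₂)]
      fun y => ψ ((y - T.k₂) / (T.ε * T.k)) := by
    filter_upwards [n2] with y hy
    simp only [onFunction, et, hY _ ht _ hy, add_zero, hψ]
  have X1 := fun y (hy : y ∈ R.I) => R.hasDerivAt_of_contDiffOn T.smooth_X hy
  have X2 := R.hasDerivAt_of_contDiffOn (R.contDiffOn_deriv T.smooth_X) hx
  have U1 : ∀ y, HasDerivAt (fun y => u (t, y)) (deriv (fun y => u (t, y)) y) y := fun y =>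
    (ux.differentiable (by simp) y).hasDerivAt
  have U2 : HasDerivAt (deriv fun y => u (t, y)) (deriv (deriv fun y => u (t, y)) x) x :=
    (((contDiff_infty_iff_deriv.1 ux).2).differentiable (by simp) x).hasDerivAt
  have ψ1 : ∀ y ∈ R.I, HasDerivAt ψ (deriv T.X y * u (t, y)
      + T.X y * deriv (fun y => u (t, y)) y) y := fun y hy => (X1 y hy).mul (U1 y)
  have ψ2 : deriv (deriv ψ) x = deriv (deriv T.X) x * u (t, x)
      + 2 * deriv T.X x * deriv (fun y => u (t, y)) x
      + T.X x * deriv (deriv fun y => u (t, y)) x := by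
    have he : deriv ψ =ᶠ[nhds x] fun y => deriv T.X y * u (t, y)
        + T.X y * deriv (fun y => u (t, y)) y := by
      filter_upwards [R.isOpen_I.mem_nhds hx] with y hy using (ψ1 y hy).deriv
    rw [he.deriv_eq]
    refine ((X2.mul (U1 x)).add ((X1 x hx).mul U2)).deriv.trans ?_
    ring
  have w0 : T.onFunction u (T.k * t + T.k₁, T.ε * T.k * x + T.k₂) = T.X x * u (t, x) := by
    simpa only [et] using v1.eq_of_nhds
  have w1 : iteratedDeriv 2 (fun s => T.onFunction u (s, T.ε * T.k * x + T.k₂)) (T.k * t + T.k₁)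
      = T.X x * iteratedDeriv 2 (fun s => u (s, x)) t / T.k ^ 2 := by
    rw [v1.iteratedDeriv_eq, iteratedDeriv_comp_affine (fun s => T.X x * u (s, x)), et, iteratedDeriv_const_mul_field]
  have w2 : iteratedDeriv 2 (fun y => T.onFunction u (T.k * t + T.k₁, y)) (T.ε * T.k * x + T.k₂)
      = deriv (deriv ψ) x / T.k ^ 2 := by
    rw [v2.iteratedDeriv_eq, iteratedDeriv_comp_affine, ex, iteratedDeriv_two, mul_pow, ε2, one_mul]
  have w3 : deriv (fun y => T.onFunction u (T.k * t + T.k₁, y)) (T.ε * T.k * x + T.k₂)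
      = deriv ψ x / (T.ε * T.k) := by
    rw [v2.deriv_eq, deriv_comp_affine, ex]
  rw [SolvesAt, w0, w1, w2, w3, ψ2, (ψ1 x hx).deriv, iteratedDeriv_two (fun y => u (t, y)),
    div_add' _ _ _ (pow_ne_zero 2 hk), div_left_inj' (pow_ne_zero 2 hk), mul_comm _ (T.k ^ 2)]

end Transformation

lemma log_abs_mul {a b : ℝ} (ha : a ≠ 0) (hb : b ≠ 0) :
    Real.log |a * b| = Real.log |a| + Real.log |b| := by
  rw [abs_mul, Real.log_mul (abs_ne_zero.2 ha) (abs_ne_zero.2 hb)]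

/-- A transformation of the equations given by a relation of the coefficients. -/
lemma CoeffRel.equivalent {k k₁ k₂ ε : ℝ} {g : ℝ → ℝ} (C : CoeffRel E E' k k₁ k₂ ε g)
    (hU : R'.U = R.U) : Equivalent E E' := by
  have hpos : ∀ x, 0 < Real.exp (g x) := fun x => Real.exp_pos _
  let T : Transformation R := ⟨k, k₁, k₂, ε, fun x => Real.exp (g x), fun _ => 0, C.k_ne, C.ε_eq,
    C.smooth.exp, fun x _ => (hpos x).ne', contDiffOn_const⟩
  have hmul : ∀ {a u : ℝ}, 0 < a → (u ∈ R.U → a * u ∈ R.U) := by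
    intro a u ha hu
    rcases R.U_eq with h | h <;> rw [h] at hu ⊢
    exacts [mul_pos ha hu, mul_neg_of_pos_of_neg ha hu]
  refine ⟨T, ?_, fun u hu t x hz => ?_⟩
  · ext ⟨s, y, v⟩
    constructor
    · rintro ⟨⟨t, x, u⟩, hz, he⟩
      obtain ⟨ht, hx, hu⟩ := Region.mem_Ω.1 hz
      simp only [Transformation.onPoint, Prod.mk.injEq, T, add_zero] at he
      obtain ⟨rfl, rfl, rfl⟩ := he
      exact Region.mem_Ω.2 ⟨C.mem_J ht, C.mem_I hx, hU ▸ hmul (hpos x) hu⟩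
    · intro hz
      obtain ⟨hs, hy, hv⟩ := Region.mem_Ω.1 hz
      obtain ⟨t, ht, rfl⟩ := C.exists_J hs
      obtain ⟨x, hx, rfl⟩ := C.exists_I hy
      refine ⟨(t, x, (Real.exp (g x))⁻¹ * v), Region.mem_Ω.2 ⟨ht, hx,
        hmul (inv_pos.2 (hpos x)) (hU ▸ hv)⟩, ?_⟩
      simp only [Transformation.onPoint, T, add_zero, Prod.mk.injEq, true_and]
      rw [mul_inv_cancel_left₀ (hpos x).ne']
  · obtain ⟨ht, hx, hu0⟩ := Region.mem_Ω.1 hz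
    replace hu0 := Region.ne_zero_of_mem_U hu0
    rw [T.solvesAt_onFunction_iff (fun _ _ _ _ => rfl) E'.F hu ht hx, SolvesAt]
    set a := iteratedDeriv 2 (fun s => u (s, x)) t
    set c := iteratedDeriv 2 (fun y => u (t, y)) x
    set q := deriv (fun y => u (t, y)) x
    set w := u (t, x)
    have g1 := fun y (hy : y ∈ R.I) => R.hasDerivAt_of_contDiffOn C.smooth hy
    have g2 := R.hasDerivAt_of_contDiffOn (R.contDiffOn_deriv C.smooth) hx
    have X1 : ∀ y ∈ R.I, HasDerivAt T.X (Real.exp (g y) * deriv g y) y := fun y hy => (g1 y hy).exp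
    have X2 : deriv (deriv T.X) x
        = Real.exp (g x) * (deriv g x ^ 2 + deriv (deriv g) x) := by
      have he : deriv T.X =ᶠ[nhds x] fun y => Real.exp (g y) * deriv g y := by
        filter_upwards [R.isOpen_I.mem_nhds hx] with y hy using (X1 y hy).deriv
      rw [he.deriv_eq]
      refine ((g1 x hx).exp.mul g2).deriv.trans ?_
      ring
    have hX : T.X x = Real.exp (g x) := rfl
    have hεk := C.εk_ne
    have hk := C.k_ne
    have hε : ε ≠ 0 := left_ne_zero_of_mul hεk
    have ε2 := C.ε_sq
    -- For `v = e^g u` the terms `2 g' u_x` and `g'² u` of `v_xx` cancel against those of `-v⁻¹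
    -- v_x²`, and `ln|v| = ln|u| + g`. What is left beyond the rescaled equation is `e^g u L g`.
    have key : deriv (deriv T.X) x * w + 2 * deriv T.X x * q + T.X x * c
        + T.k ^ 2 * E'.F (T.k * t + T.k₁, T.ε * T.k * x + T.k₂, T.X x * w,
            (deriv T.X x * w + T.X x * q) / (T.ε * T.k))
        = Real.exp (g x) * (c + E.F (t, x, w, q)) := by
      rw [X2, (X1 x hx).deriv, hX]
      simp only [Equation.F, T, log_abs_mul (hpos x).ne' hu0, Real.abs_exp, Real.log_exp]
      rw [C.eqA x hx, C.eqB x hx, C.eqD t ht x hx, Equation.L, C.eqA x hx, C.eqB x hx]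
      have hp := (hpos x).ne'
      generalize Real.exp (g x) = X at *
      field_simp
      rw [show ε ^ 2 = 1 from ε2] 
      ring
    rw [key, hX, mul_right_inj' (hpos x).ne']

/-- A map `y ↦ a y + b` between half-lines ending at `0` that is onto has `b = 0`. -/
lemma eq_zero_of_halfLines {U U' : Set ℝ} {s s' a b : ℝ} (hs : |s| = 1) (hs' : |s'| = 1)
    (hU : ∀ w, w ∈ U ↔ 0 < s * w) (hU' : ∀ w, w ∈ U' ↔ 0 < s' * w)
    (h : ∀ w ∈ U, a * w + b ∈ U') (h' : ∀ v ∈ U', ∃ w ∈ U, a * w + b = v) : b = 0 := by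
  have e : s * s = 1 := by rw [← abs_mul_abs_self, hs, one_mul]
  have e' : s' * s' = 1 := by rw [← abs_mul_abs_self, hs', one_mul]
  have hpos : ∀ y, 0 < y → 0 < s' * (a * (s * y) + b) := fun y hy =>
    (hU' _).1 (h _ ((hU _).2 (by rwa [← mul_assoc, e, one_mul])))
  -- With the signs `s`, `s'` both half-lines become positive. A negative constant term fails for
  -- small arguments and a negative slope for large ones; if the constant term is positive, values
  -- below it are not attained.
  have h1 : 0 ≤ s' * b := by
    by_contra hcon
    push Not at hcon
    have h1 := hpos 1 one_pos
    have hc : 0 < s' * (a * s) := by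
      have : s' * (a * (s * 1) + b) = s' * (a * s) + s' * b := by ring
      linarith
    have h2 := hpos (-(s' * b) / (2 * (s' * (a * s)))) (by apply div_pos <;> linarith)
    have : s' * (a * (s * (-(s' * b) / (2 * (s' * (a * s))))) + b) = s' * b / 2 := by
      have h3 : s' * (a * s) * (-(s' * b) / (2 * (s' * (a * s)))) = -(s' * b) / 2 := by
        have := hc.ne'
        generalize s' * (a * s) = r at *
        field_simp
      linear_combination h3
    linarith
  have h2 : 0 ≤ s' * (a * s) := by
    by_contra hcon
    push Not at hcon
    have h2 := hpos ((s' * b + 1) / -(s' * (a * s))) (div_pos (by linarith) (by linarith))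
    have h3 : s' * (a * s) * ((s' * b + 1) / -(s' * (a * s))) = -(s' * b + 1) := by
      have := hcon.ne
      generalize s' * (a * s) = r at *
      field_simp
    have : s' * (a * (s * ((s' * b + 1) / -(s' * (a * s)))) + b) = -1 := by
      linear_combination h3
    linarith
  rcases h1.lt_or_eq with h1 | h1
  · obtain ⟨w, hw, hv⟩ := h' (s' * (s' * b / 2)) ((hU' _).2 (by rw [← mul_assoc, e', one_mul]; linarith))
    have hw' := (hU _).1 hw
    have h3 : s' * (a * s) * (s * w) = s' * b / 2 - s' * b := by
      linear_combination s' * hv + (s' * b / 2) * e' + s' * a * w * e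
    have := mul_nonneg h2 hw'.le
    linarith
  · have : b = s' * (s' * b) := by rw [← mul_assoc, e', one_mul]
    rw [this, ← h1, mul_zero]

lemma Region.exists_mem_U_iff (R : Region) : ∃ s : ℝ, |s| = 1 ∧ ∀ w, w ∈ R.U ↔ 0 < s * w := by
  rcases R.U_eq with h | h
  · exact ⟨1, by simp, fun w => by simp [h]⟩
  · exact ⟨-1, by simp, fun w => by simp [h]⟩

/-- For fixed `(t, x)` the map `u ↦ X u + Y` carries a half-line ending at `0` onto another one, so
`Y = 0`. The pointwise condition, tested on functions with arbitrary value and slope at the point,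
becomes an identity in `w = u` and `q = u_x`. Comparing the parts in `w ln|w|`, `w` and `q` gives
the relations with `g = ln|X|`. -/
theorem Equivalent.exists_coeffRel (h : Equivalent E E') :
    ∃ k k₁ k₂ ε g, CoeffRel E E' k k₁ k₂ ε g := by
  obtain ⟨T, hΩ, hT⟩ := h
  obtain ⟨t₀, ht₀⟩ := R.nonempty_J
  obtain ⟨x₀, hx₀⟩ := R.nonempty_I
  obtain ⟨s, -, hs⟩ := R.exists_sign
  obtain ⟨t₀', ht₀'⟩ := R'.nonempty_J
  obtain ⟨x₀', hx₀'⟩ := R'.nonempty_I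
  obtain ⟨s', -, hs'⟩ := R'.exists_sign
  have hu₀ := hs 1 one_pos
  have hu₀' := hs' 1 one_pos
  have hk := T.k_ne
  have hε := T.ε_ne
  have hεk : T.ε * T.k ≠ 0 := mul_ne_zero hε hk
  have ε2 : T.ε ^ 2 = 1 := by rcases T.ε_eq with h | h <;> rw [h] <;> norm_num
  have hmap : ∀ t ∈ R.J, ∀ x ∈ R.I, ∀ u ∈ R.U, T.k * t + T.k₁ ∈ R'.J ∧
      T.ε * T.k * x + T.k₂ ∈ R'.I ∧ T.X x * u + T.Y (t, x) ∈ R'.U := fun t ht x hx u hu => by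
    have : T.onPoint (t, x, u) ∈ R'.Ω := hΩ ▸ mem_image_of_mem _ (Region.mem_Ω.2 ⟨ht, hx, hu⟩)
    exact Region.mem_Ω.1 this
  have hsurj : ∀ t ∈ R'.J, ∀ x ∈ R'.I, ∀ u ∈ R'.U, ∃ t₁ ∈ R.J, ∃ x₁ ∈ R.I, ∃ u₁ ∈ R.U,
      T.k * t₁ + T.k₁ = t ∧ T.ε * T.k * x₁ + T.k₂ = x ∧ T.X x₁ * u₁ + T.Y (t₁, x₁) = u := by
    intro t ht x hx u hu
    have : (t, x, u) ∈ T.onPoint '' R.Ω := hΩ ▸ Region.mem_Ω.2 ⟨ht, hx, hu⟩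
    obtain ⟨⟨t₁, x₁, u₁⟩, hz, he⟩ := this
    obtain ⟨h1, h2, h3⟩ := Region.mem_Ω.1 hz
    simp only [Transformation.onPoint, Prod.mk.injEq] at he
    exact ⟨t₁, h1, x₁, h2, u₁, h3, he⟩
  have hY : ∀ t ∈ R.J, ∀ x ∈ R.I, T.Y (t, x) = 0 := by
    intro t ht x hx
    obtain ⟨σ, hσ, hU⟩ := R.exists_mem_U_iff
    obtain ⟨σ', hσ', hU'⟩ := R'.exists_mem_U_iff
    refine eq_zero_of_halfLines hσ hσ' hU hU' (fun w hw => (hmap t ht x hx w hw).2.2)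
      fun v hv => ?_
    obtain ⟨h1, h2, -⟩ := hmap t ht x hx _ hu₀
    obtain ⟨t₁, ht₁, x₁, hx₁, u₁, hu₁, e1, e2, e3⟩ := hsurj _ h1 _ h2 v hv
    have e1' : t₁ = t := mul_left_cancel₀ hk (by linarith)
    have e2' : x₁ = x := mul_left_cancel₀ hεk (by linarith)
    subst e1' e2'
    exact ⟨u₁, hu₁, e3⟩
  have X1 := fun y (hy : y ∈ R.I) => R.hasDerivAt_of_contDiffOn T.smooth_X hy
  have g1 : ∀ y ∈ R.I, HasDerivAt (fun y => Real.log |T.X y|) (deriv T.X y / T.X y) y :=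
    fun y hy => by
      simpa only [Real.log_abs] using (X1 y hy).log (T.X_ne y hy)
  have g2 : ∀ x ∈ R.I, deriv (deriv fun y => Real.log |T.X y|) x
      = (deriv (deriv T.X) x * T.X x - deriv T.X x * deriv T.X x) / T.X x ^ 2 := fun x hx => by
    have he : (deriv fun y => Real.log |T.X y|) =ᶠ[nhds x] fun y => deriv T.X y / T.X y := by
      filter_upwards [R.isOpen_I.mem_nhds hx] with y hy using (g1 y hy).deriv
    rw [he.deriv_eq]
    exact ((R.hasDerivAt_of_contDiffOn (R.contDiffOn_deriv T.smooth_X) hx).div (X1 x hx)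
      (T.X_ne x hx)).deriv
  have jet : ∀ t ∈ R.J, ∀ x ∈ R.I, ∀ w ∈ R.U, ∀ q, T.X x * E.F (t, x, w, q) =
      deriv (deriv T.X) x * w + 2 * deriv T.X x * q + T.k ^ 2 *
        E'.F (T.k * t + T.k₁, T.ε * T.k * x + T.k₂, T.X x * w,
          (deriv T.X x * w + T.X x * q) / (T.ε * T.k)) := by
    intro t ht x hx w hw q
    set a := E.F (t, x, w, q)
    -- A polynomial with value `w`, slope `q` and `u_xx = 0` at the point, whose `u_tt = a` makes it
    -- satisfy `E` there.
    have hu : ContDiff ℝ ∞ fun y : ℝ × ℝ => w + q * (y.2 - x) + a * (y.1 - t) ^ 2 / 2 := by fun_prop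
    have e0 : w + q * (x - x) + a * (t - t) ^ 2 / 2 = w := by ring
    have dt : iteratedDeriv 2 (fun s => w + q * (x - x) + a * (s - t) ^ 2 / 2) t = a := by
      have h1 : (deriv fun s => w + q * (x - x) + a * (s - t) ^ 2 / 2) = fun s => a * (s - t) := by
        funext s
        exact (((((hasDerivAt_id s).sub_const t).pow 2).const_mul a).div_const 2).const_add
          (w + q * (x - x)) |>.deriv.trans (by simp; ring)
      rw [iteratedDeriv_two, h1]
      exact (((hasDerivAt_id t).sub_const t).const_mul a).deriv.trans (mul_one a)
    have dx : (deriv fun y => w + q * (y - x) + a * (t - t) ^ 2 / 2) = fun _ => q := by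
      funext y
      exact ((((hasDerivAt_id y).sub_const x).const_mul q).const_add w).add_const
        (a * (t - t) ^ 2 / 2) |>.deriv.trans (mul_one q)
    have := (T.solvesAt_onFunction_iff hY E'.F hu ht hx).1
      ((hT _ hu t x (Region.mem_Ω.2 ⟨ht, hx, by rwa [e0]⟩)).1 ?_)
    · rw [e0, dt, iteratedDeriv_two, dx, deriv_const] at this
      linear_combination this
    · rw [SolvesAt, e0, dt, iteratedDeriv_two, dx, deriv_const, zero_add]
  have hBD : ∀ t ∈ R.J, ∀ x ∈ R.I, _ ∧ _ := fun t ht x hx => R.eq_zero_of_log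
    (α := E.B x - T.k ^ 2 * E'.B (T.ε * T.k * x + T.k₂))
    (β := E.D (t, x) - (deriv (deriv T.X) x * T.X x - deriv T.X x * deriv T.X x) / T.X x ^ 2
      - T.ε * T.k * E'.A (T.ε * T.k * x + T.k₂) * (deriv T.X x / T.X x)
      - T.k ^ 2 * E'.B (T.ε * T.k * x + T.k₂) * Real.log |T.X x|
      - T.k ^ 2 * E'.D (T.k * t + T.k₁, T.ε * T.k * x + T.k₂)) fun w hw => by
    have hX := T.X_ne x hx
    have hw0 := Region.ne_zero_of_mem_U hw
    have := jet t ht x hx w hw 0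
    simp only [Equation.F, log_abs_mul hX hw0] at this
    field_simp at this ⊢
    simp only [ε2] at this ⊢
    refine mul_left_cancel₀ hw0 ?_
    linear_combination this
  have hA : ∀ x ∈ R.I, E.A x = T.ε * T.k * E'.A (T.ε * T.k * x + T.k₂) := by
    intro x hx
    have hX := T.X_ne x hx
    have hw0 := Region.ne_zero_of_mem_U hu₀
    have j0 := jet t₀ ht₀ x hx _ hu₀ 0
    have j1 := jet t₀ ht₀ x hx _ hu₀ 1
    simp only [Equation.F] at j0 j1
    generalize E'.B (T.ε * T.k * x + T.k₂) * (T.X x * (s * 1)) * Real.log |T.X x * (s * 1)| = r at *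
    generalize Real.log |s * 1| = r' at *
    generalize s * 1 = w at *
    field_simp at j0 j1
    simp only [ε2] at j0 j1
    refine mul_left_cancel₀ (mul_ne_zero (pow_ne_zero 2 hX) hw0) ?_
    rw [mul_comm T.ε T.k]
    linear_combination j1 - j0
  refine ⟨T.k, T.k₁, T.k₂, T.ε, fun x => Real.log |T.X x|, hk, T.ε_eq, ?_, ?_, ?_, hA,
    fun x hx => by linarith [(hBD t₀ ht₀ x hx).1], fun t ht x hx => ?_⟩
  · simp only [Real.log_abs]
    exact T.smooth_X.log T.X_ne
  · refine Subset.antisymm (image_subset_iff.2 fun t ht => (hmap t ht x₀ hx₀ _ hu₀).1) fun t ht => ?_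
    obtain ⟨t₁, h1, -, -, -, -, e, -⟩ := hsurj t ht x₀' hx₀' _ hu₀'
    exact ⟨t₁, h1, e⟩
  · refine Subset.antisymm (image_subset_iff.2 fun x hx => (hmap t₀ ht₀ x hx _ hu₀).2.1)
      fun x hx => ?_
    obtain ⟨-, -, x₁, h1, -, -, -, e, -⟩ := hsurj t₀' ht₀' x hx _ hu₀'
    exact ⟨x₁, h1, e⟩
  · obtain ⟨h1, h2⟩ := hBD t ht x hx
    rw [Equation.L, g2 x hx, (g1 x hx).deriv, hA x hx]
    linear_combination h2 - Real.log |T.X x| * h1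

lemma ordConnected_image_affine {S : Set ℝ} (hS : S.OrdConnected) (a b : ℝ) :
    ((fun t => a * t + b) '' S).OrdConnected :=
  (hS.convex.isPreconnected.image _ (by fun_prop)).ordConnected

lemma isOpen_image_affine {S : Set ℝ} (hS : IsOpen S) {a : ℝ} (ha : a ≠ 0) (b : ℝ) :
    IsOpen ((fun t => a * t + b) '' S) := by
  have h : (fun t => a * t + b) '' S = (fun y => (y - b) / a) ⁻¹' S := by
    ext y
    constructor
    · rintro ⟨t, ht, rfl⟩
      simpa [ha] using ht
    · intro hy
      exact ⟨_, hy, by field_simp; ring⟩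
  rw [h]
  exact hS.preimage (by fun_prop)

/-- Every transformation of the group with `Y = 0` can be applied to every equation. -/
lemma exists_coeffRel (E : Equation R) {k : ℝ} (hk : k ≠ 0) (k₁ k₂ : ℝ) {ε : ℝ}
    (hε : ε = 1 ∨ ε = -1) {g : ℝ → ℝ} (hg : ContDiffOn ℝ ∞ g R.I) :
    ∃ (R' : Region) (E' : Equation R'), R'.U = R.U ∧ CoeffRel E E' k k₁ k₂ ε g := by
  have ε2 : ε ^ 2 = 1 := by rcases hε with h | h <;> rw [h] <;> norm_num
  have hεk : ε * k ≠ 0 := mul_ne_zero (by rintro rfl; norm_num at ε2) hk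
  have et : ∀ t, (k * t + k₁ - k₁) / k = t := fun t => by field_simp; ring
  have ex : ∀ x, (ε * k * x + k₂ - k₂) / (ε * k) = x := fun x => by
    rw [add_sub_cancel_right, mul_div_cancel_left₀ _ hεk]
  let R' : Region := ⟨(fun t => k * t + k₁) '' R.J, (fun x => ε * k * x + k₂) '' R.I, R.U,
    isOpen_image_affine R.isOpen_J hk k₁, ordConnected_image_affine R.ordConnected_J k k₁,
    R.nonempty_J.image _, isOpen_image_affine R.isOpen_I hεk k₂,
    ordConnected_image_affine R.ordConnected_I (ε * k) k₂, R.nonempty_I.image _, R.U_eq⟩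
  have mJ : ∀ s ∈ R'.J, (s - k₁) / k ∈ R.J := by
    rintro _ ⟨t, ht, rfl⟩
    simpa only [et] using ht
  have mI : ∀ y ∈ R'.I, (y - k₂) / (ε * k) ∈ R.I := by
    rintro _ ⟨x, hx, rfl⟩
    simpa only [ex] using hx
  let E' : Equation R' :=
    { A := fun y => E.A ((y - k₂) / (ε * k)) / (ε * k)
      B := fun y => E.B ((y - k₂) / (ε * k)) / k ^ 2
      D := fun y => (E.D ((y.1 - k₁) / k, (y.2 - k₂) / (ε * k))
        - E.L g ((y.2 - k₂) / (ε * k))) / k ^ 2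
      smooth_A := (E.smooth_A.comp (by fun_prop) mI).div_const _
      smooth_B := (E.smooth_B.comp (by fun_prop) mI).div_const _
      smooth_D := ((E.smooth_D.comp (g := E.D)
          (f := fun y : ℝ × ℝ => ((y.1 - k₁) / k, (y.2 - k₂) / (ε * k))) (by fun_prop)
          fun y hy => ⟨mJ _ hy.1, mI _ hy.2⟩).sub
        ((CoeffRel.contDiffOn_L hg).comp (f := fun y : ℝ × ℝ => (y.2 - k₂) / (ε * k)) (by fun_prop)
          fun y hy => mI _ hy.2)).div_const _ }
  refine ⟨R', E', rfl, hk, hε, hg, rfl, rfl, fun x hx => ?_, fun x hx => ?_, fun t ht x hx => ?_⟩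
  · simp only [E', ex]
    rw [mul_div_cancel₀ _ hεk]
  · simp only [E', ex]
    rw [mul_div_cancel₀ _ (pow_ne_zero 2 hk)]
  · simp only [E', ex, et]
    rw [mul_div_cancel₀ _ (pow_ne_zero 2 hk)]
    ring

end Equivalence

/-! ### Invariance of dimension and type under equivalence -/

section Classification

variable {R R' : Region} {E : Equation R} {E' : Equation R'}

namespace CoeffRel

variable {k k₁ k₂ ε : ℝ} {g : ℝ → ℝ}

lemma symm (C : CoeffRel E E' k k₁ k₂ ε g) :
    CoeffRel E' E k⁻¹ (-(k₁ / k)) (-(k₂ / (ε * k))) ε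
      (fun y => -g (ε * k⁻¹ * y + -(k₂ / (ε * k)))) := by
  have hk := C.k_ne
  have hεk := C.εk_ne
  have ε2 := C.ε_sq
  have hε : ε ≠ 0 := left_ne_zero_of_mul hεk
  have hinv : ε * k⁻¹ = (ε * k)⁻¹ := by
    field_simp; exact ε2
  have et : ∀ t, k⁻¹ * (k * t + k₁) + -(k₁ / k) = t := fun t => by field_simp; ring
  have ex : ∀ x, ε * k⁻¹ * (ε * k * x + k₂) + -(k₂ / (ε * k)) = x := fun x => by
    rw [hinv, mul_add, inv_mul_cancel_left₀ hεk]; ring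
  have hI : (fun y => ε * k⁻¹ * y + -(k₂ / (ε * k))) '' R'.I = R.I := by
    rw [← C.image_I, image_image]
    simp only [ex, image_id']
  have hA : ∀ x ∈ R.I, E'.A (ε * k * x + k₂) = ε * k⁻¹ * E.A x := fun x hx => by
    rw [C.eqA x hx, hinv, inv_mul_cancel_left₀ hεk]
  have hB : ∀ x ∈ R.I, E'.B (ε * k * x + k₂) = k⁻¹ ^ 2 * E.B x := fun x hx => by
    rw [C.eqB x hx]; field_simp
  have hmem : ∀ y ∈ R'.I, ε * k⁻¹ * y + -(k₂ / (ε * k)) ∈ R.I := fun y hy => by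
    rw [← hI]; exact mem_image_of_mem _ hy
  have hg : ContDiffOn ℝ ∞ (fun y => -g (ε * k⁻¹ * y + -(k₂ / (ε * k)))) R'.I :=
    (C.smooth.comp (by fun_prop) hmem).neg
  refine ⟨inv_ne_zero hk, C.ε_eq, hg, ?_, hI, fun y hy => ?_, fun y hy => ?_, fun t ht y hy => ?_⟩
  · rw [← C.image_J, image_image]
    simp only [et, image_id']
  · obtain ⟨x, hx, rfl⟩ := C.exists_I hy
    rw [ex, hA x hx]
  · obtain ⟨x, hx, rfl⟩ := C.exists_I hy
    rw [ex, hB x hx]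
  · obtain ⟨x, hx, rfl⟩ := C.exists_I hy
    obtain ⟨t, ht', rfl⟩ := C.exists_J ht
    have h1 := C.hasDerivAt_comp hg hx
    have h2 := C.deriv_deriv_comp hg hx
    simp only [ex] at h1 h2
    have e1 := h1.unique (R.hasDerivAt_of_contDiffOn C.smooth hx).neg
    have e2 : deriv (deriv fun x => -g x) x = -deriv (deriv g) x := by
      have : (deriv fun x => -g x) = fun x => -deriv g x := by funext x; exact deriv.fun_neg
      rw [this, deriv.fun_neg]
    rw [e2] at h2
    rw [et, ex, Equation.L, hA x hx, hB x hx, ex, C.eqD t ht' x hx, Equation.L]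
    have e3 : ∀ z, k ^ 2 * z = 0 → z = 0 := fun z hz =>
      (mul_eq_zero.1 hz).resolve_left (pow_ne_zero 2 hk)
    rw [← sub_eq_zero]
    apply e3
    have hkk : k * k⁻¹ = 1 := mul_inv_cancel₀ hk
    field_simp at e1 h2 ⊢
    linear_combination h2 - E.A x * e1

/-- Symmetries are pushed forward through the inverse relation. The function `h'` is constrained
only on the image interval, so a gauge with `h + (l x + l₂) g' = 0` allows `h' = 0`. -/
lemma det_push (C : CoeffRel E E' k k₁ k₂ ε g) {l l₁ l₂ : ℝ} {h h' : ℝ → ℝ}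
    (hd : Det E l l₁ l₂ h)
    (hh : ∀ x ∈ R.I, h' (ε * k * x + k₂) = h x + (l * x + l₂) * deriv g x) :
    Det E' l (k * l₁ - l * k₁) (ε * k * l₂ - l * k₂) h' := by
  have hk := C.k_ne
  have hεk := C.εk_ne
  have ε2 := C.ε_sq
  have hε : ε ≠ 0 := left_ne_zero_of_mul hεk
  have hinv : ε * k⁻¹ = (ε * k)⁻¹ := by
    field_simp; exact ε2
  have ex : ∀ x, ε * k⁻¹ * (ε * k * x + k₂) + -(k₂ / (ε * k)) = x := fun x => by
    rw [hinv, mul_add, inv_mul_cancel_left₀ hεk]; ring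
  refine (C.symm.det hd (l₁ := k * l₁ - l * k₁) (l₂ := ε * k * l₂ - l * k₂) ?_ ?_).congr
    fun y hy => ?_
  · field_simp; ring
  · rw [hinv]; field_simp; ring
  · obtain ⟨x, hx, rfl⟩ := C.exists_I hy
    have h1 := C.hasDerivAt_comp C.symm.smooth hx
    simp only [ex] at h1
    have e1 := h1.unique (R.hasDerivAt_of_contDiffOn C.smooth hx).neg
    rw [ex, hh x hx]
    linear_combination (l * x + l₂) * e1

end CoeffRel

/-- Modulo the two-dimensional space of operators `h u ∂_u` with `L h = 0`, a symmetry is determined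
by `(l, l₁, l₂)`. Dimension three therefore means that these vectors fill exactly one line. -/
lemma finrank_eq_three_iff : Module.finrank ℝ E.maxAlg = 3 ↔
    ∃ l l₁ l₂ h, Det E l l₁ l₂ h ∧ (l ≠ 0 ∨ l₁ ≠ 0 ∨ l₂ ≠ 0) ∧
      ∀ q q₁ q₂ k, Det E q q₁ q₂ k → ∃ α, q = α * l ∧ q₁ = α * l₁ ∧ q₂ = α * l₂ := by
  obtain ⟨f, g, hfg⟩ := exists_invariantForm E
  obtain ⟨hf, hg, hw⟩ := invariantForm_iff.1 hfg
  obtain ⟨x₀, hx₀⟩ := R.nonempty_I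
  have hw' : ∃ x ∈ R.I, wr f g x ≠ 0 := ⟨x₀, hx₀, hw x₀ hx₀⟩
  constructor
  · intro hE
    obtain ⟨l, l₁, l₂, h, hd, hne⟩ := exists_det_of_finrank hE hfg
    refine ⟨l, l₁, l₂, h, hd, hne, fun q q₁ q₂ k hk => ?_⟩
    have hs : tripleSpan R l l₁ l₂ h f g = E.maxAlg :=
      span_triple_eq (R.linearIndependent_op_first hne hf.smooth hg.smooth hw') hE
        hd.mem_maxAlg hf.mem_maxAlg hg.mem_maxAlg
    obtain ⟨α, β, γ, e1, e2, e3, -⟩ := mem_tripleSpan.1 (hs ▸ hk.mem_maxAlg)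
    exact ⟨α, e1, e2, e3⟩
  · rintro ⟨l, l₁, l₂, h, hd, hne, H⟩
    have hs : E.maxAlg = tripleSpan R l l₁ l₂ h f g := by
      refine le_antisymm (fun v hv => ?_) (Submodule.span_le.2 ?_)
      · obtain ⟨q, q₁, q₂, k, hk, rfl⟩ := mem_maxAlg_iff.1 hv
        obtain ⟨α, rfl, rfl, rfl⟩ := H _ _ _ _ hk
        have h0 := hd.comb hk (-α)
        have e : ∀ z, -α * z + α * z = 0 := fun z => by ring
        rw [e, e, e] at h0
        obtain ⟨β, γ, hβγ⟩ := hfg.exists_comb h0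
        exact mem_tripleSpan.2 ⟨α, β, γ, rfl, rfl, rfl, fun x hx => by linarith [hβγ x hx]⟩
      · rintro v (rfl | rfl | rfl)
        exacts [hd.mem_maxAlg, hf.mem_maxAlg, hg.mem_maxAlg]
    rw [hs]
    exact finrank_span_triple (R.linearIndependent_op_first hne hf.smooth hg.smooth hw')

lemma Det.proportional (hE : Module.finrank ℝ E.maxAlg = 3) {l l₁ l₂ q q₁ q₂ : ℝ} {h k : ℝ → ℝ}
    (hd : Det E l l₁ l₂ h) (hne : l ≠ 0 ∨ l₁ ≠ 0 ∨ l₂ ≠ 0) (hd' : Det E q q₁ q₂ k) :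
    ∃ α, q = α * l ∧ q₁ = α * l₁ ∧ q₂ = α * l₂ := by
  obtain ⟨r, r₁, r₂, -, -, -, H⟩ := finrank_eq_three_iff.1 hE
  obtain ⟨α, rfl, rfl, rfl⟩ := H _ _ _ _ hd
  obtain ⟨β, rfl, rfl, rfl⟩ := H _ _ _ _ hd'
  have hα : α ≠ 0 := by rintro rfl; simp at hne
  exact ⟨β / α, by field_simp, by field_simp, by field_simp⟩

/-- The vectors `(l, l₁, l₂)` of the two equations correspond under an invertible linear map, which
takes lines to lines. -/
lemma CoeffRel.finrank_eq {k k₁ k₂ ε : ℝ} {g : ℝ → ℝ} (C : CoeffRel E E' k k₁ k₂ ε g)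
    (hE : Module.finrank ℝ E.maxAlg = 3) : Module.finrank ℝ E'.maxAlg = 3 := by
  obtain ⟨l, l₁, l₂, h, hd, hne, H⟩ := finrank_eq_three_iff.1 hE
  have hk := C.k_ne
  have hεk := C.εk_ne
  have hd' := C.symm.det hd (l₁ := k * l₁ - l * k₁) (l₂ := ε * k * l₂ - l * k₂)
    (by field_simp; ring) (by
      have hε : ε ≠ 0 := left_ne_zero_of_mul hεk
      have hinv : ε * k⁻¹ = (ε * k)⁻¹ := by field_simp; exact C.ε_sq
      rw [hinv]; field_simp; ring)
  refine finrank_eq_three_iff.2 ⟨_, _, _, _, hd', ?_, fun q q₁ q₂ k' hq => ?_⟩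
  · by_contra hcon
    push Not at hcon
    obtain ⟨rfl, h1, h2⟩ := hcon
    simp only [zero_mul, sub_zero] at h1 h2
    rcases hne with h | h | h
    exacts [h rfl, h ((mul_eq_zero.1 h1).resolve_left hk), h ((mul_eq_zero.1 h2).resolve_left hεk)]
  · obtain ⟨α, e0, e1, e2⟩ := H _ _ _ _ (C.det hq (l₁ := (q₁ + q * k₁) / k)
      (l₂ := (q₂ + q * k₂) / (ε * k)) (by field_simp; ring)
      (by rw [mul_div_cancel₀ _ hεk]; ring))
    rw [div_eq_iff hk] at e1
    rw [div_eq_iff hεk] at e2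
    exact ⟨α, e0, by rw [e0] at e1; linear_combination e1, by rw [e0] at e2; linear_combination e2⟩

/-- An equation related to a listed one satisfies the conclusion of the classification. -/
lemma CoeffRel.classification {k k₁ k₂ ε : ℝ} {g : ℝ → ℝ} (C : CoeffRel E E' k k₁ k₂ ε g)
    (hU : R'.U = R.U) (hE : Module.finrank ℝ E.maxAlg = 3) {s : Item} {c : LieType}
    {e₁ e₂ e₃ : VF} (hL : Listed E' s c e₁ e₂ e₃) :
    ∃ (R' : Region) (E' : Equation R') (s : Item) (c : LieType) (e₁ e₂ e₃ : VF),
      Equivalent E E' ∧ Listed E' s c e₁ e₂ e₃ ∧ E'.maxAlg = Submodule.span ℝ {e₁, e₂, e₃} ∧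
        HasType E.maxAlg c := by
  obtain ⟨l, l₁, l₂, h, h₁, h₂, α, β, γ, δ, T, hs, -⟩ := hL.exists_triple
  refine ⟨R', E', s, c, e₁, e₂, e₃, C.equivalent hU, hL, hs ▸ T.maxAlg_eq (C.finrank_eq hE), ?_⟩
  have hk := C.k_ne
  have hεk := C.εk_ne
  have T' := C.triple (l₁ := (l₁ + l * k₁) / k) (l₂ := (l₂ + l * k₂) / (ε * k)) T
    (by field_simp; ring) (by rw [mul_div_cancel₀ _ hεk]; ring)
  rw [T'.maxAlg_eq hE]
  exact T'.hasType

end Classification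

/-! ### Reduction of the extra operator to normal form -/

section NormalForms

variable {R : Region} {E : Equation R}

lemma eq_of_hasDerivAt_zero {S : Set ℝ} (hS : IsOpen S) (hS' : S.OrdConnected) {φ : ℝ → ℝ}
    (h : ∀ x ∈ S, HasDerivAt φ 0 x) {x y : ℝ} (hx : x ∈ S) (hy : y ∈ S) : φ x = φ y :=
  hS.is_const_of_deriv_eq_zero hS'.convex.isPreconnected
    (fun x hx => (h x hx).differentiableAt.differentiableWithinAt) (fun x hx => (h x hx).deriv) hx hy

/-- The parameters of the points on a line that lie in `J × I`. -/
def Region.line (R : Region) (t x a b : ℝ) : Set ℝ := {s | t + s * a ∈ R.J ∧ x + s * b ∈ R.I}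

lemma Region.isOpen_line (R : Region) (t x a b : ℝ) : IsOpen (R.line t x a b) :=
  (R.isOpen_J.preimage (f := fun s : ℝ => t + s * a) (by fun_prop)).inter
    (R.isOpen_I.preimage (f := fun s : ℝ => x + s * b) (by fun_prop))

lemma Region.ordConnected_line (R : Region) (t x a b : ℝ) : (R.line t x a b).OrdConnected := by
  have h : ∀ {S : Set ℝ}, Convex ℝ S → ∀ t a : ℝ, Convex ℝ {s : ℝ | t + s * a ∈ S} := by
    intro S hS t a s hs s' hs' p q hp hq hpq
    have := hS hs hs' hp hq hpq
    simp only [smul_eq_mul, mem_ofPred_eq] at this ⊢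
    convert this using 1
    linear_combination -t * hpq
  exact ((h R.convex_J t a).inter (h R.convex_I x b)).ordConnected

lemma hasDerivAt_D_line {t x a b s : ℝ} (hs : s ∈ R.line t x a b) :
    HasDerivAt (fun s => E.D (t + s * a, x + s * b))
      (fderiv ℝ E.D (t + s * a, x + s * b) (a, b)) s :=
  (E.differentiableAt_D hs.1 hs.2).hasFDerivAt.comp_hasDerivAt s
    ((hasDerivAt_affine t a s).prodMk (hasDerivAt_affine x b s))

/-- A function that is constant on the fibres of `P` is a smooth function of `P` if it is one
locally. -/
lemma exists_factor {W : Set (ℝ × ℝ)} {P Q : ℝ × ℝ → ℝ} {T : Set ℝ}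
    (hPQ : ∀ z ∈ W, ∀ z' ∈ W, P z = P z' → Q z = Q z') (hT : ∀ y ∈ T, ∃ z ∈ W, P z = y)
    (hsec : ∀ z ∈ W, ∃ q : ℝ → ℝ, ContDiffAt ℝ ∞ q (P z) ∧
      ∀ᶠ y in nhds (P z), ∃ w ∈ W, P w = y ∧ Q w = q y) :
    ∃ G : ℝ → ℝ, ContDiffOn ℝ ∞ G T ∧ ∀ z ∈ W, Q z = G (P z) := by
  classical
  let G : ℝ → ℝ := fun y => if h : ∃ z ∈ W, P z = y then Q h.choose else 0
  have hG : ∀ z ∈ W, Q z = G (P z) := fun z hz => by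
    have h : ∃ w ∈ W, P w = P z := ⟨z, hz, rfl⟩
    simp only [G, dif_pos h]
    exact hPQ _ hz _ h.choose_spec.1 h.choose_spec.2.symm
  refine ⟨G, fun y hy => ?_, hG⟩
  obtain ⟨z, hz, rfl⟩ := hT y hy
  -- Near each value `G` agrees with the smooth function read off along a local section of `P`,
  -- whichever points were chosen on the fibres.
  obtain ⟨q, hq, he⟩ := hsec z hz
  refine (hq.congr_of_eventuallyEq ?_).contDiffWithinAt
  filter_upwards [he] with y ⟨w, hw, h1, h2⟩
  rw [← h1, ← hG w hw, h2, h1]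

lemma contDiffAt_D_comp {a b : ℝ → ℝ} {y : ℝ} (ha : ContDiff ℝ ∞ a) (hb : ContDiff ℝ ∞ b)
    (h : a y ∈ R.J) (h' : b y ∈ R.I) : ContDiffAt ℝ ∞ (fun y => E.D (a y, b y)) y :=
  (E.smooth_D.contDiffAt (R.isOpen_JI.mem_nhds ⟨h, h'⟩)).comp y
    (ha.prodMk hb).contDiffAt

lemma exists_eulerCase (n m : ℝ) : ∃ i ty h₁ h₂, EulerCase i n m ty h₁ h₂ := by
  rcases eq_or_ne m 0 with rfl | hm
  · rcases eq_or_ne n 1 with rfl | hn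
    exacts [⟨_, _, _, _, .c2⟩, ⟨_, _, _, _, .c1 n hn⟩]
  · rcases eq_or_ne n 1 with rfl | hn
    · rcases lt_or_gt_of_ne hm with h | h
      exacts [⟨_, _, _, _, .c7 m h⟩, ⟨_, _, _, _, .c6 m h⟩]
    · rcases eq_or_ne n 0 with rfl | hn0
      · rcases lt_trichotomy m (1 / 4) with h | rfl | h
        exacts [⟨_, _, _, _, .c5 m _ h hm rfl⟩, ⟨_, _, _, _, .c3⟩, ⟨_, _, _, _, .c4 m _ h rfl⟩]
      · rcases lt_trichotomy m (1 / 4 * (n - 1) ^ 2) with h | rfl | h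
        exacts [⟨_, _, _, _, .c10 n m _ hn0 hn h hm rfl⟩, ⟨_, _, _, _, .c8 n hn0 hn⟩,
          ⟨_, _, _, _, .c9 n m _ hn0 hn h rfl⟩]

/-- Scaling `x` by `κ` divides `n` by `κ` and `m` by `κ²`. For `n ≠ 0` the choice `κ = -n` gives `n
= -1`; for `n = 0` and `m ≠ 0` the choice `κ = √|m|` gives `m = ±1`. -/
lemma exists_constCase (n m : ℝ) :
    ∃ κ, κ ≠ 0 ∧ ∃ i ty h₁ h₂, ConstCase i (n / κ) (m / κ ^ 2) ty h₁ h₂ := by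
  rcases eq_or_ne n 0 with rfl | hn
  · rcases lt_trichotomy m 0 with h | rfl | h
    · have hs : √(-m) ≠ 0 := (Real.sqrt_pos.2 (by linarith)).ne'
      refine ⟨√(-m), hs, 4, .A36, Real.exp, fun x => Real.exp (-x), ?_⟩
      rw [Real.sq_sqrt (by linarith), zero_div, div_neg, div_self h.ne]
      exact .c4
    · refine ⟨1, one_ne_zero, 1, .A33, fun _ => 1, fun x => x, ?_⟩
      rw [zero_div, zero_div]
      exact .c1
    · have hs : √m ≠ 0 := (Real.sqrt_pos.2 h).ne'
      refine ⟨√m, hs, 3, .A38, Real.cos, Real.sin, ?_⟩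
      rw [Real.sq_sqrt h.le, zero_div, div_self h.ne']
      exact .c3
  · refine ⟨-n, neg_ne_zero.2 hn, ?_⟩
    rw [div_neg, div_self hn]
    generalize m / (-n) ^ 2 = r
    rcases eq_or_ne r 0 with rfl | hr
    · exact ⟨_, _, _, _, .c2⟩
    · rcases lt_trichotomy r (1 / 4) with h | rfl | h
      exacts [⟨_, _, _, _, .c6 r _ h hr rfl⟩, ⟨_, _, _, _, .c5⟩, ⟨_, _, _, _, .c7 r _ h rfl⟩]

/-- For `l = 1` the first determining equation is `((x + l₂) A)' = 0`. -/
lemma Det.const_mul_A {l₂ : ℝ} {h : ℝ → ℝ} {l₁ : ℝ} (hd : Det E 1 l₁ l₂ h) {x y : ℝ} (hx : x ∈ R.I)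
    (hy : y ∈ R.I) : (x + l₂) * E.A x = (y + l₂) * E.A y := by
  refine eq_of_hasDerivAt_zero R.isOpen_I R.ordConnected_I (φ := fun x => (x + l₂) * E.A x)
    (fun x hx => ?_) hx hy
  exact (((hasDerivAt_id x).add_const l₂).mul (E.differentiableAt_A hx).hasDerivAt).congr_deriv
    (by simp only [id]; linear_combination hd.eqA x hx)

lemma Det.const_mul_B {l₂ : ℝ} {h : ℝ → ℝ} {l₁ : ℝ} (hd : Det E 1 l₁ l₂ h) {x y : ℝ} (hx : x ∈ R.I)
    (hy : y ∈ R.I) : (x + l₂) ^ 2 * E.B x = (y + l₂) ^ 2 * E.B y := by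
  refine eq_of_hasDerivAt_zero R.isOpen_I R.ordConnected_I (φ := fun x => (x + l₂) ^ 2 * E.B x)
    (fun x hx => ?_) hx hy
  exact ((((hasDerivAt_id x).add_const l₂).pow 2).mul
    (E.differentiableAt_B hx).hasDerivAt).congr_deriv
    (by simp only [id, Pi.pow_apply]; push_cast; linear_combination (x + l₂) * hd.eqB x hx)

/-- The term `h u ∂_u` of an operator with a dilation part can be removed. -/
lemma Det.exists_gauge_dil {l₁ l₂ : ℝ} {h : ℝ → ℝ} (hd : Det E 1 l₁ l₂ h) :
    ∃ g h' : ℝ → ℝ, ContDiffOn ℝ ∞ g R.I ∧ Det E 1 l₁ l₂ h' ∧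
      ∀ x ∈ R.I, h' x + (x + l₂) * deriv g x = 0 := by
  have hgauge : ∀ h', Det E 1 l₁ l₂ h' → ∀ k, ContDiffOn ℝ ∞ k R.I →
      (∀ x ∈ R.I, h' x = (x + l₂) * k x) → ∃ g h' : ℝ → ℝ, ContDiffOn ℝ ∞ g R.I ∧
        Det E 1 l₁ l₂ h' ∧ ∀ x ∈ R.I, h' x + (x + l₂) * deriv g x = 0 := by
    intro h' hd' k hk hk'
    obtain ⟨g, hg, hg'⟩ := exists_primitive R.isOpen_I R.ordConnected_I hk.neg
    refine ⟨g, h', hg, hd', fun x hx => ?_⟩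
    rw [(hg' x hx).deriv, hk' x hx]
    ring
  -- The equation `h + (x + l₂) g' = 0` is singular at `x = -l₂`. If this point lies in `I`, the
  -- constants `(x + l₂) A` and `(x + l₂)² B` are zero, so `A = B = 0` and constants solve `L h =
  -- 0`. Subtracting `h(-l₂)` then makes `h` divisible by `x + l₂`.
  by_cases h0 : -l₂ ∈ R.I
  · have hA : ∀ x ∈ R.I, E.A x = 0 := fun x hx => by
      by_cases hx0 : x + l₂ = 0
      · have := hd.eqA x hx
        rw [one_mul, hx0] at this
        linarith
      · have := hd.const_mul_A hx h0
        rw [neg_add_cancel, zero_mul] at this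
        exact (mul_eq_zero.1 this).resolve_left hx0
    have hB : ∀ x ∈ R.I, E.B x = 0 := fun x hx => by
      by_cases hx0 : x + l₂ = 0
      · have := hd.eqB x hx
        rw [one_mul, hx0] at this
        linarith
      · have := hd.const_mul_B hx h0
        rw [neg_add_cancel, zero_pow two_ne_zero, zero_mul] at this
        exact (mul_eq_zero.1 this).resolve_left (pow_ne_zero 2 hx0)
    have hc : Det E 0 0 0 (fun _ => 1) :=
      det_zero_iff.2 ⟨contDiffOn_const, fun x hx => by simp [Equation.L, hB x hx]⟩
    have hd' := hc.comb hd (-h (-l₂))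
    simp only [mul_zero, zero_add, mul_one] at hd'
    obtain ⟨k, hk, hk'⟩ := exists_eq_sub_mul R.isOpen_I R.ordConnected_I h0 hd'.smooth (by ring)
    exact hgauge _ hd' k hk fun x hx => by rw [hk' x hx, sub_neg_eq_add]
  · have hne : ∀ x ∈ R.I, x + l₂ ≠ 0 := fun x hx hx0 => h0 (by rwa [← eq_neg_of_add_eq_zero_left hx0])
    refine hgauge h hd (fun x => h x / (x + l₂)) (hd.smooth.div (by fun_prop) hne) fun x hx => ?_
    rw [mul_div_cancel₀ _ (hne x hx)]

/-- Equations admitting `t ∂_t + x ∂_x`. -/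
lemma listed_of_dil (hE : Module.finrank ℝ E.maxAlg = 3) (hd : Det E 1 0 0 (fun _ => 0)) :
    ∃ s c e₁ e₂ e₃, Listed E s c e₁ e₂ e₃ := by
  obtain ⟨x₀, hx₀⟩ := R.nonempty_I
  obtain ⟨i, ty, h₁, h₂, hi⟩ := exists_eulerCase (x₀ * E.A x₀) (x₀ ^ 2 * E.B x₀)
  have hcA := fun x hx => hd.const_mul_A (x := x) (y := x₀) hx hx₀
  have hcB := fun x hx => hd.const_mul_B (x := x) (y := x₀) hx hx₀
  simp only [add_zero] at hcA hcB
  -- Euler's relation integrated along the line through the origin and `(t, x)`; the parameters with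
  -- points in `J × I` form an interval containing `1` and `r`.
  have hscale : ∀ t ∈ R.J, ∀ x ∈ R.I, ∀ r, r * t ∈ R.J → r * x ∈ R.I →
      r ^ 2 * E.D (r * t, r * x) = E.D (t, x) := by
    intro t ht x hx r hr hr'
    have := eq_of_hasDerivAt_zero (R.isOpen_line 0 0 t x) (R.ordConnected_line 0 0 t x)
      (φ := fun s => s ^ 2 * E.D (0 + s * t, 0 + s * x)) (x := r) (y := 1) (fun s hs => ?_)
      ⟨by simpa using hr, by simpa using hr'⟩ ⟨by simpa using ht, by simpa using hx⟩
    · simpa using this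
    · refine ((hasDerivAt_pow 2 s).mul (hasDerivAt_D_line hs)).congr_deriv ?_
      have e := hd.eqD _ hs.1 _ hs.2
      have e2 : ((1 * (0 + s * t) + 0, 1 * (0 + s * x) + 0) : ℝ × ℝ) = s • (t, x) := by
        simp
      rw [e2, map_smul, smul_eq_mul] at e
      simp only [deriv_const', deriv_const, mul_zero, zero_add] at e ⊢
      push_cast
      linear_combination s * e
  have hfactor : ∃ G : ℝ → ℝ,
      ContDiffOn ℝ ∞ G {y | ∃ t ∈ R.J, ∃ x ∈ R.I, x ≠ 0 ∧ y = t * x⁻¹} ∧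
      ∀ z ∈ {z : ℝ × ℝ | z.1 ∈ R.J ∧ z.2 ∈ R.I ∧ z.2 ≠ 0}, z.2 ^ 2 * E.D z = G (z.1 * z.2⁻¹) := by
    refine exists_factor (W := {z | z.1 ∈ R.J ∧ z.2 ∈ R.I ∧ z.2 ≠ 0})
      (P := fun z => z.1 * z.2⁻¹) (Q := fun z => z.2 ^ 2 * E.D z)
      (T := {y | ∃ t ∈ R.J, ∃ x ∈ R.I, x ≠ 0 ∧ y = t * x⁻¹}) ?_ ?_ ?_
    · rintro ⟨t, x⟩ ⟨ht, hx, hx0⟩ ⟨t', x'⟩ ⟨ht', hx', hx0'⟩ hp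
      simp only at ht hx hx0 ht' hx' hx0' hp ⊢
      have e1 : x' / x * t = t' := by
        field_simp at hp ⊢
        linarith
      have e2 : x' / x * x = x' := by field_simp
      have := hscale t ht x hx (x' / x) (by rwa [e1]) (by rwa [e2])
      rw [← this, e1, e2]
      field_simp
    · rintro y ⟨t, ht, x, hx, hx0, rfl⟩
      exact ⟨(t, x), ⟨ht, hx, hx0⟩, rfl⟩
    · rintro ⟨t, x⟩ ⟨ht, hx, hx0⟩
      simp only at ht hx hx0 ⊢
      have et : t * x⁻¹ * x = t := by field_simp
      refine ⟨fun y => x ^ 2 * E.D (y * x, x), contDiffAt_const.mul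
        (contDiffAt_D_comp (by fun_prop) (by fun_prop) (by rwa [et]) hx), ?_⟩
      have c : ContinuousAt (fun y : ℝ => y * x) (t * x⁻¹) := by fun_prop
      filter_upwards [c.preimage_mem_nhds (R.isOpen_J.mem_nhds (et.symm ▸ ht))] with y hy
      exact ⟨(y * x, x), ⟨hy, hx, hx0⟩, by field_simp, rfl⟩
  obtain ⟨G, hG, hDG⟩ := hfactor
  refine ⟨_, _, _, _, _, .III i _ _ ty h₁ h₂ G hi (fun x hx hx0 => ?_) (fun x hx hx0 => ?_) hG ?_
    fun t ht x hx hx0 => ?_⟩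
  · rw [← hcA x hx]; field_simp
  · rw [← hcB x hx]; field_simp
  · by_contra hcon
    push Not at hcon
    -- If `G` vanished, then `D = 0` and `∂_t` would be a symmetry in a second direction, against
    -- dimension three. This is the source of the condition `G ≢ 0`.
    have hD0 : ∀ t ∈ R.J, ∀ x ∈ R.I, E.D (t, x) = 0 := fun t ht =>
      R.eq_zero_of_ne (contDiffOn_D_snd ht).continuousOn fun x hx hx0 => by
        have := hDG (t, x) ⟨ht, hx, hx0⟩
        rw [hcon t ht x hx hx0] at this
        exact (mul_eq_zero.1 this).resolve_left (pow_ne_zero 2 hx0)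
    have hdt : Det E 0 1 0 (fun _ => 0) := det_dt (δ := fun _ => 0) contDiffOn_const
      fun t ht x hx => by simp [hD0 t ht x hx, Equation.L]
    obtain ⟨α, h0, h1, -⟩ := hd.proportional hE (.inl one_ne_zero) hdt
    simp at h1
  · rw [← hDG (t, x) ⟨ht, hx, hx0⟩]
    field_simp

/-- Equations admitting `∂_x`. -/
lemma listed_of_dx {n m : ℝ} {i : ℕ} {ty : LieType} {h₁ h₂ : ℝ → ℝ} (hi : ConstCase i n m ty h₁ h₂)
    (hA : ∀ x ∈ R.I, E.A x = n) (hB : ∀ x ∈ R.I, E.B x = m) (hd : Det E 0 0 1 (fun _ => 0)) :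
    ∃ s c e₁ e₂ e₃, Listed E s c e₁ e₂ e₃ := by
  obtain ⟨x₀, hx₀⟩ := R.nonempty_I
  refine ⟨_, _, _, _, _, .IV i n m ty h₁ h₂ (fun t => E.D (t, x₀)) hi hA hB
    (fun t ht => (contDiffAt_D_comp contDiff_id contDiff_const ht hx₀).contDiffWithinAt)
    fun t ht x hx => ?_⟩
  refine eq_of_hasDerivAt_zero R.isOpen_I R.ordConnected_I (φ := fun x => E.D (t, x))
    (fun x hx => ?_) hx hx₀
  have h := hasDerivAt_D_line (E := E) (t := t) (x := 0) (a := 0) (b := 1) (s := x)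
    ⟨by simpa using ht, by simpa using hx⟩
  have e := hd.eqD t ht x hx
  simp only [mul_zero, add_zero, mul_one, zero_add, zero_mul, deriv_const', deriv_const] at h e
  rwa [e] at h

/-- Equations admitting `∂_t + k ∂_x`. -/
lemma listed_of_dt_dx {n m k : ℝ} {i : ℕ} {ty : LieType} {h₁ h₂ : ℝ → ℝ}
    (hi : ConstCase i n m ty h₁ h₂) (hk : 0 < k) (hA : ∀ x ∈ R.I, E.A x = n)
    (hB : ∀ x ∈ R.I, E.B x = m) (hd : Det E 0 1 k (fun _ => 0)) :
    ∃ s c e₁ e₂ e₃, Listed E s c e₁ e₂ e₃ := by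
  have hline : ∀ t ∈ R.J, ∀ x ∈ R.I, ∀ s, t + s * 1 ∈ R.J → x + s * k ∈ R.I →
      E.D (t + s * 1, x + s * k) = E.D (t, x) := by
    intro t ht x hx s hs hs'
    have := eq_of_hasDerivAt_zero (R.isOpen_line t x 1 k) (R.ordConnected_line t x 1 k)
      (φ := fun s => E.D (t + s * 1, x + s * k)) (x := s) (y := 0) (fun s hs => ?_)
      ⟨hs, hs'⟩ ⟨by simpa using ht, by simpa using hx⟩
    · simpa using this
    · have h := hasDerivAt_D_line (E := E) hs
      have e := hd.eqD _ hs.1 _ hs.2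
      simp only [mul_zero, add_zero, zero_add, zero_mul, deriv_const', deriv_const] at e
      rwa [e] at h
  have hfactor : ∃ G : ℝ → ℝ,
      ContDiffOn ℝ ∞ G {y | ∃ t ∈ R.J, ∃ x ∈ R.I, y = x - k * t} ∧
      ∀ z ∈ R.J ×ˢ R.I, E.D z = G (z.2 - k * z.1) := by
    refine exists_factor (W := R.J ×ˢ R.I) (P := fun z => z.2 - k * z.1) (Q := E.D)
      (T := {y | ∃ t ∈ R.J, ∃ x ∈ R.I, y = x - k * t}) ?_ ?_ ?_
    · rintro ⟨t, x⟩ ⟨ht, hx⟩ ⟨t', x'⟩ ⟨ht', hx'⟩ hp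
      simp only at ht hx ht' hx' hp
      have e1 : t + (t' - t) * 1 = t' := by ring
      have e2 : x + (t' - t) * k = x' := by linarith
      have := hline t ht x hx (t' - t) (by rwa [e1]) (by rwa [e2])
      rw [← this, e1, e2]
    · rintro y ⟨t, ht, x, hx, rfl⟩
      exact ⟨(t, x), ⟨ht, hx⟩, rfl⟩
    · rintro ⟨t, x⟩ ⟨ht, hx⟩
      simp only at ht hx ⊢
      have ex : x - k * t + k * t = x := by ring
      refine ⟨fun y => E.D (t, y + k * t), contDiffAt_D_comp (by fun_prop) (by fun_prop) ht
        (by rwa [ex]), ?_⟩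
      have c : ContinuousAt (fun y : ℝ => y + k * t) (x - k * t) := by fun_prop
      filter_upwards [c.preimage_mem_nhds (R.isOpen_I.mem_nhds (ex.symm ▸ hx))] with y hy
      exact ⟨(t, y + k * t), ⟨ht, hy⟩, by ring, rfl⟩
  obtain ⟨G, hG, hDG⟩ := hfactor
  exact ⟨_, _, _, _, _, .V i n m ty h₁ h₂ k G hi hk hA hB hG fun t ht x hx => hDG (t, x) ⟨ht, hx⟩⟩

/-- For `L f = 0` the Wronskian `w` of `f` and `ψ` satisfies `w' + A w = -f L ψ`, so `w = 0` gives
`f L ψ = 0`. Since `f` and `f'` have no common zero, `f` cannot vanish on a neighbourhood where `L ψ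
≠ 0`. Item II owes its two nonvanishing conditions to this. -/
lemma L_eq_zero_of_wr {f ψ : ℝ → ℝ} (hf : Det E 0 0 0 f) (hψ : ContDiffOn ℝ ∞ ψ R.I)
    (hf0 : ∀ x ∈ R.I, f x ≠ 0 ∨ deriv f x ≠ 0) (hw : ∀ x ∈ R.I, wr f ψ x = 0) :
    ∀ x ∈ R.I, E.L ψ x = 0 := by
  have hmul : ∀ x ∈ R.I, f x * E.L ψ x = 0 := fun x hx => by
    have h1 := hasDerivAt_wr hf.smooth hψ hx
    have h2 : HasDerivAt (wr f ψ) 0 x := by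
      refine (hasDerivAt_const x (0 : ℝ)).congr_of_eventuallyEq ?_
      filter_upwards [R.isOpen_I.mem_nhds hx] with y hy using hw y hy
    have e := h1.unique h2
    have e1 := (det_zero_iff.1 hf).2 x hx
    have e2 := hw x hx
    rw [Equation.L] at e1 ⊢
    rw [wr] at e2
    linear_combination ψ x * e1 - e - E.A x * e2
  intro x hx
  by_contra hL
  have hc := (CoeffRel.contDiffOn_L (E := E) hψ).continuousOn.continuousAt (R.isOpen_I.mem_nhds hx)
  have he : f =ᶠ[nhds x] fun _ => 0 := by
    filter_upwards [R.isOpen_I.mem_nhds hx, hc.eventually_ne hL] with y hy hy'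
    exact (mul_eq_zero.1 (hmul y hy)).resolve_right hy'
  rcases hf0 x hx with h | h
  exacts [h he.eq_of_nhds, h (by rw [he.deriv_eq, deriv_const])]

/-- Equations with `D` proportional to `t`. -/
lemma listed_of_linear {ψ : ℝ → ℝ} (hψ : ContDiffOn ℝ ∞ ψ R.I)
    (hD : ∀ t ∈ R.J, ∀ x ∈ R.I, E.D (t, x) = -t * E.L ψ x) :
    ∃ s c e₁ e₂ e₃, Listed E s c e₁ e₂ e₃ := by
  obtain ⟨f, φ, hfφ⟩ := exists_invariantForm E
  obtain ⟨hf, hφ, hw⟩ := invariantForm_iff.1 hfφ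
  by_cases hL : ∀ x ∈ R.I, E.L ψ x = 0
  · exact ⟨_, _, _, _, _, .I f φ hfφ fun t ht x hx => by rw [hD t ht x hx, hL x hx, mul_zero]⟩
  · refine ⟨_, _, _, _, _, .II f φ ψ hfφ hψ (fun t ht x hx => ?_) ?_ ?_ ?_⟩
    · rw [mul_assoc, hfφ.L_eq ψ hx, hD t ht x hx]; ring
    · by_contra hcon
      push Not at hcon
      refine hL (L_eq_zero_of_wr hf hψ (fun x hx => ?_) hcon)
      by_contra h0
      push Not at h0
      exact hw x hx (by rw [wr, h0.1, h0.2]; ring)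
    · by_contra hcon
      push Not at hcon
      refine hL (L_eq_zero_of_wr hφ hψ (fun x hx => ?_) hcon)
      by_contra h0
      push Not at h0
      exact hw x hx (by rw [wr, h0.1, h0.2]; ring)
    · push Not at hL
      obtain ⟨x, hx, hx'⟩ := hL
      by_contra hcon
      push Not at hcon
      obtain ⟨h, -⟩ := eq_zero_of_affine R.isOpen_J R.nonempty_J (a := -E.L ψ x) (b := 0)
        (fun t ht => by have := hcon t ht x hx; rw [hD t ht x hx] at this; linarith)
      exact hx' (neg_eq_zero.1 h)

/-- Equations with a three-dimensional algebra are related to listed ones. -/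
theorem exists_listed (hE : Module.finrank ℝ E.maxAlg = 3) :
    ∃ (R' : Region) (E' : Equation R') (k k₁ k₂ ε : ℝ) (g : ℝ → ℝ) (s : Item) (c : LieType)
      (e₁ e₂ e₃ : VF), R'.U = R.U ∧ CoeffRel E E' k k₁ k₂ ε g ∧ Listed E' s c e₁ e₂ e₃ := by
  obtain ⟨l, l₁, l₂, h, hd, hne, -⟩ := finrank_eq_three_iff.1 hE
  by_cases hl : l = 0
  swap
  -- With `l = 1` the operator vanishes in `(t, x)` at `(-l₁, -l₂)`; this centre is translated to
  -- the origin and `h` is gauged away.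
  · have hd := hd.smul l⁻¹
    rw [inv_mul_cancel₀ hl] at hd
    obtain ⟨g, h', hg, hd', hgh⟩ := hd.exists_gauge_dil
    obtain ⟨R', E', hU, C⟩ := exists_coeffRel E one_ne_zero (l⁻¹ * l₁) (l⁻¹ * l₂) (.inl rfl) hg
    have hp := C.det_push (h' := fun _ => 0) hd' fun x hx => by rw [one_mul x, hgh x hx]
    simp only [one_mul, sub_self] at hp
    obtain ⟨s, c, e₁, e₂, e₃, hL⟩ := listed_of_dil (C.finrank_eq hE) hp
    exact ⟨R', E', _, _, _, _, _, s, c, e₁, e₂, e₃, hU, C, hL⟩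
  subst hl
  by_cases hl₂ : l₂ = 0
  · subst hl₂
    have hl₁ : l₁ ≠ 0 := by tauto
    have hd := hd.smul l₁⁻¹
    rw [inv_mul_cancel₀ hl₁] at hd
    simp only [mul_zero] at hd
    set ψ := fun x => l₁⁻¹ * h x
    obtain ⟨x₀, hx₀⟩ := R.nonempty_I
    obtain ⟨t₀, ht₀⟩ := R.nonempty_J
    -- Here `D_t = -L ψ` depends on `x` only, so `D` is affine in `t`. A solution `g` of the
    -- inhomogeneous equation below then removes the part without `t`.
    have hlin : ∀ t ∈ R.J, ∀ x ∈ R.I,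
        E.D (t, x) = -t * E.L ψ x + (E.D (t₀, x) + t₀ * E.L ψ x) := by
      intro t ht x hx
      have := eq_of_hasDerivAt_zero R.isOpen_J R.ordConnected_J
        (φ := fun t => E.D (t, x) + t * E.L ψ x) (fun t ht => ?_) ht ht₀
      · linarith
      · have h := hasDerivAt_D_line (E := E) (t := 0) (x := x) (a := 1) (b := 0) (s := t)
          ⟨by simpa using ht, by simpa using hx⟩
        have e := hd.eqD t ht x hx
        simp only [mul_zero, add_zero, mul_one, zero_add, zero_mul] at h e
        refine (h.add ((hasDerivAt_id t).mul_const (E.L ψ x))).congr_deriv ?_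
        rw [Equation.L]
        linarith
    obtain ⟨g, hg, -, -, hgL⟩ := E.exists_solution (d := fun x => E.D (t₀, x) + t₀ * E.L ψ x)
      ((contDiffOn_D_snd ht₀).add (contDiffOn_const.mul (CoeffRel.contDiffOn_L hd.smooth))) hx₀ 0 0
    let E' : Equation R :=
      { E with
        D := fun y => -y.1 * E.L ψ y.2
        smooth_D := contDiff_fst.neg.contDiffOn.mul
          ((CoeffRel.contDiffOn_L hd.smooth).comp contDiffOn_snd fun y hy => hy.2) }
    have C : CoeffRel E E' 1 0 0 1 g := by
      refine ⟨one_ne_zero, .inl rfl, hg, by simp, by simp, by simp [E'], by simp [E'],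
        fun t ht x hx => ?_⟩
      rw [hgL x hx, hlin t ht x hx]
      simp [E']
    obtain ⟨s, c, e₁, e₂, e₃, hL⟩ := listed_of_linear (E := E') hd.smooth fun t _ x _ => rfl
    exact ⟨R, E', _, _, _, _, _, s, c, e₁, e₂, e₃, rfl, C, hL⟩
  · obtain ⟨x₀, hx₀⟩ := R.nonempty_I
    -- With `l = 0` and `l₂ ≠ 0` the first two determining equations say `A' = B' = 0`.
    have hA : ∀ x ∈ R.I, E.A x = E.A x₀ := fun x hx =>
      eq_of_hasDerivAt_zero R.isOpen_I R.ordConnected_I (fun x hx => by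
        have := hd.eqA x hx
        simp only [zero_mul, zero_add, add_zero] at this
        exact (mul_eq_zero.1 this).resolve_left hl₂ ▸ (E.differentiableAt_A hx).hasDerivAt) hx hx₀
    have hB : ∀ x ∈ R.I, E.B x = E.B x₀ := fun x hx =>
      eq_of_hasDerivAt_zero R.isOpen_I R.ordConnected_I (fun x hx => by
        have := hd.eqB x hx
        simp only [mul_zero, zero_mul, zero_add, add_zero] at this
        exact (mul_eq_zero.1 this).resolve_left hl₂ ▸ (E.differentiableAt_B hx).hasDerivAt) hx hx₀
    obtain ⟨κ, hκ, i, ty, h₁, h₂, hi⟩ := exists_constCase (E.A x₀) (E.B x₀)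
    obtain ⟨g, hg, hg'⟩ := exists_primitive R.isOpen_I R.ordConnected_I
      (hd.smooth.neg.div_const l₂)
    have hgh : ∀ x ∈ R.I, h x + (0 * x + l₂) * deriv g x = 0 := fun x hx => by
      rw [(hg' x hx).deriv]; field_simp; ring
    -- With `k = ε κ` the variable `x` is scaled by `ε k = κ` for either sign and only `t` sees `ε`.
    -- The normalisation of `A` and `B` therefore leaves `ε` free.
    have push : ∀ ε : ℝ, (ε = 1 ∨ ε = -1) → ∃ (R' : Region) (E' : Equation R'), R'.U = R.U ∧
        CoeffRel E E' (ε * κ) 0 0 ε g ∧ (∀ y ∈ R'.I, E'.A y = E.A x₀ / κ) ∧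
        (∀ y ∈ R'.I, E'.B y = E.B x₀ / κ ^ 2) ∧ Det E' 0 (ε * κ * l₁) (κ * l₂) (fun _ => 0) := by
      intro ε hε
      have ε2 : ε ^ 2 = 1 := by rcases hε with h | h <;> rw [h] <;> norm_num
      have hε0 : ε ≠ 0 := by rintro rfl; norm_num at ε2
      have εκ : ε * (ε * κ) = κ := by rw [← mul_assoc, ← sq, ε2, one_mul]
      obtain ⟨R', E', hU, C⟩ := exists_coeffRel E (mul_ne_zero hε0 hκ) 0 0 hε hg
      refine ⟨R', E', hU, C, fun y hy => ?_, fun y hy => ?_, ?_⟩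
      · obtain ⟨x, hx, rfl⟩ := C.exists_I hy
        have := C.eqA x hx
        rw [hA x hx] at this
        rw [this, εκ, mul_div_cancel_left₀ _ hκ]
      · obtain ⟨x, hx, rfl⟩ := C.exists_I hy
        have := C.eqB x hx
        rw [hB x hx, mul_pow, ε2, one_mul] at this
        rw [this, mul_div_cancel_left₀ _ (pow_ne_zero 2 hκ)]
      · have := C.det_push (h' := fun _ => 0) hd fun x hx => (hgh x hx).symm
        simpa only [zero_mul, sub_zero, εκ] using this
    by_cases hl₁ : l₁ = 0
    · obtain ⟨R', E', hU, C, hA', hB', hd'⟩ := push 1 (.inl rfl)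
      have hd'' := hd'.smul (κ * l₂)⁻¹
      rw [inv_mul_cancel₀ (mul_ne_zero hκ hl₂), hl₁] at hd''
      simp only [mul_zero] at hd''
      obtain ⟨s, c, e₁, e₂, e₃, hL⟩ := listed_of_dx hi hA' hB' hd''
      exact ⟨R', E', _, _, _, _, _, s, c, e₁, e₂, e₃, hU, C, hL⟩
    -- The free sign reverses `t` if necessary and makes the speed of the travelling variable
    -- positive.
    · obtain ⟨ε, hε, hpos⟩ : ∃ ε : ℝ, (ε = 1 ∨ ε = -1) ∧ 0 < ε * (l₂ / l₁) := by
        rcases lt_or_gt_of_ne (div_ne_zero hl₂ hl₁) with h | h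
        · exact ⟨-1, .inr rfl, by linarith⟩
        · exact ⟨1, .inl rfl, by linarith⟩
      obtain ⟨R', E', hU, C, hA', hB', hd'⟩ := push ε hε
      have hne' : ε * κ * l₁ ≠ 0 := mul_ne_zero C.k_ne hl₁
      have hd'' := hd'.smul (ε * κ * l₁)⁻¹
      rw [inv_mul_cancel₀ hne'] at hd''
      simp only [mul_zero] at hd''
      have hk : 0 < (ε * κ * l₁)⁻¹ * (κ * l₂) := by
        convert hpos using 1
        have ε2 : ε ^ 2 = 1 := by rcases hε with h | h <;> rw [h] <;> norm_num
        have hε0 : ε ≠ 0 := by rintro rfl; norm_num at ε2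
        field_simp
        rw [ε2]
      obtain ⟨s, c, e₁, e₂, e₃, hL⟩ := listed_of_dt_dx hi hk hA' hB' hd''
      exact ⟨R', E', _, _, _, _, _, s, c, e₁, e₂, e₃, hU, C, hL⟩

end NormalForms

/-! ### Different items are inequivalent -/

section Inequivalence

variable {R R' : Region} {E : Equation R} {E' : Equation R'}

/-- The number of the Euler case with parameters `n`, `m`. -/
noncomputable def eulerIndex (n m : ℝ) : ℕ :=
  if m = 0 then (if n = 1 then 2 else 1)
  else if n = 1 then (if 0 < m then 6 else 7)
  else if n = 0 then (if m = 1 / 4 then 3 else if 1 / 4 < m then 4 else 5)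
  else if m = 1 / 4 * (n - 1) ^ 2 then 8 else if 1 / 4 * (n - 1) ^ 2 < m then 9 else 10

lemma EulerCase.index_eq {i : ℕ} {n m : ℝ} {ty : LieType} {h₁ h₂ : ℝ → ℝ}
    (hi : EulerCase i n m ty h₁ h₂) : i = eulerIndex n m := by
  cases hi with
  | c1 n hn => simp [eulerIndex, hn]
  | c2 => simp [eulerIndex]
  | c3 => simp [eulerIndex]
  | c4 m β hm =>
    have h0 : m ≠ 0 := by linarith
    have h1 : m ≠ 1 / 4 := hm.ne'
    rw [eulerIndex, if_neg h0, if_neg zero_ne_one, if_pos rfl, if_neg h1, if_pos hm]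
  | c5 m β hm hm0 =>
    rw [eulerIndex, if_neg hm0, if_neg zero_ne_one, if_pos rfl, if_neg hm.ne, if_neg hm.not_gt]
  | c6 m hm => rw [eulerIndex, if_neg hm.ne', if_pos rfl, if_pos hm]
  | c7 m hm => rw [eulerIndex, if_neg hm.ne, if_pos rfl, if_neg hm.not_gt]
  | c8 n hn0 hn1 =>
    have h0 : 1 / 4 * (n - 1) ^ 2 ≠ 0 :=
      mul_ne_zero (by norm_num) (pow_ne_zero 2 (sub_ne_zero.2 hn1))
    rw [eulerIndex, if_neg h0, if_neg hn1, if_neg hn0, if_pos rfl]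
  | c9 n m β hn0 hn1 hm =>
    have h0 : m ≠ 0 := by nlinarith [sq_nonneg (n - 1)]
    rw [eulerIndex, if_neg h0, if_neg hn1, if_neg hn0, if_neg hm.ne', if_pos hm]
  | c10 n m β hn0 hn1 hm hm0 =>
    rw [eulerIndex, if_neg hm0, if_neg hn1, if_neg hn0, if_neg hm.ne, if_neg hm.not_gt]

/-- The number of the case with constant coefficients `n`, `m`. -/
noncomputable def constIndex (n m : ℝ) : ℕ :=
  if n = 0 then (if m = 0 then 1 else if 0 < m then 3 else 4)
  else if m = 0 then 2 else if m = 1 / 4 then 5 else if m < 1 / 4 then 6 else 7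

lemma ConstCase.index_eq {i : ℕ} {n m : ℝ} {ty : LieType} {h₁ h₂ : ℝ → ℝ}
    (hi : ConstCase i n m ty h₁ h₂) : (n = 0 ∨ n = -1) ∧ i = constIndex n m := by
  have h1 : (-1 : ℝ) ≠ 0 := by norm_num
  cases hi with
  | c1 => simp [constIndex]
  | c2 => simp [constIndex]
  | c3 => simp [constIndex]
  | c4 => norm_num [constIndex]
  | c5 => norm_num [constIndex]
  | c6 m β hm hm0 =>
    refine ⟨.inr rfl, ?_⟩
    rw [constIndex, if_neg h1, if_neg hm0, if_neg hm.ne, if_pos hm]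
  | c7 m β hm =>
    have h0 : m ≠ 0 := by linarith
    refine ⟨.inr rfl, ?_⟩
    rw [constIndex, if_neg h1, if_neg h0, if_neg hm.ne', if_neg hm.not_gt]

/-- In the list `n` is `0` or `-1`. If `n' = -1`, then `n ≠ 0`, so `n = -1` and `κ = 1`; if `n' =
0`, only the sign of `m` matters, and the factor `κ²` preserves it. -/
lemma ConstCase.index_unique {i i' : ℕ} {n m n' m' κ : ℝ} {ty ty' : LieType}
    {h₁ h₂ h₁' h₂' : ℝ → ℝ} (hi : ConstCase i n m ty h₁ h₂) (hi' : ConstCase i' n' m' ty' h₁' h₂')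
    (hκ : κ ≠ 0) (hn : n = κ * n') (hm : m = κ ^ 2 * m') : i = i' := by
  obtain ⟨h, rfl⟩ := hi.index_eq
  obtain ⟨h', rfl⟩ := hi'.index_eq
  rcases h' with rfl | rfl
  · rw [mul_zero] at hn
    have hpos : 0 < κ ^ 2 := by positivity
    subst hn hm
    simp only [constIndex, if_true, mul_eq_zero, hpos.ne', false_or, mul_pos_iff_of_pos_left hpos]
  · have : n = -1 := h.resolve_left (by rw [hn]; simpa using hκ)
    have hκ1 : κ = 1 := by linarith
    rw [hn, hm, hκ1, one_pow, one_mul, one_mul]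

/-- The items with the same operator outside the span of the `h u ∂_u`. -/
def Item.kind : Item → ℕ
  | .I => 0
  | .II => 0
  | .III _ => 1
  | .IV _ => 2
  | .V _ => 3

lemma Item.Vec.kind {s : Item} {l l₁ l₂ : ℝ} (h : s.Vec l l₁ l₂) :
    (s.kind = 0 ∧ l = 0 ∧ l₁ = 1 ∧ l₂ = 0) ∨ (s.kind = 1 ∧ l = 1 ∧ l₁ = 0 ∧ l₂ = 0) ∨
    (s.kind = 2 ∧ l = 0 ∧ l₁ = 0 ∧ l₂ = 1) ∨ (s.kind = 3 ∧ l = 0 ∧ l₁ = 1 ∧ l₂ ≠ 0) := by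
  cases s
  · exact .inl ⟨rfl, h⟩
  · exact .inl ⟨rfl, h⟩
  · exact .inr (.inl ⟨rfl, h⟩)
  · exact .inr (.inr (.inl ⟨rfl, h⟩))
  · exact .inr (.inr (.inr ⟨rfl, h.1, h.2.1, h.2.2.ne'⟩))

/-- The two directions agree up to a factor and an invertible change in which `l` stays fixed; which
of `l`, `l₁`, `l₂` vanish then separates the kinds. A dilation has its centre in `x` at the origin
in both equations, which rules out a translation of `x`. -/
lemma Item.Vec.kind_eq {s s' : Item} {l l₁ l₂ l' l₁' l₂' k κ k₁ k₂ α : ℝ} (h : s.Vec l l₁ l₂)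
    (h' : s'.Vec l' l₁' l₂') (hk : k ≠ 0) (hκ : κ ≠ 0) (e : l' = α * l)
    (e₁ : l₁' + l' * k₁ = α * l₁ * k) (e₂ : l₂' + l' * k₂ = α * l₂ * κ) :
    s.kind = s'.kind ∧ (s.kind = 1 → k₂ = 0) := by
  have hs := h.kind
  have hs' := h'.kind
  clear h h'
  rcases hs with ⟨h, rfl, rfl, rfl⟩ | ⟨h, rfl, rfl, rfl⟩ | ⟨h, rfl, rfl, rfl⟩ | ⟨h, rfl, rfl, h2⟩ <;>
  rcases hs' with ⟨h', rfl, rfl, rfl⟩ | ⟨h', rfl, rfl, rfl⟩ | ⟨h', rfl, rfl, rfl⟩ |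
    ⟨h', rfl, rfl, h2'⟩ <;>
  rw [h, h'] <;>
  first
  | exact ⟨rfl, fun _ => by linarith⟩
  | (exfalso
     simp only [mul_zero, zero_mul, add_zero, mul_one, one_mul] at e e₁ e₂
     grind)

lemma eq_zero_of_linear {S : Set ℝ} (hS : IsOpen S) (hne : S.Nonempty) {a b : ℝ}
    (h : ∀ t ∈ S, t * a = b) : a = 0 :=
  (eq_zero_of_affine hS hne (a := a) (b := -b) fun t ht => by linarith [h t ht]).1

/-- Since the algebra of `E` has dimension three, the extra operator of `E'`, pulled back, is
proportional in direction to that of `E`, which fixes the kind. Within item III the parameters `n`,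
`m` are invariant; within IV and V they change by `κ`, `κ²`. Items I and II differ because a
transformation adds only the `t`-free term `L g` to a rescaled `D`, so it cannot produce or remove a
nonzero slope in `t`. -/
theorem item_eq {s s' : Item} {c c' : LieType} {e₁ e₂ e₃ e₁' e₂' e₃' : VF}
    (hL : Listed E s c e₁ e₂ e₃) (hm : E.maxAlg = Submodule.span ℝ {e₁, e₂, e₃})
    (hL' : Listed E' s' c' e₁' e₂' e₃') (h : Equivalent E E') : s = s' := by
  obtain ⟨k, k₁, k₂, ε, g, C⟩ := h.exists_coeffRel
  have hk := C.k_ne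
  have hεk := C.εk_ne
  have ε2 := C.ε_sq
  obtain ⟨hkind, hk₂⟩ : s.kind = s'.kind ∧ (s.kind = 1 → k₂ = 0) := by
    obtain ⟨l, l₁, l₂, h, h₁, h₂, a, b, c, d, T, hs, hv⟩ := hL.exists_triple
    obtain ⟨l', l₁', l₂', h', h₁', h₂', a', b', c', d', T', -, hv'⟩ := hL'.exists_triple
    have hE : Module.finrank ℝ E.maxAlg = 3 := by rw [hm, hs]; exact T.finrank_span
    obtain ⟨α, e0, e1, e2⟩ := T.det.proportional hE T.ne
      (C.det T'.det (l₁ := (l₁' + l' * k₁) / k) (l₂ := (l₂' + l' * k₂) / (ε * k))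
        (by field_simp; ring) (by rw [mul_div_cancel₀ _ hεk]; ring))
    exact hv.kind_eq hv' hk hεk e0 ((div_eq_iff hk).1 e1) ((div_eq_iff hεk).1 e2)
  obtain ⟨t₀, ht₀⟩ := R.nonempty_J
  obtain ⟨x₀, hx₀⟩ := R.nonempty_I
  cases hL with
  | I f φ hf hD =>
    cases hL' with
    | I => rfl
    | II f' φ' ψ' hf' hψ' hD' _ _ hD0 =>
      exfalso
      obtain ⟨t, ht, y, hy, h0⟩ := hD0
      obtain ⟨x, hx, rfl⟩ := C.exists_I hy
      rw [hD' t ht _ hy, mul_assoc] at h0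
      refine right_ne_zero_of_mul h0 (eq_zero_of_linear R'.isOpen_J R'.nonempty_J
        (b := -E.L g x / k ^ 2) fun s hs => ?_)
      obtain ⟨r, hr, rfl⟩ := C.exists_J hs
      have e := C.eqD r hr x hx
      rw [hD r hr x hx, hD' _ hs _ hy] at e
      rw [eq_div_iff (pow_ne_zero 2 hk)]
      linear_combination -e
    | III => simp [Item.kind] at hkind
    | IV => simp [Item.kind] at hkind
    | V => simp [Item.kind] at hkind
  | II f φ ψ hf hψ hD _ _ hD0 =>
    cases hL' with
    | I f' φ' hf' hD' =>
      exfalso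
      obtain ⟨t, ht, x, hx, h0⟩ := hD0
      rw [hD t ht _ hx, mul_assoc] at h0
      refine right_ne_zero_of_mul h0 (eq_zero_of_linear R.isOpen_J R.nonempty_J
        (b := E.L g x) fun s hs => ?_)
      have e := C.eqD s hs x hx
      rw [hD s hs x hx, hD' _ (C.mem_J hs) _ (C.mem_I hx), mul_zero, zero_add] at e
      rw [← e]
      ring
    | II => rfl
    | III => simp [Item.kind] at hkind
    | IV => simp [Item.kind] at hkind
    | V => simp [Item.kind] at hkind
  | III i n m c h₁ h₂ G hi hA hB =>
    cases hL' with
    | I => simp [Item.kind] at hkind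
    | II => simp [Item.kind] at hkind
    | III i' n' m' c' h₁' h₂' G' hi' hA' hB' =>
      obtain ⟨x, hx, hx0⟩ := R.exists_ne_zero
      have h2 := hk₂ rfl
      subst h2
      have hx' := mul_ne_zero hεk hx0
      have hxm := C.mem_I hx
      have eA := C.eqA x hx
      have eB := C.eqB x hx
      rw [add_zero] at hxm eA eB
      rw [hA x hx hx0, hA' _ hxm hx', mul_inv, mul_left_comm, ← mul_assoc (ε * k),
        mul_inv_cancel₀ hεk, one_mul] at eA
      rw [hB x hx hx0, hB' _ hxm hx', mul_pow, mul_pow, ε2, one_mul, mul_inv, mul_left_comm,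
        ← mul_assoc (k ^ 2), mul_inv_cancel₀ (pow_ne_zero 2 hk), one_mul] at eB
      rw [hi.index_eq, hi'.index_eq, mul_right_cancel₀ (inv_ne_zero hx0) eA,
        mul_right_cancel₀ (inv_ne_zero (pow_ne_zero 2 hx0)) eB]
    | IV => simp [Item.kind] at hkind
    | V => simp [Item.kind] at hkind
  | IV i n m c h₁ h₂ G hi hA hB =>
    cases hL' with
    | I => simp [Item.kind] at hkind
    | II => simp [Item.kind] at hkind
    | III => simp [Item.kind] at hkind
    | IV i' n' m' c' h₁' h₂' G' hi' hA' hB' =>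
      have eA := C.eqA x₀ hx₀
      have eB := C.eqB x₀ hx₀
      rw [hA x₀ hx₀, hA' _ (C.mem_I hx₀)] at eA
      rw [hB x₀ hx₀, hB' _ (C.mem_I hx₀)] at eB
      rw [hi.index_unique hi' hεk eA (by rw [mul_pow, ε2, one_mul, eB])]
    | V => simp [Item.kind] at hkind
  | V i n m c h₁ h₂ κ G hi hκ hA hB =>
    cases hL' with
    | I => simp [Item.kind] at hkind
    | II => simp [Item.kind] at hkind
    | III => simp [Item.kind] at hkind
    | IV => simp [Item.kind] at hkind
    | V i' n' m' c' h₁' h₂' κ' G' hi' hκ' hA' hB' =>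
      have eA := C.eqA x₀ hx₀
      have eB := C.eqB x₀ hx₀
      rw [hA x₀ hx₀, hA' _ (C.mem_I hx₀)] at eA
      rw [hB x₀ hx₀, hB' _ (C.mem_I hx₀)] at eB
      rw [hi.index_unique hi' hεk eA (by rw [mul_pow, ε2, one_mul, eB])]

end Inequivalence
end WaveClassification

/-- Group classification of `u_tt = u_xx - u⁻¹ u_x² + A(x) u_x + B(x) u ln|u| + u D(t,x)`:
the generic case, and the equations with three-dimensional maximal invariance algebra. -/
theorem mainTheorem12 :
    -- every equation of the class has the form invariant under `⟨f u ∂_u, g u ∂_u⟩`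
    (∀ (R : WaveClassification.Region) (E : WaveClassification.Equation R),
      ∃ f g : ℝ → ℝ, WaveClassification.InvariantForm E f g ∧
        R.mulU f ∈ E.maxAlg ∧ R.mulU g ∈ E.maxAlg) ∧
    -- for generic coefficients this two-dimensional abelian algebra is maximal
    (∀ R : WaveClassification.Region, ∃ 𝒢 : Set (WaveClassification.Equation R),
      IsOpen 𝒢 ∧ Dense 𝒢 ∧ ∀ E ∈ 𝒢, ∀ f g : ℝ → ℝ, WaveClassification.InvariantForm E f g →
        E.maxAlg = Submodule.span ℝ {R.mulU f, R.mulU g} ∧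
        LinearIndependent ℝ ![R.mulU f, R.mulU g] ∧
        WaveClassification.bracket (R.mulU f) (R.mulU g) = 0) ∧
    -- every equation with three-dimensional maximal algebra is equivalent to a listed one, whose
    -- maximal algebra is the listed algebra
    (∀ (R : WaveClassification.Region) (E : WaveClassification.Equation R),
      Module.finrank ℝ E.maxAlg = 3 →
      ∃ (R' : WaveClassification.Region) (E' : WaveClassification.Equation R')
        (s : WaveClassification.Item) (c : WaveClassification.LieType)
        (e₁ e₂ e₃ : WaveClassification.VF),
        WaveClassification.Equivalent E E' ∧ WaveClassification.Listed E' s c e₁ e₂ e₃ ∧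
        E'.maxAlg = Submodule.span ℝ {e₁, e₂, e₃} ∧ WaveClassification.HasType E.maxAlg c) ∧
    -- every listed equation admits the listed algebra, which has the listed type
    (∀ (R : WaveClassification.Region) (E : WaveClassification.Equation R)
      (s : WaveClassification.Item) (c : WaveClassification.LieType)
      (e₁ e₂ e₃ : WaveClassification.VF), WaveClassification.Listed E s c e₁ e₂ e₃ →
        Submodule.span ℝ {e₁, e₂, e₃} ≤ E.maxAlg ∧
        WaveClassification.HasType (Submodule.span ℝ {e₁, e₂, e₃}) c) ∧
    -- different items of the list are inequivalent
    (∀ (R R' : WaveClassification.Region) (E : WaveClassification.Equation R)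
      (E' : WaveClassification.Equation R') (s s' : WaveClassification.Item)
      (c c' : WaveClassification.LieType) (e₁ e₂ e₃ e₁' e₂' e₃' : WaveClassification.VF),
      WaveClassification.Listed E s c e₁ e₂ e₃ → E.maxAlg = Submodule.span ℝ {e₁, e₂, e₃} →
      WaveClassification.Listed E' s' c' e₁' e₂' e₃' →
      E'.maxAlg = Submodule.span ℝ {e₁', e₂', e₃'} →
      WaveClassification.Equivalent E E' → s = s') := by
  refine ⟨fun R E => ?_, WaveClassification.exists_generic, fun R E hE => ?_,
    fun R E s c e₁ e₂ e₃ hL => ?_, fun R R' E E' s s' c c' e₁ e₂ e₃ e₁' e₂' e₃' hL hm hL' _ h =>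
      WaveClassification.item_eq hL hm hL' h⟩
  · obtain ⟨f, g, hfg⟩ := WaveClassification.exists_invariantForm E
    obtain ⟨hf, hg, -⟩ := WaveClassification.invariantForm_iff.1 hfg
    exact ⟨f, g, hfg, hf.mem_maxAlg, hg.mem_maxAlg⟩
  · obtain ⟨R', E', k, k₁, k₂, ε, g, s, c, e₁, e₂, e₃, hU, C, hL⟩ :=
      WaveClassification.exists_listed hE
    exact C.classification hU hE hL
  · obtain ⟨l, l₁, l₂, h, h₁, h₂, α, β, γ, δ, T, hs, -⟩ := hL.exists_triple
    rw [hs]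
    exact ⟨T.span_le, T.hasType⟩
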